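/- **Setting.** Let $\mathbb F$ be an algebraically closed field of characteristic $p>3$, let $m=2r\ge 2$ be even, let $n=2s+1\ge 1$ be odd, and let $\underline t=(t_1,\dots,t_m)$ be positive integers; put $\pi_i=p^{t_i}-1$. Let $\mathcal O(m,n)$ be the tensor product of the divided power algebra with basis $x^{(\alpha)}$ ($\alpha\in\mathbb N^m$, $x^{(\alpha)}x^{(\beta)}=\binom{\alpha+\beta}{\alpha}x^{(\alpha+\beta)}$) and the exterior algebra in $x_{m+1},\dots,x_{m+n}$. It has the basis $x^{(\alpha)}x^u$, where for $u=\{i_1<\dots<i_k\}\subseteq I_1$ we write $x^u=x_{i_1}\cdots x_{i_k}$, $|u|=k$. Put $I_0=\{1,\dots,m\}$, $I_1=\{m+1,\dots,m+n\}$, $I=I_0\cup I_1$, $\omega=I_1$; $\mu(i)=0$ for $i\in I_0$ and $\mu(i)=1$ for $i\in I_1$; $p(f)$ denotes the parity of $f$. Let $\partial_i$ ($i\in I$) be the superderivations with $\partial_i(x^{(\alpha)})=x^{(\alpha-\varepsilon_i)}$ for $i\in I_0$ (zero if $\alpha_i=0$) and $\partial_i(x_k)=\delta_{ik}$ for $i\in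 I_1$, where $\partial_i$ ($i\in I_0$) kills $x_{m+1},\dots,x_{m+n}$ and $\partial_i$ ($i\in I_1$) kills all $x^{(\alpha)}$. Let $W$ be the Lie superalgebra spanned by the $x^{(\alpha)}x^u\partial_j$ with $\alpha_i\le\pi_i$ for all $i\in I_0$, $u\subseteq I_1$, $j\in I$, with the supercommutator as bracket. Let $W_{\bar 1}$ be its odd part, and $W_d$ the span of those $x^{(\alpha)}x^u\partial_j$ with $|\alpha|+|u|=d+1$. Put $$D_H(f)=\sum_{i\in I}\tau(i)(-1)^{\mu(i)p(f)}\partial_i(f)\,\partial_{i'},$$ where $i'=i+r$ for $1\le i\le r$, $i'=i-r$ for $r<i\le m$, $i'=i+s$ for $m<i\le m+s$, $i'=i-s$ for $m+s<i\le m+2s$, $(m+n)'=m+n$, and $\tau(i)=-1$ for $r<i\le m$, $\tau(i)=1$ otherwise. Let $H_{\bar 0}$ be the span of the $D_H(x^{(\alpha)}x^u)$ with $\alpha\le\pi$, $|u|$ even and $(\alpha,u)\ne(\pi,\omega)$, and let $\mathcal J\subset H_{\bar 0}$ be the span of those with, in addition, $(\alpha,u)\neq(\pi,\emptyset)$. It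 is an ideal of $H_{\bar 0}$, graded by $\mathcal J_k=\mathcal J\cap W_k$. For $i\in I_0$ and $q\in\mathbb N$ define linear maps on $H_{\bar 0}$ by $$\Phi_i^{(q)}(D_H(f))=\partial_i^{\,p^q}(f)\,D_H(x^\omega),\qquad \Theta_i^{(q)}(E)=x^\omega\,(\mathrm{ad}\,\partial_i)^{p^q}(E),$$ and put $\mathfrak D=\sum_{k\in I_1}x_kx_{m+n}\partial_k\in W_{\bar 1}$. **Proposition 4.7.** Let $\varphi:\mathcal J\to W_{\bar 1}$ be a derivation, that is, a linear map with $\varphi([x,y])=[\varphi(x),y]+[x,\varphi(y)]$ for all $x,y\in\mathcal J$. Suppose that $\varphi$ is $\mathbb Z$-homogeneous (there is $d\in\mathbb Z$ with $\varphi(\mathcal J_k)\subseteq W_{k+d}$ for all $k$) and that $\varphi(\mathcal J_{-1}\oplus\mathcal J_0)=0$. Then there are scalars $\lambda,\lambda_i^{(q)},\mu_i^{(q)}\in\mathbb F$ ($i\in I_0$, $1\le q\le t_i-1$) such that $$\varphi=\lambda\,\mathrm{ad}\,\mathfrak D+\sum_{i\in I_0}\ \sum_{1\le q\le t_i-1}\bigl(\lambda_i^{(q)}\Phi_i^{(q)}+\mu_i^{(q)}\Theta_i^{(q)}\bigr)\quad\text{on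 }\mathcal J.$$ -/

import Mathlib

noncomputable section

namespace HamSuper

/-! ## The superalgebra `𝒪(m,n)`: divided powers tensor exterior algebra

The even index set `I₀` is `Fin m`, the odd index set `I₁` is `Fin n`: the element `k` of `Fin n`
stands for the variable `x_{m+1+k}`.  -/

/-- The underlying space of `𝒪(m,n) = 𝒪(m) ⊗ Λ(n)`, with basis `x^(α) x^u`, where `α ∈ ℕ^m` and
`u` is a set of odd indices (listed increasingly). -/
def SuperO (F : Type*) [Field F] (m n : ℕ) : Type _ := ((Fin m → ℕ) × Finset (Fin n)) →₀ F

instance (F : Type*) [Field F] (m n : ℕ) : AddCommGroup (SuperO F m n) :=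
  inferInstanceAs (AddCommGroup (((Fin m → ℕ) × Finset (Fin n)) →₀ F))

instance (F : Type*) [Field F] (m n : ℕ) : Module F (SuperO F m n) :=
  inferInstanceAs (Module F (((Fin m → ℕ) × Finset (Fin n)) →₀ F))

/-- Linear endomorphisms of `𝒪(m,n)`. -/
abbrev EndO (F : Type*) [Field F] (m n : ℕ) : Type _ := Module.End F (SuperO F m n)

variable (F : Type*) [Field F] {m n : ℕ}

/-- The standard basis of `𝒪(m,n)`. -/
def stdBasis (m n : ℕ) : Module.Basis ((Fin m → ℕ) × Finset (Fin n)) F (SuperO F m n) :=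
  Module.Basis.ofRepr (LinearEquiv.refl F (((Fin m → ℕ) × Finset (Fin n)) →₀ F))

/-- The basis monomial `x^(α) x^u`. -/
def mono (α : Fin m → ℕ) (u : Finset (Fin n)) : SuperO F m n := stdBasis F m n (α, u)

/-- The linear map on `𝒪(m,n)` that sends `x^(α) x^u` to `g (α, u)`. -/
def ofMono {V : Type*} [AddCommGroup V] [Module F V] (g : (Fin m → ℕ) × Finset (Fin n) → V) :
    SuperO F m n →ₗ[F] V := (stdBasis F m n).constr F g

theorem ofMono_mono {V : Type*} [AddCommGroup V] [Module F V]
    (g : (Fin m → ℕ) × Finset (Fin n) → V) (α : Fin m → ℕ) (u : Finset (Fin n)) :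
    ofMono F g (mono F α u) = g (α, u) := (stdBasis F m n).constr_basis F g (α, u)

/-- Number of pairs `(i, j) ∈ u × v` with `j < i`: `x^u x^v = (-1)^(inversions u v) x^(u ∪ v)` for
disjoint `u`, `v`. -/
def inversions (u v : Finset (Fin n)) : ℕ := ((u ×ˢ v).filter fun x => x.2 < x.1).card

/-- Multiplication of `𝒪(m,n)`:
`x^(α) x^u · x^(β) x^v = ∏ᵢ (αᵢ+βᵢ choose αᵢ) x^(α+β) x^u x^v`. -/
def mul : SuperO F m n →ₗ[F] SuperO F m n →ₗ[F] SuperO F m n :=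
  ofMono F fun a => ofMono F fun b =>
    if Disjoint a.2 b.2 then
      ((-1 : F) ^ inversions a.2 b.2 * ∏ i, ((a.1 i + b.1 i).choose (a.1 i) : F)) •
        mono F (a.1 + b.1) (a.2 ∪ b.2)
    else 0

/-- The even derivation `∂_i`, `i ∈ I₀`: `x^(α) x^u ↦ x^(α-ε_i) x^u` (zero if `α_i = 0`). -/
def partialEven (i : Fin m) : EndO F m n :=
  ofMono F fun a =>
    if a.1 i = 0 then 0 else mono F (a.1 - Pi.single i 1) a.2

/-- The odd superderivation `∂_k`, `k ∈ I₁`, with `∂_k(x_l) = δ_{kl}`. -/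
def partialOdd (k : Fin n) : EndO F m n :=
  ofMono F fun a =>
    if k ∈ a.2 then (-1 : F) ^ (a.2.filter (· < k)).card • mono F a.1 (a.2.erase k) else 0

/-- The superderivations `∂_r`, `r ∈ I = I₀ ⊔ I₁`. -/
def pd : Fin m ⊕ Fin n → EndO F m n := Sum.elim (partialEven F) (partialOdd F)

/-- `f D`: the operator `g ↦ f · D(g)`. -/
def leftMul (f : SuperO F m n) (D : EndO F m n) : EndO F m n := mul F f ∘ₗ D

/-- The parity involution `f ↦ (-1)^{p(f)} f`. -/
def parityInv : EndO F m n :=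
  ofMono F fun a => (-1 : F) ^ a.2.card • mono F a.1 a.2

/-- The index map `i ↦ i'` on `{0, …, k-1}`, with `h = ⌊k/2⌋`: exchange `i` and `i + h` for
`i < h`, and fix the last index if `k` is odd. -/
def conj {k : ℕ} (i : Fin k) : Fin k :=
  if h : i.1 < k / 2 then ⟨i.1 + k / 2, by omega⟩
  else if i.1 < 2 * (k / 2) then ⟨i.1 - k / 2, by omega⟩
  else i

/-- The sign `τ(i)` for `i ∈ I₀`. -/
def tau (i : Fin m) : F := if i.1 < m / 2 then 1 else -1

/-- The Hamiltonian operator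
`D_H(f) = ∑_{i ∈ I} τ(i) (-1)^{μ(i) p(f)} ∂_i(f) ∂_{i'}`. -/
def DH : SuperO F m n →ₗ[F] EndO F m n where
  toFun f := (∑ i : Fin m, tau F i • leftMul F (partialEven F i f) (partialEven F (conj i))) +
    ∑ k : Fin n, leftMul F (partialOdd F k (parityInv F f)) (partialOdd F (conj k))
  map_add' f g := by
    simp only [leftMul, map_add, LinearMap.add_comp, smul_add, Finset.sum_add_distrib]
    abel
  map_smul' c f := by
    simp only [leftMul, map_smul, LinearMap.smul_comp, RingHom.id_apply, smul_add,
      Finset.smul_sum, smul_comm c]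

/-! ## The truncated objects, depending on the heights `t` -/

variable (n) (p : ℕ) (t : Fin m → ℕ)

/-- The tuple `π`, `π_i = p^{t_i} - 1`. -/
def topExp : Fin m → ℕ := fun i => p ^ t i - 1

/-- The odd part `W_1̄` of `W(m,n;t)`: span of the `x^(α) x^u ∂_r`, `α ≤ π`, that are odd. -/
def WOdd : Submodule F (EndO F m n) :=
  Submodule.span F {D | ∃ (α : Fin m → ℕ) (u : Finset (Fin n)) (r : Fin m ⊕ Fin n),
    α ≤ topExp p t ∧ Odd (u.card + Sum.elim (fun _ => 0) (fun _ => 1) r) ∧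
    D = leftMul F (mono F α u) (pd F r)}

/-- The component of `ℤ`-degree `d` of `W(m,n;t)`: span of the `x^(α) x^u ∂_r`, `α ≤ π`, with
`|α| + |u| = d + 1`. -/
def WDeg (d : ℤ) : Submodule F (EndO F m n) :=
  Submodule.span F {D | ∃ (α : Fin m → ℕ) (u : Finset (Fin n)) (r : Fin m ⊕ Fin n),
    α ≤ topExp p t ∧ (((∑ i, α i) + u.card : ℕ) : ℤ) = d + 1 ∧
    D = leftMul F (mono F α u) (pd F r)}

/-- Span of the `x^(α) x^u` with `α ≤ π`, `|u|` even, `(α,u) ≠ (π,ω)`. -/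
def evenO : Submodule F (SuperO F m n) :=
  Submodule.span F {f | ∃ (α : Fin m → ℕ) (u : Finset (Fin n)),
    α ≤ topExp p t ∧ Even u.card ∧ (α, u) ≠ (topExp p t, Finset.univ) ∧ f = mono F α u}

/-- Span of the `x^(α) x^u` with `α ≤ π`, `|u|` even, `(α,u) ≠ (π,ω)` and `(α,u) ≠ (π,∅)`. -/
def idealO : Submodule F (SuperO F m n) :=
  Submodule.span F {f | ∃ (α : Fin m → ℕ) (u : Finset (Fin n)),
    α ≤ topExp p t ∧ Even u.card ∧ (α, u) ≠ (topExp p t, Finset.univ) ∧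
    (α, u) ≠ (topExp p t, ∅) ∧ f = mono F α u}

/-- The even part `H_0̄` of the Hamiltonian superalgebra `H(m,n;t)`. -/
def HEven : Submodule F (EndO F m n) := (evenO F n p t).map (DH F)

/-- The ideal `𝒥` of codimension one in `H_0̄`. -/
def J : Submodule F (EndO F m n) := (idealO F n p t).map (DH F)

theorem J_le_HEven : J F n p t ≤ HEven F n p t := by
  refine Submodule.map_mono (Submodule.span_mono ?_)
  rintro f ⟨α, u, h1, h2, h3, -, h4⟩
  exact ⟨α, u, h1, h2, h3, h4⟩

/-! ## Well-definedness of `D_H(f) ↦ ∂_i^{p^q}(f) D_H(x^ω)` -/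

variable {n}

theorem conj_conj {k : ℕ} (i : Fin k) : conj (conj i) = i := by
  ext
  by_cases h : i.1 < k / 2
  · have h2 : ¬ i.1 + k / 2 < k / 2 := by omega
    have h3 : i.1 + k / 2 < 2 * (k / 2) := by omega
    simp [conj, h, h3]
  · by_cases h' : i.1 < 2 * (k / 2)
    · have h2 : i.1 - k / 2 < k / 2 := by omega
      simp only [conj, h, h', h2, dite_true, dite_false, if_true]
      omega
    · simp [conj, h, h']

theorem mul_one' (f : SuperO F m n) : mul F f (mono F 0 ∅) = f := by
  suffices h : (mul F).flip (mono F 0 ∅) = (LinearMap.id : EndO F m n) from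
    LinearMap.congr_fun h f
  refine (stdBasis F m n).ext fun a => ?_
  change mul F (mono F a.1 a.2) (mono F 0 ∅) = mono F a.1 a.2
  have h1 : inversions a.2 ∅ = 0 := by simp [inversions]
  rw [mul, ofMono_mono, ofMono_mono, if_pos (Finset.disjoint_empty_right _), h1]
  simp

theorem partialEven_eq_zero_of_DH {f : SuperO F m n} (hf : DH F f = 0) (i : Fin m) :
    partialEven F i f = 0 := by
  have h := congrArg (fun D => D (mono F (Pi.single (conj i) 1) ∅)) hf
  have h1 : ∀ j : Fin m, partialEven F (n := n) (conj j) (mono F (Pi.single (conj i) 1) ∅)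
      = if j = i then mono F 0 ∅ else 0 := by
    intro j
    by_cases hj : j = i
    · subst hj
      simp [partialEven, ofMono_mono]
    · have : conj j ≠ conj i := fun e => hj (by rw [← conj_conj j, e, conj_conj])
      simp [partialEven, ofMono_mono, hj, this]
  have h2 : ∀ k : Fin n, partialOdd F (m := m) k (mono F (Pi.single (conj i) 1) ∅) = 0 := by
    intro k
    simp [partialOdd, ofMono_mono]
  simp only [DH, LinearMap.coe_mk, AddHom.coe_mk, LinearMap.add_apply, LinearMap.sum_apply,
    LinearMap.smul_apply, leftMul, LinearMap.comp_apply, h1, h2, map_zero,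
    Finset.sum_const_zero, add_zero, LinearMap.zero_apply] at h
  rw [Finset.sum_eq_single i (fun j _ hj => by simp [hj]) (fun hi => absurd (Finset.mem_univ i) hi)]
    at h
  rw [if_pos rfl, mul_one'] at h
  refine (smul_eq_zero.mp h).resolve_left ?_
  unfold tau
  split_ifs <;> simp

variable (n)

/-- `x^ω`, the product of all odd variables. -/
def xOmega : SuperO F m n := mono F 0 Finset.univ

/-- The map `f ↦ ∂_i^{p^q}(f) D_H(x^ω)`. -/
def preΦ (i : Fin m) (q : ℕ) : SuperO F m n →ₗ[F] EndO F m n :=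
  (LinearMap.lcomp F (SuperO F m n) (DH F (xOmega F n))) ∘ₗ mul F ∘ₗ
    (partialEven F i ^ p ^ q)

theorem preΦ_apply (i : Fin m) (q : ℕ) (f : SuperO F m n) :
    preΦ F n p i q f = leftMul F ((partialEven F i ^ p ^ q) f) (DH F (xOmega F n)) := rfl

theorem ker_le_ker_preΦ [Fact p.Prime] (i : Fin m) (q : ℕ) :
    LinearMap.ker ((DH F).submoduleMap (evenO F n p t)) ≤
      LinearMap.ker (preΦ F n p i q ∘ₗ (evenO F n p t).subtype) := by
  intro f hf
  have hf' : DH F (f : SuperO F m n) = 0 := congrArg Subtype.val (LinearMap.mem_ker.mp hf)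
  have hpos : 0 < p ^ q := pow_pos (Fact.out : p.Prime).pos q
  obtain ⟨k, hk⟩ := Nat.exists_eq_succ_of_ne_zero hpos.ne'
  rw [LinearMap.mem_ker, LinearMap.comp_apply, Submodule.subtype_apply, preΦ_apply, hk,
    pow_succ, Module.End.mul_apply, partialEven_eq_zero_of_DH F hf' i]
  simp [leftMul]

/-- The isomorphism `f ↦ D_H(f)` from the span of the `x^(α) x^u` as above, modulo the kernel of
`D_H`, onto `H_0̄`. -/
def quotEquiv : (evenO F n p t ⧸ LinearMap.ker ((DH F).submoduleMap (evenO F n p t))) ≃ₗ[F]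
    HEven F n p t :=
  LinearMap.quotKerEquivOfSurjective ((DH F).submoduleMap (evenO F n p t))
    (LinearMap.submoduleMap_surjective (DH F) (evenO F n p t))

/-- The exceptional derivation `Φ_i^{(q)} : H_0̄ → W_1̄`, `D_H(f) ↦ ∂_i^{p^q}(f) D_H(x^ω)`, as a
linear map into the endomorphisms of `𝒪(m,n)`. -/
def Φ [Fact p.Prime] (i : Fin m) (q : ℕ) : HEven F n p t →ₗ[F] EndO F m n :=
  (Submodule.liftQ _ (preΦ F n p i q ∘ₗ (evenO F n p t).subtype) (ker_le_ker_preΦ F n p t i q)) ∘ₗ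
    (quotEquiv F n p t).symm.toLinearMap

theorem Φ_apply [Fact p.Prime] (i : Fin m) (q : ℕ) {f : SuperO F m n} (hf : f ∈ evenO F n p t) :
    Φ F n p t i q ⟨DH F f, Submodule.mem_map_of_mem hf⟩ =
      leftMul F ((partialEven F i ^ p ^ q) f) (DH F (xOmega F n)) := by
  have : (quotEquiv F n p t).symm ⟨DH F f, Submodule.mem_map_of_mem hf⟩ =
      Submodule.Quotient.mk ⟨f, hf⟩ := by
    rw [LinearEquiv.symm_apply_eq]
    rfl
  simp only [Φ, LinearMap.comp_apply, LinearEquiv.coe_coe, this]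
  rfl

/-- `ad D : E ↦ [D, E]` on operators. -/
def adOp {m n : ℕ} (D : EndO F m n) : EndO F m n →ₗ[F] EndO F m n :=
  LinearMap.mulLeft F D - LinearMap.mulRight F D

theorem adOp_apply {m n : ℕ} (D E : EndO F m n) : adOp F D E = ⁅D, E⁆ := rfl

/-- The exceptional derivation `Θ_i^{(q)} : H_0̄ → W_1̄`, `E ↦ x^ω (ad ∂_i)^{p^q}(E)`, as a linear
map into the endomorphisms of `𝒪(m,n)`. -/
def Θ (i : Fin m) (q : ℕ) : HEven F n p t →ₗ[F] EndO F m n where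
  toFun E := leftMul F (xOmega F n)
    ((adOp F (partialEven F i) ^ p ^ q) (E : EndO F m n))
  map_add' x y := by simp [leftMul, LinearMap.comp_add]
  map_smul' c x := by simp [leftMul, LinearMap.comp_smul]

/-- The odd vector field `𝔇 = ∑_{k ∈ I₁} x_k x_{m+n} ∂_k`, where `x_{m+n}` is the last odd
variable. -/
def frakD (m : ℕ) {n : ℕ} (hn : 0 < n) : EndO F m n :=
  ∑ k : Fin n, leftMul F (mul F (mono F 0 {k}) (mono F 0 {⟨n - 1, Nat.sub_lt hn one_pos⟩}))
    (partialOdd F k)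

/-! ## Derivations from `𝒥` into `W_1̄` -/

variable {F n p t}

/-- `φ` is a derivation from `𝒥` into the `𝒥`-module `W_1̄`.  The elements of `𝒥` are even, so the
superbracket of an element of `𝒥` with any element is the commutator of operators; `z` is the
bracket of `x` and `y` (which always lies in `𝒥`). -/
def IsDer (φ : J F n p t →ₗ[F] WOdd F n p t) : Prop :=
  ∀ x y z : J F n p t, (z : EndO F m n) = ⁅(x : EndO F m n), (y : EndO F m n)⁆ →
    (φ z : EndO F m n) = ⁅(φ x : EndO F m n), (y : EndO F m n)⁆ +
      ⁅(x : EndO F m n), (φ y : EndO F m n)⁆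

/-- `φ` is `ℤ`-homogeneous: for some `d ∈ ℤ` it maps `𝒥_k = 𝒥 ∩ W_k` into `W_{k+d}`, all `k`. -/
def IsHomog (φ : J F n p t →ₗ[F] WOdd F n p t) : Prop :=
  ∃ d : ℤ, ∀ (k : ℤ) (x : J F n p t), (x : EndO F m n) ∈ WDeg F n p t k →
    (φ x : EndO F m n) ∈ WDeg F n p t (k + d)

/-- `φ` vanishes on `𝒥_{-1} ⊕ 𝒥_0`. -/
def VanishesOnTop (φ : J F n p t →ₗ[F] WOdd F n p t) : Prop :=
  ∀ x : J F n p t, (x : EndO F m n) ∈ WDeg F n p t (-1) ∨ (x : EndO F m n) ∈ WDeg F n p t 0 →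
    φ x = 0

end HamSuper

end

noncomputable section

namespace HamSuper

variable {F : Type*} [Field F] {m n : ℕ}

/-! ### Monomials and multiplication -/

/-! Write {f, g} = D_H(f)(g), so that [D_H f, D_H g] = D_H({f, g}) for even f, g (`lie_DH`). The
derivation φ becomes a linear map T on functions, f ↦ φ(D_H f). The maps Φ and Θ are themselves
derivations that vanish in degrees -1 and 0: D_H(x^ω) commutes with every D_H(f) (`lie_DH_xOmega`),
{f, x^ω} = 0 (`DH_xOmega`), and ∂_i^{p^q} is a derivation of the bracket in characteristic p
(`partialEven_pow_DH`). Subtracting a combination of them from T makes two families of coefficients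
vanish: one coefficient of T(x_i^(p^q)) detects Φ_i^{(q)}, and one of T(x_i^(p^q) x_{i'}) detects
Θ_i^{(q)}. The remaining map Ψ is shown to be zero, so the coefficient of ad 𝔇 can be taken to be 0.

Ψ is shown to kill all monomials by induction on total degree (`lower`). If everything of smaller
degree is killed, Ψ(f) commutes with all ∂_i, i ∈ I₀, so its coefficients lie in the exterior
algebra. The torus elements x_i x_{i'} act on such a field with weight 0 on its odd components and
only 0, ±1 on its even ones, whereas f has weight α_{i'} - α_i up to sign; a mismatch forces
components to vanish. Also f is killed whenever a bracket of killed elements is a nonzero multiple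
of f plus killed terms.

For monomials in the even variables, brackets with x_i^(a+1) x_{i'} reach everything except
exponents p^q ε_i and p^q ε_i + ε_j, by a count of binomial coefficients mod p (`even_mem`). For
these, equivariance under the rotations x_k x_ζ of the odd variables, ζ being the self-conjugate
index, leaves exactly the normalized coefficients and ones of the wrong parity (`single_mem`,
`single_add_conj_mem`). Monomials with odd variables are split by brackets (`mem_of_split`,
`mem_of_zero`), starting from x_i x_k x_ζ, which needs its own argument (`xe_mul_rot_mem`). -/

theorem SuperO.induction {P : SuperO F m n → Prop} (hmono : ∀ α u, P (mono F α u))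
    (hadd : ∀ f g, P f → P g → P (f + g)) (hsmul : ∀ (c : F) f, P f → P (c • f))
    (f : SuperO F m n) : P f := by
  have h0 : P 0 := by simpa using hsmul 0 _ (hmono 0 ∅)
  have hf : f ∈ Submodule.span F (Set.range (stdBasis F m n)) := by
    rw [(stdBasis F m n).span_eq]; trivial
  induction hf using Submodule.span_induction with
  | mem x hx => obtain ⟨a, rfl⟩ := hx; exact hmono a.1 a.2
  | zero => exact h0
  | add x y _ _ hx hy => exact hadd x y hx hy
  | smul c x _ hx => exact hsmul c x hx

theorem inversions_eq_sum (u v : Finset (Fin n)) :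
    inversions u v = ∑ i ∈ u, ∑ j ∈ v, if j < i then 1 else 0 := by
  rw [inversions, Finset.card_filter, Finset.sum_product]

theorem inversions_union_left {u v : Finset (Fin n)} (h : Disjoint u v) (w : Finset (Fin n)) :
    inversions (u ∪ v) w = inversions u w + inversions v w := by
  simp only [inversions_eq_sum, Finset.sum_union h]

theorem inversions_union_right {v w : Finset (Fin n)} (h : Disjoint v w) (u : Finset (Fin n)) :
    inversions u (v ∪ w) = inversions u v + inversions u w := by
  simp only [inversions_eq_sum, Finset.sum_union h, Finset.sum_add_distrib]

/-- Disjointness means that each pair in u × v is an inversion in exactly one of the two orders. All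
supercommutativity signs come from this count. -/
theorem inversions_add_comm {u v : Finset (Fin n)} (h : Disjoint u v) :
    inversions u v + inversions v u = u.card * v.card := by
  simp only [inversions_eq_sum]
  rw [Finset.sum_comm (s := v), ← Finset.sum_add_distrib]
  have : ∀ i ∈ u, ((∑ j ∈ v, if j < i then 1 else 0) + ∑ j ∈ v, if i < j then 1 else 0) = v.card := by
    intro i hi
    rw [← Finset.sum_add_distrib, Finset.card_eq_sum_ones]
    refine Finset.sum_congr rfl fun j hj => ?_
    have : i ≠ j := fun e => Finset.disjoint_left.mp h hi (e ▸ hj)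
    rcases lt_or_gt_of_ne this with h | h
    · simp [h, not_lt.mpr h.le]
    · simp [h, not_lt.mpr h.le]
  rw [Finset.sum_congr rfl this, Finset.sum_const, smul_eq_mul]

theorem card_filter_lt (k : Fin n) (v : Finset (Fin n)) :
    (v.filter (· < k)).card = inversions {k} v := by
  rw [inversions_eq_sum, Finset.sum_singleton, Finset.card_filter]

theorem inversions_self_singleton (k : Fin n) : inversions {k} {k} = 0 := by
  simp [inversions_eq_sum]

/-- The structure constant of the divided power algebra. -/
def bc (F : Type*) [Field F] (α β : Fin m → ℕ) : F := ∏ i, ((α i + β i).choose (α i) : F)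

theorem mul_mono (α β : Fin m → ℕ) (u v : Finset (Fin n)) :
    mul F (mono F α u) (mono F β v) =
      if Disjoint u v then ((-1 : F) ^ inversions u v * bc F α β) • mono F (α + β) (u ∪ v)
      else 0 := by
  rw [mul, ofMono_mono, ofMono_mono]; rfl

/-- Both products are the multinomial coefficient (a+b+c)!/(a! b! c!) in each coordinate. The
identity is proved in ℕ, where the factorials can be cancelled, and then cast. -/
theorem bc_assoc (α β γ : Fin m → ℕ) :
    bc F α β * bc F (α + β) γ = bc F β γ * bc F α (β + γ) := by
  simp only [bc, ← Finset.prod_mul_distrib]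
  refine Finset.prod_congr rfl fun i _ => ?_
  norm_cast
  congr 1
  simp only [Pi.add_apply]
  generalize α i = a, β i = b, γ i = c
  have h1 := Nat.add_choose_mul_factorial_mul_factorial a b
  have h2 := Nat.add_choose_mul_factorial_mul_factorial (a + b) c
  have h3 := Nat.add_choose_mul_factorial_mul_factorial b c
  have h4 := Nat.add_choose_mul_factorial_mul_factorial a (b + c)
  rw [← Nat.choose_symm_add] at h1 h2 h3 h4
  have e : a + (b + c) = a + b + c := by ring
  rw [e] at h4 ⊢
  have hp : 0 < a.factorial * b.factorial * c.factorial := by positivity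
  refine Nat.eq_of_mul_eq_mul_right hp ?_
  calc _ = (a + b + c).choose (a + b) * ((a + b).choose a * a.factorial * b.factorial)
        * c.factorial := by ring
    _ = (a + b + c).choose a * a.factorial * ((b + c).choose b * b.factorial * c.factorial) := by
        rw [h1, h2, h3, h4]
    _ = _ := by ring

theorem bc_comm (α β : Fin m → ℕ) : bc F α β = bc F β α := by
  refine Finset.prod_congr rfl fun i _ => ?_
  rw [Nat.choose_symm_add, add_comm]

theorem mul_assoc' (f g h : SuperO F m n) : mul F (mul F f g) h = mul F f (mul F g h) := by
  induction f using SuperO.induction with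
  | hadd a b ha hb => simp only [map_add, LinearMap.add_apply, ha, hb]
  | hsmul c a ha => simp only [map_smul, LinearMap.smul_apply, ha]
  | hmono α u =>
  induction g using SuperO.induction with
  | hadd a b ha hb => simp only [map_add, LinearMap.add_apply, ha, hb]
  | hsmul c a ha => simp only [map_smul, LinearMap.smul_apply, ha]
  | hmono β v =>
  induction h using SuperO.induction with
  | hadd a b ha hb => simp only [map_add, ha, hb]
  | hsmul c a ha => simp only [map_smul, ha]
  | hmono γ w =>
  simp only [mul_mono]
  by_cases huv : Disjoint u v
  · by_cases hvw : Disjoint v w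
    · by_cases huw : Disjoint u w
      · have h1 : Disjoint (u ∪ v) w := Finset.disjoint_union_left.mpr ⟨huw, hvw⟩
        have h2 : Disjoint u (v ∪ w) := Finset.disjoint_union_right.mpr ⟨huv, huw⟩
        simp only [huv, hvw, if_true, map_smul, LinearMap.smul_apply, mul_mono, h1, h2, smul_smul,
          inversions_union_left huv, inversions_union_right hvw, add_assoc, Finset.union_assoc,
          pow_add]
        congr 1
        linear_combination ((-1 : F) ^ inversions u v * (-1) ^ inversions u w *
          (-1) ^ inversions v w) * bc_assoc (F := F) α β γ
      · have h1 : ¬ Disjoint (u ∪ v) w := fun h => huw (Finset.disjoint_union_left.mp h).1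
        have h2 : ¬ Disjoint u (v ∪ w) := fun h => huw (Finset.disjoint_union_right.mp h).2
        simp only [huv, hvw, if_true, map_smul, LinearMap.smul_apply, mul_mono, h1, h2, if_false,
          smul_zero]
    · have h1 : ¬ Disjoint (u ∪ v) w := fun h => hvw (Finset.disjoint_union_left.mp h).2
      simp [huv, hvw, mul_mono, h1]
  · by_cases hvw : Disjoint v w
    · have h2 : ¬ Disjoint u (v ∪ w) := fun h => huv (Finset.disjoint_union_right.mp h).1
      simp [huv, hvw, mul_mono, h2]
    · simp [huv, hvw]

theorem one_mul' (f : SuperO F m n) : mul F (mono F 0 ∅) f = f := by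
  induction f using SuperO.induction with
  | hadd a b ha hb => simp only [map_add, ha, hb]
  | hsmul c a ha => simp only [map_smul, ha]
  | hmono α u => simp [mul_mono, inversions, bc]

theorem mul_mono_comm (α β : Fin m → ℕ) (u v : Finset (Fin n)) :
    mul F (mono F α u) (mono F β v) =
      (-1 : F) ^ (u.card * v.card) • mul F (mono F β v) (mono F α u) := by
  simp only [mul_mono, disjoint_comm (a := v)]
  split_ifs with h
  · rw [smul_smul, ← inversions_add_comm h, add_comm β, Finset.union_comm v, bc_comm β]
    congr 1
    rw [pow_add, ← mul_assoc, mul_assoc ((-1 : F) ^ _), ← pow_add (-1 : F) (inversions v u),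
      Even.neg_one_pow ⟨_, rfl⟩, mul_one]
  · simp

/-! ### Parity -/

theorem parityInv_mono (α : Fin m → ℕ) (u : Finset (Fin n)) :
    parityInv F (mono F α u) = (-1 : F) ^ u.card • mono F α u := by
  rw [parityInv, ofMono_mono]

/-- The homogeneous component of parity `e` of `𝒪(m,n)`. -/
def parityPart (F : Type*) [Field F] (m n : ℕ) (e : ZMod 2) : Submodule F (SuperO F m n) :=
  Submodule.span F {f | ∃ α u, (Finset.card u : ZMod 2) = e ∧ f = mono F α u}

theorem mono_mem_parityPart (α : Fin m → ℕ) (u : Finset (Fin n)) {e : ZMod 2}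
    (h : (u.card : ZMod 2) = e) : mono F α u ∈ parityPart F m n e :=
  Submodule.subset_span ⟨α, u, h, rfl⟩

theorem map_mem_parityPart {V : Type*} [AddCommGroup V] [Module F V] {S : Submodule F V}
    {T : SuperO F m n →ₗ[F] V} {e : ZMod 2}
    (h : ∀ α u, (Finset.card u : ZMod 2) = e → T (mono F α u) ∈ S) {f : SuperO F m n}
    (hf : f ∈ parityPart F m n e) : T f ∈ S := by
  have : parityPart F m n e ≤ S.comap T := by
    refine Submodule.span_le.mpr ?_
    rintro _ ⟨α, u, hu, rfl⟩
    exact h α u hu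
  exact this hf

theorem eq_on_parityPart {V : Type*} [AddCommGroup V] [Module F V]
    {T T' : SuperO F m n →ₗ[F] V} {e : ZMod 2}
    (h : ∀ α u, (Finset.card u : ZMod 2) = e → T (mono F α u) = T' (mono F α u))
    {f : SuperO F m n} (hf : f ∈ parityPart F m n e) : T f = T' f := by
  have := map_mem_parityPart (S := ⊥) (T := T - T')
    (fun α u hu => by simpa [sub_eq_zero] using h α u hu) hf
  simpa [sub_eq_zero] using this

theorem zmod_two_cases (e : ZMod 2) : e = 0 ∨ e = 1 := by
  revert e; decide

theorem natCast_zmod_two_eq_zero {a : ℕ} : (a : ZMod 2) = 0 ↔ Even a := by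
  rw [ZMod.natCast_eq_zero_iff_even]

theorem natCast_zmod_two_eq_one {a : ℕ} : (a : ZMod 2) = 1 ↔ Odd a := by
  rw [ZMod.natCast_eq_one_iff_odd]

/-- The sign `(-1)^e`. -/
def zsgn (F : Type*) [Field F] (e : ZMod 2) : F := if e = 0 then 1 else -1

theorem zsgn_natCast (a : ℕ) : zsgn F (a : ZMod 2) = (-1) ^ a := by
  unfold zsgn
  rcases Nat.even_or_odd a with h | h
  · rw [if_pos (natCast_zmod_two_eq_zero.mpr h), h.neg_one_pow]
  · rw [if_neg, h.neg_one_pow]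
    rw [natCast_zmod_two_eq_one.mpr h]; decide

theorem zsgn_add (a b : ZMod 2) : zsgn F (a + b) = zsgn F a * zsgn F b := by
  rcases zmod_two_cases a with rfl | rfl <;> rcases zmod_two_cases b with rfl | rfl <;>
    simp [zsgn, show (1 + 1 : ZMod 2) = 0 from by decide]

theorem zsgn_mul_self (a : ZMod 2) : zsgn F a * zsgn F a = 1 := by
  rcases zmod_two_cases a with rfl | rfl <;> simp [zsgn]

theorem parityInv_of_mem {f : SuperO F m n} {e : ZMod 2} (hf : f ∈ parityPart F m n e) :
    parityInv F f = zsgn F e • f := by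
  refine eq_on_parityPart (T' := zsgn F e • LinearMap.id) (fun α u hu => ?_) hf
  rw [parityInv_mono, ← hu, zsgn_natCast]; rfl

theorem mul_comm_of_mem {f g : SuperO F m n} {a b : ZMod 2} (hf : f ∈ parityPart F m n a)
    (hg : g ∈ parityPart F m n b) : mul F f g = zsgn F (a * b) • mul F g f := by
  refine eq_on_parityPart (T := (mul F).flip g) (T' := zsgn F (a * b) • mul F g)
    (fun α u hu => ?_) hf
  refine eq_on_parityPart (T := mul F (mono F α u))
    (T' := zsgn F (a * b) • (mul F).flip (mono F α u)) (fun β v hv => ?_) hg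
  rw [mul_mono_comm, ← hu, ← hv, ← Nat.cast_mul, zsgn_natCast]
  rfl

theorem mul_mem_parityPart {f g : SuperO F m n} {a b : ZMod 2} (hf : f ∈ parityPart F m n a)
    (hg : g ∈ parityPart F m n b) : mul F f g ∈ parityPart F m n (a + b) := by
  refine map_mem_parityPart (T := (mul F).flip g) (fun α u hu => ?_) hf
  refine map_mem_parityPart (T := mul F (mono F α u)) (fun β v hv => ?_) hg
  rw [mul_mono]
  split_ifs with h
  · refine Submodule.smul_mem _ _ (mono_mem_parityPart _ _ ?_)
    rw [Finset.card_union_of_disjoint h, Nat.cast_add, hu, hv]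
  · exact Submodule.zero_mem _

/-- Even elements commute with everything. -/
theorem mul_comm_even {f : SuperO F m n} (hf : f ∈ parityPart F m n 0) (g : SuperO F m n) :
    mul F f g = mul F g f := by
  induction g using SuperO.induction with
  | hadd a b ha hb => simp only [map_add, LinearMap.add_apply, ha, hb]
  | hsmul c a ha => simp only [map_smul, LinearMap.smul_apply, ha]
  | hmono α u =>
    rw [mul_comm_of_mem hf (mono_mem_parityPart α u rfl), zero_mul]; simp [zsgn]

/-! ### Partial derivatives -/

theorem partialEven_mono (i : Fin m) (α : Fin m → ℕ) (u : Finset (Fin n)) :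
    partialEven F i (mono F α u) = if α i = 0 then 0 else mono F (α - Pi.single i 1) u := by
  rw [partialEven, ofMono_mono]

theorem partialOdd_mono (k : Fin n) (α : Fin m → ℕ) (u : Finset (Fin n)) :
    partialOdd F k (mono F α u) =
      if k ∈ u then (-1 : F) ^ inversions {k} u • mono F α (u.erase k) else 0 := by
  rw [partialOdd, ofMono_mono, card_filter_lt]

theorem bc_eq_mul_prod (i : Fin m) (α β : Fin m → ℕ) :
    bc F α β = ((α i + β i).choose (α i) : F) *
      ∏ j ∈ Finset.univ.erase i, ((α j + β j).choose (α j) : F) :=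
  (Finset.mul_prod_erase _ (fun j => ((α j + β j).choose (α j) : F)) (Finset.mem_univ i)).symm

/-- Pascal's rule in coordinate i, which is the Leibniz rule for ∂_i on divided powers. If α_i = β_i
= 0 the right side is 0 while the left need not be, so that case is excluded. -/
theorem bc_pascal (i : Fin m) (α β : Fin m → ℕ) (h : α i + β i ≠ 0) :
    bc F α β = (if α i = 0 then 0 else bc F (α - Pi.single i 1) β) +
      (if β i = 0 then 0 else bc F α (β - Pi.single i 1)) := by
  simp only [bc_eq_mul_prod i]
  have h1 : ∏ j ∈ Finset.univ.erase i, (((α - Pi.single i 1 : Fin m → ℕ) j + β j).choose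
      ((α - Pi.single i 1 : Fin m → ℕ) j) : F) =
      ∏ j ∈ Finset.univ.erase i, ((α j + β j).choose (α j) : F) :=
    Finset.prod_congr rfl fun j hj => by simp [Finset.ne_of_mem_erase hj]
  have h2 : ∏ j ∈ Finset.univ.erase i, ((α j + (β - Pi.single i 1 : Fin m → ℕ) j).choose (α j) : F) =
      ∏ j ∈ Finset.univ.erase i, ((α j + β j).choose (α j) : F) :=
    Finset.prod_congr rfl fun j hj => by simp [Finset.ne_of_mem_erase hj]
  rw [h1, h2]
  simp only [Pi.sub_apply, Pi.single_eq_same]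
  generalize α i = a at *
  generalize β i = b at *
  rcases a with _ | a
  · have hb : b ≠ 0 := by simpa using h
    simp [hb]
  · rcases b with _ | b
    · simp
    · have := Nat.choose_succ_succ' (a + b + 1) a
      simp only [Nat.add_eq_zero_iff, one_ne_zero, and_false, if_false, Nat.add_sub_cancel]
      rw [show a + 1 + (b + 1) = a + b + 1 + 1 by ring, show a + (b + 1) = a + b + 1 by ring,
        show a + 1 + b = a + b + 1 by ring]
      rw [← add_mul, this, Nat.cast_add]

theorem partialEven_mul (i : Fin m) (f g : SuperO F m n) :
    partialEven F i (mul F f g) = mul F (partialEven F i f) g + mul F f (partialEven F i g) := by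
  induction f using SuperO.induction with
  | hadd a b ha hb => simp only [map_add, LinearMap.add_apply, ha, hb]; abel
  | hsmul c a ha => simp only [map_smul, LinearMap.smul_apply, ha, smul_add]
  | hmono α u =>
  induction g using SuperO.induction with
  | hadd a b ha hb => simp only [map_add, ha, hb]; abel
  | hsmul c a ha => simp only [map_smul, ha, smul_add]
  | hmono β v =>
  by_cases h : Disjoint u v
  · have e1 : α i ≠ 0 → α - Pi.single i 1 + β = α + β - Pi.single i 1 := by
      intro ha; ext j; by_cases hj : j = i
      · subst hj; simp; omega
      · simp [hj]
    have e2 : β i ≠ 0 → α + (β - Pi.single i 1) = α + β - Pi.single i 1 := by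
      intro ha; ext j; by_cases hj : j = i
      · subst hj; simp; omega
      · simp [hj]
    rw [mul_mono, if_pos h, map_smul, partialEven_mono, partialEven_mono, partialEven_mono]
    by_cases h0 : α i + β i = 0
    · have ha : α i = 0 := by omega
      have hb : β i = 0 := by omega
      simp [ha, hb]
    · rw [if_neg (by simpa using h0), bc_pascal i α β h0]
      by_cases ha : α i = 0 <;> by_cases hb : β i = 0
      · omega
      · simp [ha, hb, mul_mono, h, e2]
      · simp [ha, hb, mul_mono, h, e1]
      · simp [ha, hb, mul_mono, h, e1, e2, mul_add, add_smul]
  · simp only [mul_mono, h, if_false, map_zero, partialEven_mono]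
    split_ifs <;> simp [mul_mono, h]

theorem neg_one_pow_eq_of_even {a b : ℕ} (h : Even (a + b)) : (-1 : F) ^ a = (-1) ^ b := by
  rcases Nat.even_or_odd a with ha | ha
  · have : Even b := (Nat.even_add.mp h).mp ha
    rw [ha.neg_one_pow, this.neg_one_pow]
  · have : Odd b := by
      rw [← Nat.not_even_iff_odd] at ha ⊢
      exact fun hb => ha ((Nat.even_add.mp h).mpr hb)
    rw [ha.neg_one_pow, this.neg_one_pow]

theorem inversions_insert_left {k : Fin n} {u : Finset (Fin n)} (hk : k ∉ u) (v : Finset (Fin n)) :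
    inversions (insert k u) v = inversions {k} v + inversions u v := by
  rw [Finset.insert_eq, inversions_union_left (by simpa using hk)]

theorem inversions_insert_right {k : Fin n} {v : Finset (Fin n)} (hk : k ∉ v)
    (u : Finset (Fin n)) : inversions u (insert k v) = inversions u {k} + inversions u v := by
  rw [Finset.insert_eq, inversions_union_right (by simpa using hk)]

theorem partialOdd_mono_insert {k : Fin n} {u : Finset (Fin n)} (hk : k ∉ u) (α : Fin m → ℕ) :
    partialOdd F k (mono F α (insert k u)) = (-1 : F) ^ inversions {k} u • mono F α u := by
  rw [partialOdd_mono, if_pos (Finset.mem_insert_self k u), Finset.erase_insert hk,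
    inversions_insert_right hk, inversions_self_singleton, zero_add]

theorem partialOdd_mono_of_notMem {k : Fin n} {u : Finset (Fin n)} (hk : k ∉ u) (α : Fin m → ℕ) :
    partialOdd F k (mono F α u) = 0 := by
  rw [partialOdd_mono, if_neg hk]

theorem inversions_singleton_add {k : Fin n} {u : Finset (Fin n)} (hk : k ∉ u) :
    inversions {k} u + inversions u {k} = u.card := by
  simpa using inversions_add_comm (u := {k}) (v := u) (by simpa using hk)

theorem partialOdd_mul (k : Fin n) (f g : SuperO F m n) :
    partialOdd F k (mul F f g) =
      mul F (partialOdd F k f) g + mul F (parityInv F f) (partialOdd F k g) := by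
  induction f using SuperO.induction with
  | hadd a b ha hb => simp only [map_add, LinearMap.add_apply, ha, hb]; abel
  | hsmul c a ha => simp only [map_smul, LinearMap.smul_apply, ha, smul_add]
  | hmono α u =>
  induction g using SuperO.induction with
  | hadd a b ha hb => simp only [map_add, ha, hb]; abel
  | hsmul c a ha => simp only [map_smul, ha, smul_add]
  | hmono β v =>
  rw [parityInv_mono]
  by_cases hu : k ∈ u
  · obtain ⟨u, hku, rfl⟩ : ∃ u', k ∉ u' ∧ insert k u' = u :=
      ⟨u.erase k, Finset.notMem_erase k u, Finset.insert_erase hu⟩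
    rw [partialOdd_mono_insert hku]
    have c1 := inversions_singleton_add hku
    by_cases hv : k ∈ v
    · obtain ⟨v, hkv, rfl⟩ : ∃ v', k ∉ v' ∧ insert k v' = v :=
        ⟨v.erase k, Finset.notMem_erase k v, Finset.insert_erase hv⟩
      rw [partialOdd_mono_insert hkv]
      rw [mul_mono, if_neg (by simp), map_zero]
      simp only [map_smul, LinearMap.smul_apply, mul_mono, Finset.disjoint_insert_left,
        Finset.disjoint_insert_right, hku, hkv, not_false_eq_true, true_and,
        Finset.card_insert_of_notMem hku, inversions_insert_left hku, inversions_insert_right hkv,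
        Finset.insert_union, Finset.union_insert]
      by_cases h : Disjoint u v
      · simp only [h, if_true, smul_smul, ← add_smul]
        -- Both factors contain x_k, so the product is 0 and the two Leibniz terms have to carry
        -- opposite signs.
        convert (zero_smul F _).symm
        have := neg_one_pow_eq_of_even (F := F) (a := inversions {k} u + (inversions u {k} + inversions u v))
          (b := u.card + inversions {k} v + (inversions {k} v + inversions u v)) (by
            rw [← c1]; ring_nf
            exact ⟨inversions {k} u + inversions u {k} + inversions u v + inversions {k} v, by ring⟩)
        simp only [pow_add, pow_one] at this ⊢
        linear_combination bc F α β * this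
      · simp [h]
    · rw [partialOdd_mono_of_notMem hv]
      simp only [map_smul, LinearMap.smul_apply, mul_mono, Finset.disjoint_insert_left, hv,
        not_false_eq_true, true_and, map_zero, add_zero]
      by_cases h : Disjoint u v
      · simp only [h, if_true, map_smul, Finset.insert_union]
        rw [partialOdd_mono_insert (by simp [hku, hv]), smul_smul, smul_smul,
          inversions_insert_left hku, inversions_union_right h]
        congr 1
        have := neg_one_pow_eq_of_even (F := F) (a := inversions {k} v + inversions u v +
          (inversions {k} u + inversions {k} v)) (b := inversions {k} u + inversions u v)
          ⟨inversions {k} v + inversions u v + inversions {k} u, by ring⟩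
        simp only [pow_add] at this ⊢
        linear_combination bc F α β * this
      · simp [h]
  · rw [partialOdd_mono_of_notMem hu]
    by_cases hv : k ∈ v
    · obtain ⟨v, hkv, rfl⟩ : ∃ v', k ∉ v' ∧ insert k v' = v :=
        ⟨v.erase k, Finset.notMem_erase k v, Finset.insert_erase hv⟩
      rw [partialOdd_mono_insert hkv]
      have c1 := inversions_singleton_add hu
      simp only [map_smul, LinearMap.smul_apply, mul_mono, Finset.disjoint_insert_right, hu,
        not_false_eq_true, true_and, map_zero, LinearMap.zero_apply, zero_add]
      by_cases h : Disjoint u v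
      · simp only [h, if_true, map_smul, Finset.union_insert]
        rw [partialOdd_mono_insert (by simp [hu, hkv]), smul_smul, smul_smul, smul_smul,
          inversions_insert_right hkv, inversions_union_right h, ← c1]
        congr 1
        have := neg_one_pow_eq_of_even (F := F) (a := inversions u {k} + inversions u v +
          (inversions {k} u + inversions {k} v)) (b := inversions {k} u + inversions u {k}  +
            inversions {k} v + inversions u v)
          ⟨inversions u {k} + inversions u v + inversions {k} u + inversions {k} v, by ring⟩
        simp only [pow_add] at this ⊢
        linear_combination bc F α β * this
      · simp [h]
    · rw [partialOdd_mono_of_notMem hv, mul_mono]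
      split_ifs
      · rw [map_smul, partialOdd_mono_of_notMem (by simp [hu, hv])]; simp
      · simp

theorem partialEven_comm (i j : Fin m) (f : SuperO F m n) :
    partialEven F i (partialEven F j f) = partialEven F j (partialEven F i f) := by
  induction f using SuperO.induction with
  | hadd a b ha hb => simp only [map_add, ha, hb]
  | hsmul c a ha => simp only [map_smul, ha]
  | hmono α u =>
  by_cases h : i = j
  · rw [h]
  · simp only [partialEven_mono]
    by_cases hi : α i = 0 <;> by_cases hj : α j = 0 <;>
      simp [hi, hj, partialEven_mono, h, Ne.symm h, tsub_right_comm]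

theorem partialEven_partialOdd (i : Fin m) (k : Fin n) (f : SuperO F m n) :
    partialEven F i (partialOdd F k f) = partialOdd F k (partialEven F i f) := by
  induction f using SuperO.induction with
  | hadd a b ha hb => simp only [map_add, ha, hb]
  | hsmul c a ha => simp only [map_smul, ha]
  | hmono α u =>
  simp only [partialEven_mono, partialOdd_mono]
  by_cases hi : α i = 0 <;> by_cases hj : k ∈ u <;>
    simp [hi, hj, partialEven_mono, partialOdd_mono]

theorem partialOdd_partialOdd (k l : Fin n) (f : SuperO F m n) :
    partialOdd F k (partialOdd F l f) = -partialOdd F l (partialOdd F k f) := by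
  induction f using SuperO.induction with
  | hadd a b ha hb => simp only [map_add, ha, hb]; abel
  | hsmul c a ha => simp only [map_smul, ha, smul_neg]
  | hmono α u =>
  by_cases h : k = l
  · subst h
    have : partialOdd F k (partialOdd F k (mono F α u)) = 0 := by
      simp only [partialOdd_mono]
      split_ifs <;> simp [partialOdd_mono]
    rw [this, neg_zero]
  by_cases hk : k ∈ u
  · by_cases hl : l ∈ u
    · obtain ⟨v, hkv, hlv, rfl⟩ : ∃ v, k ∉ v ∧ l ∉ v ∧ u = insert k (insert l v) := by
        refine ⟨(u.erase k).erase l, by simp, by simp, ?_⟩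
        rw [Finset.insert_erase (by simp [hl, Ne.symm h]), Finset.insert_erase hk]
      have h1 : k ∉ insert l v := by simp [hkv, h]
      have h2 : l ∉ insert k v := by simp [hlv, Ne.symm h]
      rw [partialOdd_mono_insert h1, Finset.insert_comm, partialOdd_mono_insert h2, map_smul,
        map_smul, partialOdd_mono_insert hkv, partialOdd_mono_insert hlv, smul_smul, smul_smul,
        inversions_insert_right hkv, inversions_insert_right hlv, ← neg_smul]
      congr 1
      have := inversions_add_comm (u := {k}) (v := {l}) (by simpa using h)
      simp only [Finset.card_singleton, mul_one] at this
      have h3 := neg_one_pow_eq_of_even (F := F) (a := inversions {l} {k} + 1)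
        (b := inversions {k} {l}) (by rw [← this]; exact ⟨inversions {l} {k} + inversions {k} {l}, by ring⟩)
      simp only [pow_add, pow_one] at h3 ⊢
      linear_combination (-((-1 : F) ^ inversions {l} v * (-1) ^ inversions {k} v)) * h3
    · rw [partialOdd_mono_of_notMem hl, partialOdd_mono, if_pos hk, map_smul,
        partialOdd_mono_of_notMem (by simp [hl])]; simp
  · rw [partialOdd_mono_of_notMem hk, partialOdd_mono]
    split_ifs with hl
    · rw [map_smul, partialOdd_mono_of_notMem (by simp [hk])]; simp
    · simp

/-- The parity of an index. -/
def ipar : Fin m ⊕ Fin n → ZMod 2 := Sum.elim (fun _ => 0) (fun _ => 1)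

@[simp] theorem ipar_inl (i : Fin m) : ipar (n := n) (Sum.inl i) = 0 := rfl
@[simp] theorem ipar_inr (k : Fin n) : ipar (m := m) (Sum.inr k) = 1 := rfl

@[simp] theorem pd_inl (i : Fin m) : pd F (n := n) (Sum.inl i) = partialEven F i := rfl
@[simp] theorem pd_inr (k : Fin n) : pd F (m := m) (Sum.inr k) = partialOdd F k := rfl

theorem pd_comm (r s : Fin m ⊕ Fin n) (f : SuperO F m n) :
    pd F r (pd F s f) = zsgn F (ipar r * ipar s) • pd F s (pd F r f) := by
  rcases r with i | k <;> rcases s with j | l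
  · simp [zsgn, partialEven_comm i j]
  · simp [zsgn, partialEven_partialOdd]
  · simp [zsgn, partialEven_partialOdd]
  · simp [zsgn, partialOdd_partialOdd k l]

theorem pd_mem_parityPart (r : Fin m ⊕ Fin n) {f : SuperO F m n} {e : ZMod 2}
    (hf : f ∈ parityPart F m n e) : pd F r f ∈ parityPart F m n (ipar r + e) := by
  refine map_mem_parityPart (fun α u hu => ?_) hf
  rcases r with i | k
  · rw [pd_inl, partialEven_mono, ipar_inl, zero_add]
    split_ifs
    · exact Submodule.zero_mem _
    · exact mono_mem_parityPart _ _ hu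
  · rw [pd_inr, partialOdd_mono, ipar_inr]
    split_ifs with h
    · refine Submodule.smul_mem _ _ (mono_mem_parityPart _ _ ?_)
      have h1 : (u.erase k).card + 1 = u.card := Finset.card_erase_add_one h
      rw [← hu, ← h1, Nat.cast_add, Nat.cast_one, add_comm (1 : ZMod 2), add_assoc,
        show (1 + 1 : ZMod 2) = 0 from by decide, add_zero]
    · exact Submodule.zero_mem _

theorem pd_mul (r : Fin m ⊕ Fin n) {f : SuperO F m n} {e : ZMod 2} (hf : f ∈ parityPart F m n e)
    (g : SuperO F m n) :
    pd F r (mul F f g) = mul F (pd F r f) g + zsgn F (ipar r * e) • mul F f (pd F r g) := by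
  rcases r with i | k
  · simp [partialEven_mul, zsgn]
  · rw [pd_inr, partialOdd_mul, parityInv_of_mem hf]; simp

/-! ### The Hamiltonian bracket -/

/-- The involution `r ↦ r'` of the full index set. -/
def conjI (r : Fin m ⊕ Fin n) : Fin m ⊕ Fin n := Sum.map conj conj r

/-- The sign `τ` on the full index set. -/
def tauI (F : Type*) [Field F] (r : Fin m ⊕ Fin n) : F := Sum.elim (tau F) (fun _ => 1) r

@[simp] theorem conjI_inl (i : Fin m) : conjI (n := n) (Sum.inl i) = Sum.inl (conj i) := rfl
@[simp] theorem conjI_inr (k : Fin n) : conjI (m := m) (Sum.inr k) = Sum.inr (conj k) := rfl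
@[simp] theorem tauI_inl (i : Fin m) : tauI F (n := n) (Sum.inl i) = tau F i := rfl
@[simp] theorem tauI_inr (k : Fin n) : tauI F (m := m) (Sum.inr k) = 1 := rfl

theorem conjI_conjI (r : Fin m ⊕ Fin n) : conjI (conjI r) = r := by
  rcases r with i | k <;> simp [conj_conj]

/-- The involution `r ↦ r'` as a permutation. -/
def conjEquiv : Equiv.Perm (Fin m ⊕ Fin n) := ⟨conjI, conjI, conjI_conjI, conjI_conjI⟩

theorem conjEquiv_apply (r : Fin m ⊕ Fin n) : conjEquiv r = conjI r := rfl

theorem ipar_conjI (r : Fin m ⊕ Fin n) : ipar (conjI r) = ipar r := by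
  rcases r with i | k <;> rfl

theorem tau_mul_self (i : Fin m) : tau F i * tau F i = 1 := by
  unfold tau; split_ifs <;> simp

theorem tau_ne_zero (i : Fin m) : tau F i ≠ 0 := fun h => by
  simpa [h] using tau_mul_self (F := F) i

theorem tau_conj (hm : Even m) (i : Fin m) : tau F (conj i) = -tau F i := by
  have h2 := Nat.two_mul_div_two_of_even hm
  have hi := i.2
  unfold tau conj
  by_cases h : i.1 < m / 2
  · simp [h]
  · have h' : i.1 < 2 * (m / 2) := by omega
    simp only [h, h', dite_false, if_true, if_false]
    rw [if_pos (by omega), neg_neg]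

theorem DH_apply {f : SuperO F m n} (hf : f ∈ parityPart F m n 0) (h : SuperO F m n) :
    DH F f h = ∑ r, tauI F r • mul F (pd F r f) (pd F (conjI r) h) := by
  rw [Fintype.sum_sum_type]
  simp [DH, leftMul, parityInv_of_mem hf, zsgn]

theorem DH_eq_sum {f : SuperO F m n} (hf : f ∈ parityPart F m n 0) :
    DH F f = ∑ r, tauI F r • leftMul F (pd F r f) (pd F (conjI r)) := by
  ext h; rw [DH_apply hf]; simp [leftMul]

theorem DH_mem_parityPart {f g : SuperO F m n} (hf : f ∈ parityPart F m n 0) {e : ZMod 2}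
    (hg : g ∈ parityPart F m n e) : DH F f g ∈ parityPart F m n e := by
  rw [DH_apply hf]
  refine Submodule.sum_mem _ fun r _ => Submodule.smul_mem _ _ ?_
  have := mul_mem_parityPart (pd_mem_parityPart r hf) (pd_mem_parityPart (conjI r) hg)
  have h2 : ∀ a b : ZMod 2, a + 0 + (a + b) = b := by decide
  rwa [ipar_conjI, h2] at this

/-- `D_H(f)` is a derivation of `𝒪(m,n)` for even `f`. -/
theorem DH_mul {f : SuperO F m n} (hf : f ∈ parityPart F m n 0) (g h : SuperO F m n) :
    DH F f (mul F g h) = mul F (DH F f g) h + mul F g (DH F f h) := by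
  induction g using SuperO.induction with
  | hadd a b ha hb => simp only [map_add, LinearMap.add_apply, ha, hb]; abel
  | hsmul c a ha => simp only [map_smul, LinearMap.smul_apply, ha, smul_add]
  | hmono α u =>
  have hg := mono_mem_parityPart (F := F) α u rfl
  rw [DH_apply hf, DH_apply hf, DH_apply hf, map_sum, map_sum, LinearMap.sum_apply,
    ← Finset.sum_add_distrib]
  refine Finset.sum_congr rfl fun r _ => ?_
  simp only [pd_mul _ hg, map_add, smul_add, map_smul, LinearMap.smul_apply, mul_assoc']
  congr 1
  rw [← mul_assoc', mul_comm_of_mem (pd_mem_parityPart r hf) hg,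
    map_smul, LinearMap.smul_apply, smul_smul, smul_smul, mul_assoc', ipar_conjI, add_zero,
    mul_assoc, zsgn_mul_self, mul_one]

/-- Commutator of a partial derivative with `D_H(f)`. -/
theorem pd_DH {f : SuperO F m n} (hf : f ∈ parityPart F m n 0) (r : Fin m ⊕ Fin n)
    (h : SuperO F m n) :
    pd F r (DH F f h) = DH F f (pd F r h) +
      ∑ s, tauI F s • mul F (pd F r (pd F s f)) (pd F (conjI s) h) := by
  rw [DH_apply hf, DH_apply hf, map_sum, ← Finset.sum_add_distrib]
  refine Finset.sum_congr rfl fun s _ => ?_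
  rw [map_smul, pd_mul _ (pd_mem_parityPart s hf), pd_comm r (conjI s), map_smul, smul_smul,
    ipar_conjI, add_zero, zsgn_mul_self, one_smul, smul_add, add_comm]

/-- Reindexing by s ↦ s' turns one Hamiltonian sum into the other. The minus sign is τ(i') = -τ(i)
on even indices and comes from exchanging odd factors on odd indices. -/
theorem sum_pd_pd_eq (hm : Even m) {f g : SuperO F m n} (hf : f ∈ parityPart F m n 0)
    (hg : g ∈ parityPart F m n 0) (r : Fin m ⊕ Fin n) :
    ∑ s, tauI F s • mul F (pd F r (pd F s f)) (pd F (conjI s) g) = -DH F g (pd F r f) := by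
  rw [DH_apply hg, ← Finset.sum_neg_distrib,
    ← Equiv.sum_comp conjEquiv]
  refine Finset.sum_congr rfl fun s _ => ?_
  simp only [conjEquiv_apply, conjI_conjI]
  rw [pd_comm r _ f, map_smul, LinearMap.smul_apply,
    mul_comm_of_mem (pd_mem_parityPart _ (pd_mem_parityPart _ hf)) (pd_mem_parityPart _ hg)]
  rcases s with i | k
  · simp [tau_conj hm, zsgn]
  · simp only [conjI_inr, tauI_inr, ipar_inr, smul_smul, one_mul, mul_one, one_smul, add_zero]
    rw [zsgn_add, ← mul_assoc, mul_comm (zsgn F _), mul_assoc, zsgn_mul_self]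
    simp [zsgn]

/-- The Leibniz rule for ∂_r on the bracket. The second term is written as -{g, ∂_r f} because ∂_r f
may be odd, and the formula for D_H used here holds only for even functions. -/
theorem pd_DH_apply (hm : Even m) {f g : SuperO F m n} (hf : f ∈ parityPart F m n 0)
    (hg : g ∈ parityPart F m n 0) (r : Fin m ⊕ Fin n) :
    pd F r (DH F f g) = DH F f (pd F r g) - DH F g (pd F r f) := by
  rw [pd_DH hf, sum_pd_pd_eq hm hf hg, sub_eq_add_neg]

theorem DH_antisymm (hm : Even m) {f g : SuperO F m n} (hf : f ∈ parityPart F m n 0)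
    (hg : g ∈ parityPart F m n 0) : DH F f g = -DH F g f := by
  rw [DH_apply hg, ← Finset.sum_neg_distrib, DH_apply hf,
    ← Equiv.sum_comp conjEquiv]
  refine Finset.sum_congr rfl fun s _ => ?_
  simp only [conjEquiv_apply, conjI_conjI]
  rw [mul_comm_of_mem (pd_mem_parityPart _ hf) (pd_mem_parityPart _ hg)]
  rcases s with i | k
  · simp [tau_conj hm, zsgn]
  · simp [zsgn]

/-- Moving D_H(f) past the coefficients and derivatives of D_H(g) collects the second-order part in
D_H(g) D_H(f). What remains has coefficients {f, ∂_r g} - {g, ∂_r f} = ∂_r {f, g}. -/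
theorem lie_DH (hm : Even m) {f g : SuperO F m n} (hf : f ∈ parityPart F m n 0)
    (hg : g ∈ parityPart F m n 0) : ⁅DH F f, DH F g⁆ = DH F (DH F f g) := by
  ext1 h
  rw [Ring.lie_def, LinearMap.sub_apply, Module.End.mul_apply, Module.End.mul_apply,
    DH_apply (DH_mem_parityPart hf hg), sub_eq_iff_eq_add]
  have key : ∀ r, DH F f (pd F (conjI r) h) = pd F (conjI r) (DH F f h) -
      ∑ s, tauI F s • mul F (pd F (conjI r) (pd F s f)) (pd F (conjI s) h) := fun r => by
    rw [pd_DH hf]; abel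
  have h1 : DH F f (DH F g h) = ∑ r, tauI F r • mul F (DH F f (pd F r g)) (pd F (conjI r) h) +
      DH F g (DH F f h) - ∑ r, tauI F r • mul F (pd F r g)
        (∑ s, tauI F s • mul F (pd F (conjI r) (pd F s f)) (pd F (conjI s) h)) := by
    rw [DH_apply hg h, map_sum, DH_apply hg (DH F f h), ← Finset.sum_add_distrib,
      ← Finset.sum_sub_distrib]
    refine Finset.sum_congr rfl fun r _ => ?_
    rw [map_smul, DH_mul hf, key, map_sub, smul_add, smul_sub]
    abel
  have h2 : ∑ r, tauI F r • mul F (pd F r g)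
        (∑ s, tauI F s • mul F (pd F (conjI r) (pd F s f)) (pd F (conjI s) h)) =
      ∑ s, tauI F s • mul F (DH F g (pd F s f)) (pd F (conjI s) h) := by
    simp only [map_sum, Finset.smul_sum, DH_apply hg, LinearMap.sum_apply]
    rw [Finset.sum_comm]
    refine Finset.sum_congr rfl fun s _ => Finset.sum_congr rfl fun r _ => ?_
    simp only [map_smul, LinearMap.smul_apply, mul_assoc']
    rw [smul_comm]
  rw [h1, h2, add_sub_right_comm, ← Finset.sum_sub_distrib]
  congr 1
  refine Finset.sum_congr rfl fun r _ => ?_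
  rw [pd_DH_apply hm hf hg, map_sub, LinearMap.sub_apply, smul_sub]

/-- `D_H` of a product of even elements. -/
theorem DH_mul_eq {f g : SuperO F m n} (hf : f ∈ parityPart F m n 0)
    (hg : g ∈ parityPart F m n 0) (h : SuperO F m n) :
    DH F (mul F f g) h = mul F f (DH F g h) + mul F g (DH F f h) := by
  have hfg := mul_mem_parityPart hf hg
  rw [add_zero] at hfg
  rw [DH_apply hfg, DH_apply hf, DH_apply hg, map_sum, map_sum, ← Finset.sum_add_distrib]
  refine Finset.sum_congr rfl fun r _ => ?_
  rw [pd_mul _ hf, ← mul_comm_even hg, mul_zero]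
  simp only [map_add, LinearMap.add_apply, smul_add, mul_assoc', map_smul, zsgn, if_true, one_smul]
  rw [add_comm]

/-! ### Explicit Hamiltonian operators -/

/-- The even variable `x_i`. -/
def xe (F : Type*) [Field F] (n : ℕ) (i : Fin m) : SuperO F m n := mono F (Pi.single i 1) ∅

/-- The odd variable `x_k`. -/
def xo (F : Type*) [Field F] (m : ℕ) (k : Fin n) : SuperO F m n := mono F 0 {k}

/-- The divided power `x_i^(a)`. -/
def dp (F : Type*) [Field F] (n : ℕ) (i : Fin m) (a : ℕ) : SuperO F m n := mono F (Pi.single i a) ∅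

theorem mono_even (α : Fin m → ℕ) {u : Finset (Fin n)} (hu : Even u.card) :
    mono F α u ∈ parityPart F m n 0 :=
  mono_mem_parityPart α u (natCast_zmod_two_eq_zero.mpr hu)

theorem xe_even (i : Fin m) : xe F n i ∈ parityPart F m n 0 := mono_even _ (by simp)

theorem dp_even (i : Fin m) (a : ℕ) : dp F n i a ∈ parityPart F m n 0 := mono_even _ (by simp)

theorem xo_odd (k : Fin n) : xo F m k ∈ parityPart F m n 1 := mono_mem_parityPart _ _ (by simp)

theorem dp_one (i : Fin m) : dp F n i 1 = xe F n i := rfl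

theorem dp_zero (i : Fin m) : dp F n i 0 = mono F 0 ∅ := by simp [dp]

theorem conj_ne (hm : Even m) (i : Fin m) : conj i ≠ i := by
  have h2 := Nat.two_mul_div_two_of_even hm
  have hi := i.2
  intro h
  have := congrArg Fin.val h
  unfold conj at this
  split_ifs at this <;> simp at this <;> omega

theorem partialEven_dp (i j : Fin m) (a : ℕ) :
    partialEven F j (dp F n i (a + 1)) = if j = i then dp F n i a else 0 := by
  rw [dp, partialEven_mono]
  by_cases h : j = i
  · subst h
    have : (Pi.single j (a + 1) - Pi.single j 1 : Fin m → ℕ) = Pi.single j a := by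
      ext l
      by_cases hl : l = j
      · subst hl; simp
      · simp [hl]
    simp [dp, this]
  · simp [h]

theorem partialOdd_mono_empty (k : Fin n) (α : Fin m → ℕ) : partialOdd F k (mono F α ∅) = 0 :=
  partialOdd_mono_of_notMem (by simp) α

theorem DH_mono_empty (α : Fin m → ℕ) (g : SuperO F m n) :
    DH F (mono F α ∅) g =
      ∑ i, tau F i • mul F (partialEven F i (mono F α ∅)) (partialEven F (conj i) g) := by
  rw [DH_apply (mono_even _ (by simp)), Fintype.sum_sum_type]
  simp [partialOdd_mono_empty]

theorem DH_dp (i : Fin m) (a : ℕ) (g : SuperO F m n) :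
    DH F (dp F n i (a + 1)) g = tau F i • mul F (dp F n i a) (partialEven F (conj i) g) := by
  rw [dp, DH_mono_empty, Finset.sum_eq_single i]
  · rw [← dp, partialEven_dp, if_pos rfl]
  · intro j _ hj
    rw [← dp, partialEven_dp, if_neg hj]; simp
  · simp

theorem DH_xe (i : Fin m) (g : SuperO F m n) :
    DH F (xe F n i) g = tau F i • partialEven F (conj i) g := by
  rw [← dp_one, DH_dp, dp_zero, one_mul']

theorem DH_xe_eq (i : Fin m) : DH F (xe F n i) = tau F i • partialEven F (conj i) := by
  ext1 g; rw [DH_xe]; rfl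

theorem DH_xe_conj (hm : Even m) (i : Fin m) :
    partialEven F (n := n) i = DH F ((-tau F i) • xe F n (conj i)) := by
  rw [map_smul, DH_xe_eq, conj_conj, tau_conj hm, smul_smul, neg_mul_neg, tau_mul_self, one_smul]

/-- `{x_i x_j, g}`. -/
theorem DH_xe_mul_xe (i j : Fin m) (g : SuperO F m n) :
    DH F (mul F (xe F n i) (xe F n j)) g = tau F j • mul F (xe F n i) (partialEven F (conj j) g) +
      tau F i • mul F (xe F n j) (partialEven F (conj i) g) := by
  rw [DH_mul_eq (xe_even i) (xe_even j), DH_xe, DH_xe, map_smul, map_smul]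

theorem xe_mul_mono (i : Fin m) (α : Fin m → ℕ) (u : Finset (Fin n)) :
    mul F (xe F n i) (mono F α u) = ((α i + 1 : ℕ) : F) • mono F (α + Pi.single i 1) u := by
  rw [xe, mul_mono, if_pos (by simp), bc_eq_mul_prod i, Finset.prod_eq_one, add_comm α]
  · simp [inversions, add_comm]
  · intro j hj; simp [Finset.ne_of_mem_erase hj]

theorem dp_mul_mono (i : Fin m) (a : ℕ) (α : Fin m → ℕ) (u : Finset (Fin n)) :
    mul F (dp F n i a) (mono F α u) =
      ((α i + a).choose a : F) • mono F (α + Pi.single i a) u := by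
  rw [dp, mul_mono, if_pos (by simp), bc_eq_mul_prod i, Finset.prod_eq_one, add_comm α]
  · simp [inversions, add_comm]
  · intro j hj; simp [Finset.ne_of_mem_erase hj]

theorem partialEven_mono_succ (i : Fin m) (α : Fin m → ℕ) (u : Finset (Fin n)) :
    partialEven F i (mono F (α + Pi.single i 1) u) = mono F α u := by
  rw [partialEven_mono, if_neg (by simp), add_tsub_cancel_right]

theorem partialEven_mono_zero {i : Fin m} {α : Fin m → ℕ} (h : α i = 0) (u : Finset (Fin n)) :
    partialEven F i (mono F α u) = 0 := by
  rw [partialEven_mono, if_pos h]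

theorem sub_single_add {α : Fin m → ℕ} {i : Fin m} (h : α i ≠ 0) :
    α - Pi.single i 1 + Pi.single i 1 = α := by
  ext j
  by_cases hj : j = i
  · subst hj; simp; omega
  · simp [hj]

/-- The Euler operator `x_i ∂_i`. -/
theorem xe_mul_partialEven (i : Fin m) (α : Fin m → ℕ) (u : Finset (Fin n)) :
    mul F (xe F n i) (partialEven F i (mono F α u)) = (α i : F) • mono F α u := by
  rw [partialEven_mono]
  split_ifs with h
  · simp [h]
  · rw [xe_mul_mono, sub_single_add h]
    congr 2
    simp; omega

/-- The weight of the torus element `x_i x_{i'}`. -/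
theorem DH_torus (hm : Even m) (i : Fin m) (α : Fin m → ℕ) (u : Finset (Fin n)) :
    DH F (mul F (xe F n i) (xe F n (conj i))) (mono F α u) =
      (tau F i * ((α (conj i) : F) - α i)) • mono F α u := by
  rw [DH_xe_mul_xe, conj_conj, xe_mul_partialEven, xe_mul_partialEven, tau_conj hm, smul_smul,
    smul_smul, ← add_smul]
  congr 1; ring

/-- The action of `D_H(x_i^(a+1) x_{i'})` on monomials. -/
theorem DH_dp_mul_xe (hm : Even m) (i : Fin m) (a : ℕ) (β : Fin m → ℕ) (v : Finset (Fin n)) :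
    DH F (mul F (dp F n i (a + 1)) (xe F n (conj i))) (mono F β v) =
      (tau F i * ((β (conj i) : F) * ((β i + a).choose a : F) - ((β i + a).choose (a + 1) : F))) •
        mono F (β + Pi.single i a) v := by
  rw [DH_mul_eq (dp_even _ _) (xe_even _), DH_xe, DH_dp, conj_conj, tau_conj hm, map_smul, map_smul,
    ← mul_assoc', mul_comm_even (xe_even _), mul_assoc', xe_mul_partialEven, map_smul, dp_mul_mono]
  by_cases h : β i = 0
  · simp only [partialEven_mono_zero h, map_zero, smul_zero, zero_add, smul_smul, h]
    rw [Nat.choose_eq_zero_of_lt (show a < a + 1 by omega)]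
    congr 1; push_cast; ring
  · obtain ⟨γ, rfl⟩ : ∃ γ : Fin m → ℕ, β = γ + Pi.single i 1 := ⟨_, (sub_single_add h).symm⟩
    rw [partialEven_mono_succ, dp_mul_mono]
    have e : γ + Pi.single i 1 + Pi.single i a = γ + Pi.single i (a + 1) := by
      rw [add_assoc, ← Pi.single_add, add_comm 1 a]
    have e2 : (γ + Pi.single i 1 : Fin m → ℕ) i + a = γ i + (a + 1) := by simp; ring
    rw [e, e2, smul_smul, smul_smul, smul_smul, ← add_smul]
    congr 1; ring

theorem partialOdd_xo (k l : Fin n) : partialOdd F k (xo F m l) = if k = l then mono F 0 ∅ else 0 := by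
  rw [xo]
  by_cases h : k = l
  · subst h
    have := partialOdd_mono_insert (F := F) (k := k) (u := ∅) (by simp) (0 : Fin m → ℕ)
    simpa [inversions] using this
  · rw [partialOdd_mono_of_notMem (by simpa using h), if_neg h]

theorem partialEven_mono_zero_left (i : Fin m) (u : Finset (Fin n)) :
    partialEven F i (mono F 0 u) = 0 := partialEven_mono_zero rfl u

/-- The generator `x_k x_l` of the orthogonal part acts by `x_l ∂_{k'} - x_k ∂_{l'}`. -/
theorem DH_xo_mul_xo (k l : Fin n) (g : SuperO F m n) :
    DH F (mul F (xo F m k) (xo F m l)) g =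
      mul F (xo F m l) (partialOdd F (conj k) g) - mul F (xo F m k) (partialOdd F (conj l) g) := by
  have hkl := mul_mem_parityPart (xo_odd (F := F) (m := m) k) (xo_odd (F := F) (m := m) l)
  rw [show (1 + 1 : ZMod 2) = 0 from by decide] at hkl
  have he : ∀ i, partialEven F i (mul F (xo F m k) (xo F m l)) = 0 := fun i => by
    rw [partialEven_mul, xo, xo, partialEven_mono_zero_left, partialEven_mono_zero_left]; simp
  have ho : ∀ j, partialOdd F j (mul F (xo F m k) (xo F m l)) =
      (if j = k then xo F m l else 0) - (if j = l then xo F m k else 0) := fun j => by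
    rw [partialOdd_mul, parityInv_of_mem (xo_odd k), partialOdd_xo, partialOdd_xo]
    split_ifs <;> simp [one_mul', mul_one', zsgn, sub_eq_add_neg]
  rw [DH_apply hkl, Fintype.sum_sum_type]
  simp only [pd_inl, pd_inr, tauI_inr, conjI_inr, he, ho, map_zero, LinearMap.zero_apply, smul_zero,
    Finset.sum_const_zero, zero_add, one_smul, map_sub, LinearMap.sub_apply,
    Finset.sum_sub_distrib, apply_ite (mul F)]
  have : ∀ (c : Prop) [Decidable c] (a b : SuperO F m n),
      (if c then mul F a else 0) b = if c then mul F a b else 0 := by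
    intro c _ a b; split_ifs <;> simp
  simp [this]

theorem xo_mul_mono (k : Fin n) (α : Fin m → ℕ) (u : Finset (Fin n)) :
    mul F (xo F m k) (mono F α u) =
      if k ∈ u then 0 else (-1 : F) ^ inversions {k} u • mono F α (insert k u) := by
  rw [xo, mul_mono]
  have : bc F (0 : Fin m → ℕ) α = 1 := by simp [bc]
  simp [this, ite_not]

/-! ### Coefficients -/

/-- The coefficient of `x^(α) x^u`. -/
def coeff (α : Fin m → ℕ) (u : Finset (Fin n)) : SuperO F m n →ₗ[F] F :=
  (stdBasis F m n).coord (α, u)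

theorem coeff_mono (α β : Fin m → ℕ) (u v : Finset (Fin n)) :
    coeff α u (mono F β v) = if α = β ∧ u = v then 1 else 0 := by
  unfold coeff mono
  rw [Module.Basis.coord_apply, Module.Basis.repr_self, Finsupp.single_apply]
  simp only [Prod.mk.injEq, eq_comm]

theorem eq_zero_of_coeff {f : SuperO F m n} (h : ∀ α u, coeff α u f = 0) : f = 0 :=
  (stdBasis F m n).ext_elem fun a => by simpa [coeff] using h a.1 a.2

theorem coeff_partialEven (i : Fin m) (f : SuperO F m n) (α : Fin m → ℕ) (u : Finset (Fin n)) :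
    coeff α u (partialEven F i f) = coeff (α + Pi.single i 1) u f := by
  induction f using SuperO.induction with
  | hadd a b ha hb => simp only [map_add, ha, hb]
  | hsmul c a ha => simp only [map_smul, ha]
  | hmono β v =>
    rw [partialEven_mono, coeff_mono]
    split_ifs with h h2 h2
    · exact absurd h (by rw [← h2.1]; simp)
    · simp
    · rw [coeff_mono, ← h2.1, h2.2]; simp
    · rw [coeff_mono, if_neg]
      rintro ⟨rfl, rfl⟩
      exact h2 ⟨sub_single_add h, rfl⟩

/-- An element killed by all even derivatives lies in the exterior algebra. -/
theorem eq_zero_of_coeff_zero {f : SuperO F m n} (hf : ∀ i, partialEven F i f = 0)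
    (h : ∀ u, coeff 0 u f = 0) : f = 0 := by
  refine eq_zero_of_coeff fun α u => ?_
  by_cases hα : α = 0
  · rw [hα, h]
  · obtain ⟨i, hi⟩ := Function.ne_iff.mp hα
    rw [← sub_single_add (α := α) (i := i) hi, ← coeff_partialEven, hf, map_zero]

theorem coeff_of_mem_parityPart {f : SuperO F m n} {e : ZMod 2} (hf : f ∈ parityPart F m n e)
    (α : Fin m → ℕ) {u : Finset (Fin n)} (hu : (u.card : ZMod 2) ≠ e) : coeff α u f = 0 := by
  refine eq_on_parityPart (T' := (0 : SuperO F m n →ₗ[F] F)) (fun β v hv => ?_) hf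
  rw [coeff_mono, if_neg]; · rfl
  rintro ⟨-, rfl⟩
  exact hu hv

/-! ### Odd variables -/

theorem partialOdd_xo_mul (k l : Fin n) (g : SuperO F m n) :
    partialOdd F k (mul F (xo F m l) g) = (if k = l then g else 0) -
      mul F (xo F m l) (partialOdd F k g) := by
  rw [partialOdd_mul, parityInv_of_mem (xo_odd l), partialOdd_xo]
  split_ifs <;> simp [one_mul', zsgn, sub_eq_add_neg]

theorem xo_mul_xo_mul_self (k : Fin n) (g : SuperO F m n) :
    mul F (xo F m k) (mul F (xo F m k) g) = 0 := by
  rw [← mul_assoc', xo, mul_mono, if_neg (by simp)]; simp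

theorem partialOdd_self (k : Fin n) (g : SuperO F m n) :
    partialOdd F k (partialOdd F k g) = 0 := by
  induction g using SuperO.induction with
  | hadd a b ha hb => simp only [map_add, ha, hb, add_zero]
  | hsmul c a ha => simp only [map_smul, ha, smul_zero]
  | hmono α u =>
  simp only [partialOdd_mono]
  split_ifs <;> simp [partialOdd_mono]

theorem xo_mul_partialOdd_mono (k : Fin n) (α : Fin m → ℕ) (u : Finset (Fin n)) :
    mul F (xo F m k) (partialOdd F k (mono F α u)) = if k ∈ u then mono F α u else 0 := by
  split_ifs with h
  · obtain ⟨v, hv, rfl⟩ : ∃ v, k ∉ v ∧ insert k v = u :=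
      ⟨u.erase k, Finset.notMem_erase k u, Finset.insert_erase h⟩
    rw [partialOdd_mono_insert hv, map_smul, xo_mul_mono, if_neg hv, smul_smul, ← pow_add,
      Even.neg_one_pow ⟨_, rfl⟩, one_smul]
  · rw [partialOdd_mono_of_notMem h, map_zero]

theorem coeff_xo_mul_partialOdd (k : Fin n) (f : SuperO F m n) (α : Fin m → ℕ)
    (u : Finset (Fin n)) :
    coeff α u (mul F (xo F m k) (partialOdd F k f)) = if k ∈ u then coeff α u f else 0 := by
  induction f using SuperO.induction with
  | hadd a b ha hb => simp only [map_add, ha, hb]; split_ifs <;> simp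
  | hsmul c a ha => simp only [map_smul, ha]; split_ifs <;> simp
  | hmono β v =>
    rw [xo_mul_partialOdd_mono]
    by_cases h : α = β ∧ u = v
    · obtain ⟨rfl, rfl⟩ := h
      split_ifs <;> simp
    · split_ifs <;> simp [coeff_mono, h]

/-- If `x_k f = 0` then `f` is a combination of monomials divisible by `x_k`. -/
theorem coeff_of_xo_mul_eq_zero {k : Fin n} {f : SuperO F m n} (hf : mul F (xo F m k) f = 0)
    (α : Fin m → ℕ) {u : Finset (Fin n)} (hu : k ∉ u) : coeff α u f = 0 := by
  -- Applying ∂_k to x_k f = 0 gives f = x_k ∂_k f, and every monomial of the latter contains x_k.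
  have h := partialOdd_xo_mul k k f
  rw [hf, map_zero, if_pos rfl] at h
  rw [sub_eq_zero.mp h.symm, coeff_xo_mul_partialOdd, if_neg hu]

/-- `E_{k'} E_k` is diagonal, where `E_k = D_H(x_k x_ζ)` and `ζ` is the self-conjugate index. -/
theorem coeff_DH_DH {ζ : Fin n} (hζ : conj ζ = ζ) {k : Fin n} (hk : k ≠ ζ) (f : SuperO F m n)
    (α : Fin m → ℕ) (u : Finset (Fin n)) :
    coeff α u (DH F (mul F (xo F m (conj k)) (xo F m ζ))
      (DH F (mul F (xo F m k) (xo F m ζ)) f)) =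
      if ζ ∈ u then (if k ∈ u then 0 else -coeff α u f)
      else (if conj k ∈ u then -coeff α u f else 0) := by
  have hk' : conj k ≠ ζ := fun h => hk (by rw [← conj_conj k, h, hζ])
  -- Here E_k = x_ζ ∂_{k'} - x_k ∂_ζ. In the composition the squares of odd variables and
  -- derivatives vanish, leaving only the number operators x_j ∂_j, which are diagonal on monomials.
  have e : DH F (mul F (xo F m (conj k)) (xo F m ζ)) (DH F (mul F (xo F m k) (xo F m ζ)) f) =
      -mul F (xo F m ζ) (partialOdd F ζ f) +
        mul F (xo F m k) (partialOdd F k (mul F (xo F m ζ) (partialOdd F ζ f))) -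
        mul F (xo F m (conj k)) (partialOdd F (conj k) f) +
        mul F (xo F m ζ) (partialOdd F ζ (mul F (xo F m (conj k)) (partialOdd F (conj k) f))) := by
    have anti : ∀ a b (g : SuperO F m n), mul F (xo F m a) (mul F (xo F m b) g) =
        -mul F (xo F m b) (mul F (xo F m a) g) := fun a b g => by
      rw [← mul_assoc', mul_comm_of_mem (xo_odd a) (xo_odd b), map_smul, LinearMap.smul_apply,
        mul_assoc']; simp [zsgn]
    simp only [DH_xo_mul_xo, conj_conj, hζ, map_sub, partialOdd_xo_mul, hk, hk.symm, hk'.symm,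
      if_true, if_false, zero_sub, map_neg, xo_mul_xo_mul_self, partialOdd_self, map_zero]
    rw [anti ζ k, partialOdd_partialOdd k ζ, anti (conj k) ζ, partialOdd_partialOdd ζ (conj k)]
    simp only [map_neg]
    abel
  rw [e]
  simp only [map_add, map_sub, map_neg, coeff_xo_mul_partialOdd]
  by_cases h1 : ζ ∈ u <;> by_cases h2 : k ∈ u <;> by_cases h3 : conj k ∈ u <;> simp [h1, h2, h3]

/-! ### Odd vector fields -/

/-- The variable `x_r`, `r ∈ I`. -/
def xv (F : Type*) [Field F] (r : Fin m ⊕ Fin n) : SuperO F m n := Sum.elim (xe F n) (xo F m) r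

theorem partialEven_xe (i j : Fin m) :
    partialEven F i (xe F n j) = if i = j then mono F 0 ∅ else 0 := by
  rw [← dp_one, ← zero_add 1, partialEven_dp, dp_zero]

theorem pd_xv (r s : Fin m ⊕ Fin n) : pd F r (xv F s) = if r = s then mono F 0 ∅ else 0 := by
  rcases r with i | k <;> rcases s with j | l
  · simp [xv, partialEven_xe]
  · simp [xv, xo, partialEven_mono]
  · simp [xv, xe, partialOdd_mono_empty]
  · simp [xv, partialOdd_xo]

/-- Odd vector fields `∑_r c_r ∂_r`, without restriction on the exponents. -/
def oddFields (F : Type*) [Field F] (m n : ℕ) : Submodule F (EndO F m n) where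
  carrier := {D | (∀ h, D h = ∑ r, mul F (D (xv F r)) (pd F r h)) ∧
    ∀ r, D (xv F r) ∈ parityPart F m n (ipar r + 1)}
  add_mem' := by
    rintro D E ⟨h1, h2⟩ ⟨h3, h4⟩
    refine ⟨fun h => ?_, fun r => Submodule.add_mem _ (h2 r) (h4 r)⟩
    rw [LinearMap.add_apply, h1 h, h3 h, ← Finset.sum_add_distrib]
    simp
  zero_mem' := ⟨fun h => by simp, fun r => Submodule.zero_mem _⟩
  smul_mem' := by
    rintro c D ⟨h1, h2⟩
    refine ⟨fun h => ?_, fun r => Submodule.smul_mem _ _ (h2 r)⟩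
    rw [LinearMap.smul_apply, h1 h, Finset.smul_sum]
    simp

theorem leftMul_pd_mem_oddFields {f : SuperO F m n} (r : Fin m ⊕ Fin n)
    (hf : f ∈ parityPart F m n (ipar r + 1)) : leftMul F f (pd F r) ∈ oddFields F m n := by
  have h : ∀ s, leftMul F f (pd F r) (xv F s) = if r = s then f else 0 := fun s => by
    rw [leftMul, LinearMap.comp_apply, pd_xv]
    split_ifs <;> simp [mul_one']
  refine ⟨fun g => ?_, fun s => ?_⟩
  · rw [Finset.sum_eq_single r]
    · rw [h, if_pos rfl]; rfl
    · intro s _ hs; rw [h, if_neg hs.symm]; simp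
    · simp
  · rw [h]; split_ifs with e
    · exact e ▸ hf
    · exact Submodule.zero_mem _

/-- The bound α ≤ π on coefficients is dropped: the argument only needs that an odd field is
determined by its values on the variables, and the parity of these values. -/
theorem WOdd_le_oddFields (p : ℕ) (t : Fin m → ℕ) : WOdd F n p t ≤ oddFields F m n := by
  refine Submodule.span_le.mpr ?_
  rintro _ ⟨α, u, r, -, hu, rfl⟩
  refine leftMul_pd_mem_oddFields r (mono_mem_parityPart _ _ ?_)
  rcases r with i | k
  · simpa using natCast_zmod_two_eq_one.mpr hu
  · have h := natCast_zmod_two_eq_one.mpr hu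
    simp only [Sum.elim_inr, Nat.cast_add, Nat.cast_one] at h
    have h2 : ∀ a : ZMod 2, a + 1 = 1 → a = 1 + 1 := by decide
    exact h2 _ h

theorem oddFields_one {D : EndO F m n} (hD : D ∈ oddFields F m n) : D (mono F 0 ∅) = 0 := by
  rw [hD.1]
  refine Finset.sum_eq_zero fun r _ => ?_
  rcases r with i | k
  · simp [partialEven_mono]
  · simp [partialOdd_mono]

theorem oddFields_ext {D : EndO F m n} (hD : D ∈ oddFields F m n)
    (he : ∀ i, D (xe F n i) = 0) (ho : ∀ k, D (xo F m k) = 0) : D = 0 := by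
  ext1 h
  rw [hD.1]
  refine Finset.sum_eq_zero fun r _ => ?_
  rcases r with i | k
  · rw [show D (xv F (Sum.inl i)) = 0 from he i]; simp
  · rw [show D (xv F (Sum.inr k)) = 0 from ho k]; simp

/-- Fields that commute with all `∂_i`, `i ∈ I₀`, have coefficients in the exterior algebra. -/
theorem partialEven_of_commute {D : EndO F m n} (hD : D ∈ oddFields F m n)
    (hc : ∀ i : Fin m, ⁅(partialEven F i : EndO F m n), D⁆ = 0) (r : Fin m ⊕ Fin n) (i : Fin m) :
    partialEven F i (D (xv F r)) = 0 := by
  have h := LinearMap.congr_fun (hc i) (xv F r)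
  rw [Ring.lie_def, LinearMap.sub_apply, Module.End.mul_apply, Module.End.mul_apply,
    LinearMap.zero_apply, ← pd_inl, pd_xv, sub_eq_zero] at h
  rw [← pd_inl, h]
  split_ifs
  · exact oddFields_one hD
  · exact map_zero _

/-- Elements of the exterior algebra have weight zero, because x_i x_j acts through even derivatives
only. -/
theorem torus_of_partialEven {f : SuperO F m n} (hf : ∀ i, partialEven F i f = 0) (i j : Fin m) :
    DH F (mul F (xe F n i) (xe F n j)) f = 0 := by
  rw [DH_xe_mul_xe, hf, hf]; simp

theorem torus_xe (hm : Even m) (i j : Fin m) :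
    DH F (mul F (xe F n i) (xe F n (conj i))) (xe F n j) =
      (tau F i * ((if j = conj i then 1 else 0) - (if j = i then 1 else 0))) • xe F n j := by
  have h := DH_torus (F := F) (n := n) hm i (Pi.single j 1) ∅
  rw [Pi.single_apply, Pi.single_apply] at h
  simp only [eq_comm (b := j), Nat.cast_ite, Nat.cast_one, Nat.cast_zero] at h
  exact h

theorem lie_apply (A D : EndO F m n) (f : SuperO F m n) : ⁅A, D⁆ f = A (D f) - D (A f) := by
  rw [Ring.lie_def, LinearMap.sub_apply, Module.End.mul_apply, Module.End.mul_apply]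

/-- Weights of the even coefficients. -/
theorem weight_even (hm : Even m) {D : EndO F m n} (hD : D ∈ oddFields F m n)
    (hc : ∀ i : Fin m, ⁅(partialEven F i : EndO F m n), D⁆ = 0) {i : Fin m} {w : F}
    (hw : ⁅DH F (mul F (xe F n i) (xe F n (conj i))), D⁆ = (tau F i * w) • D) (j : Fin m) :
    (w + (if j = conj i then 1 else 0) - (if j = i then 1 else 0)) • D (xe F n j) = 0 := by
  -- Evaluated at x_j, the relation only sees the weight of x_j, since the coefficient of D there
  -- has weight zero.
  have h := LinearMap.congr_fun hw (xe F n j)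
  have h0 := torus_of_partialEven (partialEven_of_commute hD hc (Sum.inl j)) i (conj i)
  change DH F _ (D (xe F n j)) = 0 at h0
  rw [lie_apply, h0, torus_xe hm, map_smul, LinearMap.smul_apply, ← sub_eq_zero, zero_sub,
    ← neg_smul, ← sub_smul] at h
  refine (smul_eq_zero.mp h).elim (fun h => ?_) (fun h => by rw [h, smul_zero])
  have h2 : tau F i * (w + (if j = conj i then 1 else 0) - (if j = i then 1 else 0)) = 0 := by
    linear_combination -h
  rw [(mul_eq_zero.mp h2).resolve_left (tau_ne_zero i), zero_smul]

/-- Weights of the odd coefficients. -/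
theorem weight_odd {D : EndO F m n} (hD : D ∈ oddFields F m n)
    (hc : ∀ i : Fin m, ⁅(partialEven F i : EndO F m n), D⁆ = 0) {i : Fin m} {w : F}
    (hw : ⁅DH F (mul F (xe F n i) (xe F n (conj i))), D⁆ = (tau F i * w) • D) (k : Fin n) :
    w • D (xo F m k) = 0 := by
  have h := LinearMap.congr_fun hw (xo F m k)
  have h0 := torus_of_partialEven (partialEven_of_commute hD hc (Sum.inr k)) i (conj i)
  change DH F _ (D (xo F m k)) = 0 at h0
  rw [lie_apply, h0, torus_of_partialEven (f := xo F m k) (fun i => partialEven_mono_zero_left i _), map_zero,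
    sub_zero, LinearMap.smul_apply] at h
  have h2 := smul_eq_zero.mp h.symm
  rcases h2 with h2 | h2
  · rw [(mul_eq_zero.mp h2).resolve_left (tau_ne_zero i), zero_smul]
  · rw [h2, smul_zero]

/-! ### Derivations of `𝒥` as maps on Hamiltonian functions -/

/-- The exponents of the monomials that span `idealO`. -/
structure Valid (p : ℕ) (t : Fin m → ℕ) (α : Fin m → ℕ) (u : Finset (Fin n)) : Prop where
  le : α ≤ topExp p t
  even : Even u.card
  ne : u = ∅ → α ≠ topExp p t

/-- A derivation `D_H(f) ↦ Ψ(f)` of `𝒥` into the odd vector fields that vanishes in degrees `-1`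
and `0`, normalized by the coefficients that detect the exceptional derivations. -/
structure IsNormalizedDer (p : ℕ) (t : Fin m → ℕ) (ζ : Fin n)
    (Ψ : SuperO F m n →ₗ[F] EndO F m n) : Prop where
  prime : p.Prime
  char : CharP F p
  three_lt : 3 < p
  m_pos : 0 < m
  even_m : Even m
  odd_n : Odd n
  conj_eq : ∀ k : Fin n, conj k = k ↔ k = ζ
  t_pos : ∀ i, 0 < t i
  mem : ∀ f ∈ idealO F n p t, Ψ f ∈ oddFields F m n
  der : ∀ f ∈ idealO F n p t, ∀ g ∈ idealO F n p t, DH F f g ∈ idealO F n p t →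
    Ψ (DH F f g) = ⁅Ψ f, DH F g⁆ + ⁅DH F f, Ψ g⁆
  low : ∀ α u, Valid p t α u → (∑ i, α i) + u.card ≤ 2 → Ψ (mono F α u) = 0
  normΦ : ∀ i q, 1 ≤ q → q < t i →
    coeff 0 (Finset.univ.erase ζ) (Ψ (dp F n i (p ^ q)) (xo F m ζ)) = 0
  normΘ : ∀ i q, 1 ≤ q → q < t i →
    coeff 0 Finset.univ (Ψ (mul F (dp F n i (p ^ q)) (xe F n (conj i))) (xe F n i)) = 0

/-- The elements of `idealO` killed by `Ψ`. -/
def killed (p : ℕ) (t : Fin m → ℕ) (Ψ : SuperO F m n →ₗ[F] EndO F m n) :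
    Submodule F (SuperO F m n) := idealO F n p t ⊓ LinearMap.ker Ψ

theorem idealO_le_parityPart (p : ℕ) (t : Fin m → ℕ) : idealO F n p t ≤ parityPart F m n 0 := by
  refine Submodule.span_le.mpr ?_
  rintro _ ⟨α, u, -, h, -, -, rfl⟩
  exact mono_even _ h

/-! ### Equivariance under killed elements and torus weights -/

namespace IsNormalizedDer

variable {p : ℕ} {t : Fin m → ℕ} {ζ : Fin n} {Ψ : SuperO F m n →ₗ[F] EndO F m n}

theorem valid_mem_idealO (H : IsNormalizedDer p t ζ Ψ) {α : Fin m → ℕ} {u : Finset (Fin n)}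
    (h : Valid p t α u) : mono F α u ∈ idealO F n p t := by
  refine Submodule.subset_span ⟨α, u, h.le, h.even, fun e => ?_, fun e => ?_, rfl⟩
  · have h1 := h.even
    rw [(Prod.mk.inj e).2, Finset.card_univ, Fintype.card_fin] at h1
    exact (Nat.not_even_iff_odd.mpr H.odd_n) h1
  · exact h.ne (Prod.mk.inj e).2 (Prod.mk.inj e).1

theorem mem_killed {f : SuperO F m n} :
    f ∈ killed p t Ψ ↔ f ∈ idealO F n p t ∧ Ψ f = 0 := Iff.rfl

/-- Since Ψ(q) = 0, one term of the derivation rule drops out: Ψ is equivariant under the adjoint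
action of every killed element. All further restrictions on Ψ use this. -/
theorem act (H : IsNormalizedDer p t ζ Ψ) {q f : SuperO F m n} (hq : q ∈ killed p t Ψ)
    (hf : f ∈ idealO F n p t) (hqf : DH F q f ∈ idealO F n p t) :
    Ψ (DH F q f) = ⁅DH F q, Ψ f⁆ := by
  rw [H.der q hq.1 f hf hqf, (mem_killed.mp hq).2]
  simp [Ring.lie_def]

theorem bracket_mem (H : IsNormalizedDer p t ζ Ψ) {f g : SuperO F m n} (hf : f ∈ killed p t Ψ)
    (hg : g ∈ killed p t Ψ) (h : DH F f g ∈ idealO F n p t) : DH F f g ∈ killed p t Ψ := by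
  refine ⟨h, ?_⟩
  change Ψ (DH F f g) = 0
  rw [H.act hf hg.1 h, (mem_killed.mp hg).2]
  simp [Ring.lie_def]

/-- If `{f, g}` is `c • x` plus killed terms, with `c ≠ 0`, then `x` is killed. -/
theorem mem_of_bracket (H : IsNormalizedDer p t ζ Ψ) {f g x r : SuperO F m n} {c : F}
    (hf : f ∈ killed p t Ψ) (hg : g ∈ killed p t Ψ) (hx : x ∈ idealO F n p t)
    (hr : r ∈ killed p t Ψ) (hc : c ≠ 0) (h : DH F f g = c • x + r) : x ∈ killed p t Ψ := by
  have h1 : DH F f g ∈ killed p t Ψ := H.bracket_mem hf hg (by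
    rw [h]; exact Submodule.add_mem _ (Submodule.smul_mem _ _ hx) hr.1)
  rw [h] at h1
  exact (Submodule.smul_mem_iff _ hc).mp ((Submodule.add_mem_iff_left _ hr).mp h1)

theorem mem_of_bracket' (H : IsNormalizedDer p t ζ Ψ) {f g x : SuperO F m n} {c : F}
    (hf : f ∈ killed p t Ψ) (hg : g ∈ killed p t Ψ) (hx : x ∈ idealO F n p t)
    (hc : c ≠ 0) (h : DH F f g = c • x) : x ∈ killed p t Ψ :=
  H.mem_of_bracket hf hg hx (Submodule.zero_mem _) hc (by rw [h, add_zero])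

/-- A prime larger than 3 is not 4, so p ≥ 5 and π_i ≥ p - 1 ≥ 4. -/
theorem four_le_topExp (H : IsNormalizedDer p t ζ Ψ) (i : Fin m) : 4 ≤ topExp p t i := by
  have h1 : p ≤ p ^ t i := (pow_one p).symm.le.trans <| Nat.pow_le_pow_right H.prime.pos (H.t_pos i)
  have h2 : p ≠ 4 := fun h => by have := H.prime; rw [h] at this; revert this; decide
  have := H.three_lt
  unfold topExp
  omega

/-- Exponents at most 3 stay below π_i ≥ 4, and m > 0 provides a coordinate that tells α from π. -/
theorem valid_of_sum_le (H : IsNormalizedDer p t ζ Ψ) {α : Fin m → ℕ} {u : Finset (Fin n)}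
    (h : ∑ i, α i ≤ 3) (hu : Even u.card) : Valid p t α u := by
  have h1 : ∀ i, α i ≤ 3 := fun i =>
    (Finset.single_le_sum (fun j _ => Nat.zero_le (α j)) (Finset.mem_univ i)).trans h
  refine ⟨fun i => (h1 i).trans (le_trans (by norm_num) (H.four_le_topExp i)), hu, fun _ e => ?_⟩
  have h2 := H.four_le_topExp ⟨0, H.m_pos⟩
  rw [← e] at h2
  have := h1 ⟨0, H.m_pos⟩
  omega

theorem low_mem (H : IsNormalizedDer p t ζ Ψ) {α : Fin m → ℕ} {u : Finset (Fin n)}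
    (h : (∑ i, α i) + u.card ≤ 2) (hu : Even u.card) : mono F α u ∈ killed p t Ψ :=
  have hv := H.valid_of_sum_le (α := α) (u := u) (by omega) hu
  ⟨H.valid_mem_idealO hv, H.low α u hv h⟩

theorem sum_single (i : Fin m) (a : ℕ) : ∑ j, (Pi.single i a : Fin m → ℕ) j = a := by
  rw [Finset.sum_pi_single']; simp

theorem xe_mem (H : IsNormalizedDer p t ζ Ψ) (i : Fin m) : xe F n i ∈ killed p t Ψ :=
  H.low_mem (by rw [sum_single]; simp) (by simp)

theorem xe_mul_xe_mem (H : IsNormalizedDer p t ζ Ψ) (i j : Fin m) :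
    mul F (xe F n i) (xe F n j) ∈ killed p t Ψ := by
  change mul F (xe F n i) (mono F (Pi.single j 1) ∅) ∈ _
  rw [xe_mul_mono]
  refine Submodule.smul_mem _ _ (H.low_mem ?_ (by simp))
  simp only [Pi.add_apply, Finset.sum_add_distrib, sum_single, Finset.card_empty]
  norm_num

theorem xo_mul_xo_mem (H : IsNormalizedDer p t ζ Ψ) (k l : Fin n) :
    mul F (xo F m k) (xo F m l) ∈ killed p t Ψ := by
  change mul F (xo F m k) (mono F 0 {l}) ∈ _
  rw [xo_mul_mono]
  split_ifs with h
  · exact Submodule.zero_mem _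
  · refine Submodule.smul_mem _ _ (H.low_mem ?_ ?_)
    · rw [Finset.card_insert_of_notMem h]; simp
    · rw [Finset.card_insert_of_notMem h]; simp

/-- All monomials of total degree less than `N` are killed. -/
def Lower (F : Type*) [Field F] {m n : ℕ} (p : ℕ) (t : Fin m → ℕ)
    (Ψ : SuperO F m n →ₗ[F] EndO F m n) (N : ℕ) : Prop :=
  ∀ α u, Valid p t α u → (∑ i, α i) + u.card < N → mono F α u ∈ killed p t Ψ

theorem sum_sub_single {α : Fin m → ℕ} {i : Fin m} {a : ℕ} (h : a ≤ α i) :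
    ∑ j, (α - Pi.single i a : Fin m → ℕ) j + a = ∑ j, α j := by
  have : α - Pi.single i a + Pi.single i a = α := by
    ext j
    by_cases hj : j = i
    · subst hj; simp; omega
    · simp [hj]
  conv_rhs => rw [← this]
  simp only [Pi.add_apply, Finset.sum_add_distrib, sum_single]

theorem sub_single_valid {α : Fin m → ℕ} {u : Finset (Fin n)}
    (h : Valid p t α u) {i : Fin m} {a : ℕ} (ha : 0 < a) (hi : a ≤ α i) :
    Valid p t (α - Pi.single i a) u := by
  refine ⟨fun j => (Nat.sub_le _ _).trans (h.le j), h.even, fun _ e => ?_⟩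
  have h1 := congrFun e i
  simp only [Pi.sub_apply, Pi.single_eq_same] at h1
  have : α i ≤ topExp p t i := h.le i
  omega

/-- Up to sign ∂_i is D_H(x_{i'}), and x_{i'} is killed. By equivariance the commutator is Ψ(∂_i f),
which vanishes because ∂_i f has smaller degree. -/
theorem commute_partialEven (H : IsNormalizedDer p t ζ Ψ) {α : Fin m → ℕ} {u : Finset (Fin n)}
    (h : Valid p t α u) (hL : Lower F p t Ψ ((∑ i, α i) + u.card)) (i : Fin m) :
    ⁅(partialEven F i : EndO F m n), Ψ (mono F α u)⁆ = 0 := by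
  have h1 : partialEven F i (mono F α u) ∈ killed p t Ψ := by
    rw [partialEven_mono]
    split_ifs with hi
    · exact Submodule.zero_mem _
    · have hi' : 1 ≤ α i := Nat.one_le_iff_ne_zero.mpr hi
      have := sum_sub_single hi'
      exact hL _ _ (sub_single_valid h one_pos hi') (by omega)
  have h2 : (-tau F i) • xe F n (conj i) ∈ killed p t Ψ :=
    Submodule.smul_mem _ _ (H.xe_mem _)
  rw [DH_xe_conj H.even_m] at h1 ⊢
  rw [← H.act h2 (H.valid_mem_idealO h) h1.1, (mem_killed.mp h1).2]

theorem torus_weight (H : IsNormalizedDer p t ζ Ψ) {α : Fin m → ℕ} {u : Finset (Fin n)}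
    (h : Valid p t α u) (i : Fin m) :
    ⁅DH F (mul F (xe F n i) (xe F n (conj i))), Ψ (mono F α u)⁆ =
      (tau F i * ((α (conj i) : F) - α i)) • Ψ (mono F α u) := by
  have h2 := DH_torus (F := F) H.even_m i α u
  rw [← H.act (H.xe_mul_xe_mem _ _) (H.valid_mem_idealO h) (by
    rw [h2]; exact Submodule.smul_mem _ _ (H.valid_mem_idealO h)), h2, map_smul]

/-- The component along ∂_j has an exterior coefficient of weight 0, so its whole weight is that of
∂_j. It vanishes unless this agrees with the weight of the monomial. -/
theorem coeff_even_eq_zero (H : IsNormalizedDer p t ζ Ψ) {α : Fin m → ℕ} {u : Finset (Fin n)}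
    (h : Valid p t α u) (hL : Lower F p t Ψ ((∑ i, α i) + u.card)) {i j : Fin m}
    (hw : (α (conj i) : F) - α i + (if j = conj i then 1 else 0) - (if j = i then 1 else 0) ≠ 0) :
    Ψ (mono F α u) (xe F n j) = 0 :=
  (smul_eq_zero.mp (weight_even H.even_m (H.mem _ (H.valid_mem_idealO h))
    (H.commute_partialEven h hL) (H.torus_weight h i) j)).resolve_left hw

theorem coeff_odd_eq_zero (H : IsNormalizedDer p t ζ Ψ) {α : Fin m → ℕ} {u : Finset (Fin n)}
    (h : Valid p t α u) (hL : Lower F p t Ψ ((∑ i, α i) + u.card)) {i : Fin m}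
    (hw : (α (conj i) : F) - α i ≠ 0) (k : Fin n) :
    Ψ (mono F α u) (xo F m k) = 0 :=
  (smul_eq_zero.mp (weight_odd (H.mem _ (H.valid_mem_idealO h))
    (H.commute_partialEven h hL) (H.torus_weight h i) k)).resolve_left hw

theorem mem_of_coeff (H : IsNormalizedDer p t ζ Ψ) {α : Fin m → ℕ} {u : Finset (Fin n)}
    (h : Valid p t α u) (he : ∀ i, Ψ (mono F α u) (xe F n i) = 0)
    (ho : ∀ k, Ψ (mono F α u) (xo F m k) = 0) : mono F α u ∈ killed p t Ψ :=
  ⟨H.valid_mem_idealO h, oddFields_ext (H.mem _ (H.valid_mem_idealO h)) he ho⟩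

/-- Monomials of a weight other than `0`, `±1` are killed. -/
theorem mem_of_weight (H : IsNormalizedDer p t ζ Ψ) {α : Fin m → ℕ} {u : Finset (Fin n)}
    (h : Valid p t α u) (hL : Lower F p t Ψ ((∑ i, α i) + u.card)) {i : Fin m}
    (h0 : (α (conj i) : F) - α i ≠ 0) (h1 : (α (conj i) : F) - α i ≠ 1)
    (h2 : (α (conj i) : F) - α i ≠ -1) : mono F α u ∈ killed p t Ψ := by
  refine H.mem_of_coeff h (fun j => H.coeff_even_eq_zero h hL (i := i) ?_)
    (H.coeff_odd_eq_zero h hL h0)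
  by_cases a : j = conj i
  · have : j ≠ i := a ▸ conj_ne H.even_m i
    rw [if_pos a, if_neg this, sub_zero]
    exact fun e => h2 (eq_neg_of_add_eq_zero_left e)
  · by_cases b : j = i
    · rw [if_neg a, if_pos b, add_zero]
      exact fun e => h1 (sub_eq_zero.mp e)
    · simpa [a, b] using h0

/-- Monomials with two nonzero weights are killed. -/
theorem mem_of_two_weights (H : IsNormalizedDer p t ζ Ψ) {α : Fin m → ℕ} {u : Finset (Fin n)}
    (h : Valid p t α u) (hL : Lower F p t Ψ ((∑ i, α i) + u.card)) {i j : Fin m}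
    (hij : j ≠ i) (hij' : j ≠ conj i)
    (hi : (α (conj i) : F) - α i ≠ 0) (hj : (α (conj j) : F) - α j ≠ 0) :
    mono F α u ∈ killed p t Ψ := by
  refine H.mem_of_coeff h (fun r => ?_) (H.coeff_odd_eq_zero h hL hi)
  -- The torus element of j sees weight 0 on components in the pair {i, i'}; the torus element of i
  -- sees weight 0 on all the others.
  by_cases hr : r = i ∨ r = conj i
  · refine H.coeff_even_eq_zero h hL (i := j) ?_
    have h1 : r ≠ j := by rintro rfl; exact hr.elim hij hij'
    have h2 : r ≠ conj j := by
      rintro rfl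
      rcases hr with hr | hr
      · exact hij' (by rw [← hr, conj_conj])
      · exact hij (by rw [← conj_conj j, hr, conj_conj])
    simpa [h1, h2] using hj
  · push Not at hr
    refine H.coeff_even_eq_zero h hL (i := i) ?_
    simpa [hr.1, hr.2] using hi

theorem dp_mul_xe_conj (hm : Even m) (i : Fin m) (a : ℕ) :
    mul F (dp F n i a) (xe F n (conj i)) = mono F (Pi.single i a + Pi.single (conj i) 1) ∅ := by
  rw [mul_comm_even (dp_even _ _), dp, xe_mul_mono]
  simp [conj_ne hm i]

/-- Bracket with `x_i^(a+1) x_{i'}`. -/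
theorem mem_of_dp (H : IsNormalizedDer p t ζ Ψ) {α : Fin m → ℕ} {u : Finset (Fin n)}
    (h : Valid p t α u) (hL : Lower F p t Ψ ((∑ i, α i) + u.card)) {i : Fin m} {a : ℕ}
    (ha : 0 < a) (ha' : a ≤ α i) (hat : a + 1 ≤ topExp p t i)
    (hN : a + 2 < (∑ i, α i) + u.card)
    (hc : (α (conj i) : F) * ((α i).choose a : F) - ((α i).choose (a + 1) : F) ≠ 0) :
    mono F α u ∈ killed p t Ψ := by
  have hm := H.even_m
  have e : α - Pi.single i a + Pi.single i a = α := by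
    ext j
    by_cases hj : j = i
    · subst hj; simp; omega
    · simp [hj]
  have key := DH_dp_mul_xe (F := F) hm i a (α - Pi.single i a) u
  rw [e] at key
  have e1 : (α - Pi.single i a : Fin m → ℕ) i + a = α i := by simp; omega
  have e2 : (α - Pi.single i a : Fin m → ℕ) (conj i) = α (conj i) := by simp [conj_ne hm i]
  rw [e1, e2] at key
  -- The bracket is a multiple of the monomial itself, without remainder. The two factors have
  -- degrees a + 2 and |α| + |u| - a, both smaller than |α| + |u|.
  refine H.mem_of_bracket' ?_ ?_ (H.valid_mem_idealO h) (mul_ne_zero (tau_ne_zero i) hc) key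
  · rw [dp_mul_xe_conj hm]
    refine hL _ _ ⟨fun j => ?_, by simp, fun _ e => ?_⟩ ?_
    · by_cases hj : j = i
      · subst hj; simpa [(conj_ne hm j).symm] using hat
      · have h4 := H.four_le_topExp j
        by_cases hj' : j = conj i
        · subst hj'; simp [hj]; omega
        · simp [hj, hj']
    · have h1 := congrFun e (conj i)
      have h4 := H.four_le_topExp (conj i)
      simp [conj_ne hm i] at h1
      omega
    · simp only [Pi.add_apply, Finset.sum_add_distrib, sum_single, Finset.card_empty]
      omega
  · have := sum_sub_single ha'
    exact hL _ _ (sub_single_valid h ha ha') (by omega)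

end IsNormalizedDer

/-! ### Binomial coefficients modulo p -/

theorem choose_prime_pow_mul_modEq {p : ℕ} [Fact p.Prime] (v c : ℕ) :
    (p ^ v * c).choose (p ^ v) ≡ c [MOD p] := by
  induction v with
  | zero => simp [Nat.ModEq]
  | succ v ih =>
    have hp : 0 < p := (Fact.out : p.Prime).pos
    -- Lucas' congruence strips one factor p from both entries, the last base-p digits being zero.
    have h := Choose.choose_modEq_choose_mod_mul_choose_div_nat (p := p) (n := p ^ (v + 1) * c)
      (k := p ^ (v + 1))
    have e1 : p ^ (v + 1) * c / p = p ^ v * c := by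
      rw [pow_succ, mul_right_comm, Nat.mul_div_cancel _ hp]
    have e2 : p ^ (v + 1) / p = p ^ v := by rw [pow_succ, Nat.mul_div_cancel _ hp]
    have e3 : p ^ (v + 1) % p = 0 := by rw [pow_succ]; exact Nat.mul_mod_left _ _
    rw [e1, e2, e3, Nat.choose_zero_right, one_mul] at h
    exact h.trans ih

/-- A positive multiple `a` of `p` that is not a power of `p` has a multiple of `p` strictly
between `0` and `a` at which the binomial coefficient does not vanish. -/
theorem exists_choose_ne_zero {p a : ℕ} (hp : p.Prime) (ha : 0 < a) (hpa : p ∣ a)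
    (hq : ∀ q, 1 ≤ q → a ≠ p ^ q) :
    ∃ b, 0 < b ∧ b < a ∧ p ∣ b ∧ ¬ p ∣ a.choose b ∧ p ∣ a.choose (b - 1) := by
  have := Fact.mk hp
  obtain ⟨v, c, hc, rfl⟩ := Nat.exists_eq_pow_mul_and_not_dvd ha.ne' p hp.ne_one
  have hv : 1 ≤ v := by
    rcases v with _ | v
    · exact absurd (by simpa using hpa) hc
    · omega
  have hc1 : c ≠ 1 := fun e => hq v hv (by rw [e, mul_one])
  have hc0 : c ≠ 0 := fun e => hc (e ▸ dvd_zero p)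
  have hpos : 0 < p ^ v := pow_pos hp.pos v
  have hpv : p ∣ p ^ v := dvd_pow_self p (by omega)
  have hlt : p ^ v < p ^ v * c := by nlinarith [show 2 ≤ c by omega]
  -- The witness is the exact power of p in a = p^v c, where the binomial coefficient is c mod p.
  refine ⟨p ^ v, hpos, hlt, hpv, fun h => hc ?_, ?_⟩
  · exact (Nat.modEq_zero_iff_dvd.mp ((choose_prime_pow_mul_modEq v c).symm.trans
      (Nat.modEq_zero_iff_dvd.mpr h)))
  -- From b · C(a, b) = (a - b + 1) · C(a, b - 1): p divides b, while a - b + 1 is 1 mod p.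
  · have h := Nat.choose_succ_right_eq (p ^ v * c) (p ^ v - 1)
    rw [Nat.sub_add_cancel hpos] at h
    have h1 : p ∣ (p ^ v * c).choose (p ^ v - 1) * (p ^ v * c - (p ^ v - 1)) :=
      h ▸ Dvd.dvd.mul_left hpv _
    refine (hp.dvd_mul.mp h1).resolve_right fun h2 => hp.one_lt.ne' ?_
    have h3 : p ^ v * c - (p ^ v - 1) = (p ^ v * c - p ^ v) + 1 := by omega
    rw [h3] at h2
    exact Nat.dvd_one.mp ((Nat.dvd_add_right (Nat.dvd_sub hpa hpv)).mp h2)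

/-! ### Symplectic root vectors and cubic monomials -/

namespace IsNormalizedDer

variable {p : ℕ} {t : Fin m → ℕ} {ζ : Fin n} {Ψ : SuperO F m n →ₗ[F] EndO F m n}

theorem cast_eq_zero (H : IsNormalizedDer p t ζ Ψ) (a : ℕ) : (a : F) = 0 ↔ p ∣ a :=
  haveI := H.char
  CharP.cast_eq_zero_iff F p a

theorem cast_ne_zero (H : IsNormalizedDer p t ζ Ψ) {a : ℕ} (h : 0 < a) (h' : a < p) :
    (a : F) ≠ 0 := by
  rw [Ne, H.cast_eq_zero]
  exact Nat.not_dvd_of_pos_of_lt h h'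

theorem two_ne (H : IsNormalizedDer p t ζ Ψ) : (2 : F) ≠ 0 := by
  have := H.three_lt
  exact_mod_cast H.cast_ne_zero (a := 2) (by omega) (by omega)

theorem three_ne (H : IsNormalizedDer p t ζ Ψ) : (3 : F) ≠ 0 := by
  have := H.three_lt
  exact_mod_cast H.cast_ne_zero (a := 3) (by omega) (by omega)

/-- The action of a long root vector of the symplectic part. -/
theorem mem_of_root_conj (H : IsNormalizedDer p t ζ Ψ) {α : Fin m → ℕ} {u : Finset (Fin n)}
    (h : Valid p t α u) {i : Fin m} (hi : (α i : F) ≠ 0)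
    (hg : mono F (α - Pi.single i 1 + Pi.single (conj i) 1) u ∈ killed p t Ψ) :
    mono F α u ∈ killed p t Ψ := by
  have hi0 : α i ≠ 0 := fun e => hi (by simp [e])
  refine H.mem_of_bracket' (H.xe_mul_xe_mem i i) hg (H.valid_mem_idealO h)
    (c := 2 * tau F i * α i) (mul_ne_zero (mul_ne_zero H.two_ne (tau_ne_zero i)) hi) ?_
  rw [DH_xe_mul_xe, partialEven_mono_succ, xe_mul_mono, sub_single_add hi0, smul_smul, ← add_smul]
  have : (α - Pi.single i 1 : Fin m → ℕ) i + 1 = α i := by simp; omega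
  rw [this]
  congr 1; ring

/-- The action of a short root vector of the symplectic part. -/
theorem mem_of_root (H : IsNormalizedDer p t ζ Ψ) {α : Fin m → ℕ} {u : Finset (Fin n)}
    (h : Valid p t α u) {i l : Fin m} (hi : (α i : F) ≠ 0) (hl : l ≠ conj i)
    (hg : mono F (α - Pi.single i 1 + Pi.single l 1) u ∈ killed p t Ψ)
    (hr : α (conj i) ≠ 0 →
      mul F (xe F n (conj l)) (mono F (α - Pi.single i 1 + Pi.single l 1 - Pi.single (conj i) 1) u)
        ∈ killed p t Ψ) :
    mono F α u ∈ killed p t Ψ := by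
  have hi0 : α i ≠ 0 := fun e => hi (by simp [e])
  -- Of the two terms of the bracket with x_i x_{l'}, the one differentiating along x_l returns the
  -- monomial. The one along x_{i'} is the remainder r, absent when α_{i'} = 0.
  refine H.mem_of_bracket (r := tau F i • mul F (xe F n (conj l)) (partialEven F (conj i)
    (mono F (α - Pi.single i 1 + Pi.single l 1) u))) (H.xe_mul_xe_mem i (conj l)) hg
    (H.valid_mem_idealO h) (Submodule.smul_mem _ _ ?_)
    (c := tau F (conj l) * α i) (mul_ne_zero (tau_ne_zero _) hi) ?_
  · rw [partialEven_mono]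
    split_ifs with h0
    · rw [map_zero]; exact Submodule.zero_mem _
    · refine hr fun e => h0 ?_
      simp [e, hl.symm, conj_ne H.even_m]
  · rw [DH_xe_mul_xe, conj_conj, partialEven_mono_succ, xe_mul_mono, sub_single_add hi0, smul_smul]
    have : (α - Pi.single i 1 : Fin m → ℕ) i + 1 = α i := by simp; omega
    rw [this]

theorem lower_three (H : IsNormalizedDer p t ζ Ψ) : Lower F p t Ψ 3 :=
  fun α u h h' => ⟨H.valid_mem_idealO h, H.low α u h (by omega)⟩

theorem eq_single_of_sum_le {α : Fin m → ℕ} {i : Fin m} (h : ∑ j, α j ≤ α i) :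
    α = Pi.single i (α i) := by
  have h1 := Finset.add_sum_erase Finset.univ α (Finset.mem_univ i)
  have h2 : ∑ j ∈ Finset.univ.erase i, α j = 0 := by omega
  rw [Finset.sum_eq_zero_iff] at h2
  ext j
  by_cases hj : j = i
  · subst hj; simp
  · simp [hj, h2 j (by simp [hj])]

theorem eq_single_add_of_sum_eq {α : Fin m → ℕ} {i : Fin m} (h : ∑ j, α j = α i + 1) :
    ∃ j, j ≠ i ∧ α = Pi.single i (α i) + Pi.single j 1 := by
  have h1 := Finset.add_sum_erase Finset.univ α (Finset.mem_univ i)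
  obtain ⟨j, hj, hj0⟩ : ∃ j ∈ Finset.univ.erase i, α j ≠ 0 := by
    by_contra hcon
    push Not at hcon
    rw [Finset.sum_eq_zero hcon] at h1; omega
  have hji : j ≠ i := Finset.ne_of_mem_erase hj
  refine ⟨j, hji, ?_⟩
  have h3 := sum_sub_single (α := α) (i := j) (a := 1) (by omega)
  have h4 : (α - Pi.single j 1 : Fin m → ℕ) i = α i := by simp [hji.symm]
  have h5 := eq_single_of_sum_le (α := α - Pi.single j 1) (i := i) (by rw [h4]; omega)
  rw [h4] at h5
  rw [← h5, sub_single_add hj0]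

/-- In degree three, brackets with cubic elements are not yet available. If x_{i'} is absent, the
weight is -2 or -3, different from 0 and ±1 because 2, 3, 4 are invertible. If x_{i'} occurs, a long
root vector trades it for a third x_i. -/
theorem cubic_of_two (H : IsNormalizedDer p t ζ Ψ) {α : Fin m → ℕ} (hα : ∑ i, α i = 3) {i : Fin m}
    (hi : 2 ≤ α i) : mono F α (∅ : Finset (Fin n)) ∈ killed p t Ψ := by
  have hv : Valid p t α (∅ : Finset (Fin n)) := H.valid_of_sum_le hα.le (by simp)
  have hL : Lower F p t Ψ ((∑ i, α i) + (∅ : Finset (Fin n)).card) := by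
    rw [hα]; exact H.lower_three
  have hm := H.even_m
  have h2 := H.two_ne
  have h3 := H.three_ne
  have h4 : (4 : F) ≠ 0 := by
    rw [show (4 : F) = 2 * 2 by norm_num]; exact mul_ne_zero h2 h2
  have key : ∀ (β : Fin m → ℕ), ∑ j, β j = 3 → 2 ≤ β i → β (conj i) = 0 →
      mono F β (∅ : Finset (Fin n)) ∈ killed p t Ψ := by
    intro β hβ hi hc
    have hv : Valid p t β (∅ : Finset (Fin n)) := H.valid_of_sum_le hβ.le (by simp)
    have hL : Lower F p t Ψ ((∑ i, β i) + (∅ : Finset (Fin n)).card) := by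
      rw [hβ]; exact H.lower_three
    have hi3 : β i ≤ 3 := hβ ▸ Finset.single_le_sum (fun j _ => Nat.zero_le (β j)) (Finset.mem_univ i)
    have hi' : β i = 2 ∨ β i = 3 := by omega
    refine H.mem_of_weight hv hL (i := i) ?_ ?_ ?_ <;> rw [hc] <;>
      rcases hi' with e | e <;> rw [e] <;> intro h
    · exact h2 (by push_cast at h; linear_combination -h)
    · exact h3 (by push_cast at h; linear_combination -h)
    · exact h3 (by push_cast at h; linear_combination -h)
    · exact h4 (by push_cast at h; linear_combination -h)
    · exact one_ne_zero (α := F) (by push_cast at h; linear_combination -h)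
    · exact h2 (by push_cast at h; linear_combination -h)
  by_cases hc : α (conj i) = 0
  · exact key α hα hi hc
  · have hne := conj_ne hm i
    have h5 := Finset.add_sum_erase Finset.univ α (Finset.mem_univ i)
    have h6 := Finset.single_le_sum (f := α) (fun j _ => Nat.zero_le (α j))
      (Finset.mem_erase.mpr ⟨hne, Finset.mem_univ (conj i)⟩)
    have h7 : α (conj i) = 1 := by omega
    refine H.mem_of_root_conj hv (i := conj i) (by rw [h7]; simp) ?_
    rw [conj_conj]
    refine key _ ?_ ?_ ?_
    · simp only [Pi.add_apply, Finset.sum_add_distrib, sum_single]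
      rw [sum_sub_single (by omega), hα]
    · simp [hne.symm]; omega
    · simp [hne, h7]

theorem sum_root {α : Fin m → ℕ} {i : Fin m} (h : α i ≠ 0) (l : Fin m) :
    ∑ j, (α - Pi.single i 1 + Pi.single l 1 : Fin m → ℕ) j = ∑ j, α j := by
  rw [← sum_sub_single (α := α) (i := i) (a := 1) (by omega)]
  simp only [Pi.add_apply, Finset.sum_add_distrib, sum_single]

/-- Cubic polynomials in the even variables are killed. -/
theorem cubic_mem (H : IsNormalizedDer p t ζ Ψ) {α : Fin m → ℕ} (hα : ∑ i, α i = 3) :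
    mono F α (∅ : Finset (Fin n)) ∈ killed p t Ψ := by
  have hm := H.even_m
  have hv : Valid p t α (∅ : Finset (Fin n)) := H.valid_of_sum_le hα.le (by simp)
  by_cases h : ∃ i, 2 ≤ α i
  · exact H.cubic_of_two hα h.choose_spec
  push Not at h
  have hex : ∃ l, α l ≠ 0 := by
    by_contra hcon
    push Not at hcon
    simp [hcon] at hα
  obtain ⟨l, hl⟩ := hex
  have h5 := Finset.add_sum_erase Finset.univ α (Finset.mem_univ l)
  obtain ⟨i, hi, hi0⟩ : ∃ j ∈ Finset.univ.erase l, α j ≠ 0 := by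
    by_contra hcon
    push Not at hcon
    rw [Finset.sum_eq_zero hcon] at h5
    have := h l; omega
  have hil : i ≠ l := Finset.ne_of_mem_erase hi
  have hi1 : α i = 1 := by have := h i; omega
  have hl1 : α l = 1 := by have := h l; omega
  -- All exponents are now at most 1, so trading x_i for another occurring variable x_l produces an
  -- exponent 2.
  have hg : mono F (α - Pi.single i 1 + Pi.single l 1) (∅ : Finset (Fin n)) ∈ killed p t Ψ :=
    H.cubic_of_two (by rw [sum_root hi0, hα]) (i := l) (by simp [hil.symm, hl1])
  by_cases hc : l = conj i
  · subst hc
    exact H.mem_of_root_conj hv (by rw [hi1]; simp) hg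
  · refine H.mem_of_root hv (by rw [hi1]; simp) hc hg fun h0 => ?_
    rw [xe_mul_mono]
    refine Submodule.smul_mem _ _ (H.cubic_of_two (i := l) ?_ ?_)
    · rw [sum_root, sum_root hi0, hα]
      simp [Ne.symm hc, conj_ne hm, h0]
    · simp [hil.symm, hl1, hc]

end IsNormalizedDer

/-! ### Non-exceptional monomials in the even variables -/

namespace IsNormalizedDer

variable {p : ℕ} {t : Fin m → ℕ} {ζ : Fin n} {Ψ : SuperO F m n →ₗ[F] EndO F m n}

/-- The exponents `p^q ε_i` and `p^q ε_i + ε_j`. -/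
def Exceptional (p : ℕ) (t : Fin m → ℕ) (α : Fin m → ℕ) : Prop :=
  ∃ i q, 1 ≤ q ∧ q < t i ∧
    (α = Pi.single i (p ^ q) ∨ ∃ j, α = Pi.single i (p ^ q) + Pi.single j 1)

/-- Bracket with `x_i^(2) x_{i'}`. -/
theorem mem_of_dp_two (H : IsNormalizedDer p t ζ Ψ) {α : Fin m → ℕ} {u : Finset (Fin n)}
    (h : Valid p t α u) (hL : Lower F p t Ψ ((∑ i, α i) + u.card)) (hN : 4 ≤ (∑ i, α i) + u.card)
    {i : Fin m} (hc : (α i : F) * (2 * α (conj i) - α i + 1) ≠ 0) :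
    mono F α u ∈ killed p t Ψ := by
  have h2 := H.two_ne
  have hi : α i ≠ 0 := fun e => hc (by simp [e])
  refine H.mem_of_dp h hL (i := i) (a := 1) one_pos (by omega)
    (le_trans (by norm_num) (H.four_le_topExp i)) (by omega) fun e => hc ?_
  have e2 : ((α i).choose 2 : F) * 2 = α i * (α i - 1) := by
    have : NeZero (2 : F) := ⟨h2⟩
    have h3 := Nat.choose_two_right (α i)
    have h4 : 2 ∣ α i * (α i - 1) := (Nat.even_mul_pred_self (α i)).two_dvd
    have h5 : (α i).choose 2 * 2 = α i * (α i - 1) := by rw [h3, Nat.div_mul_cancel h4]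
    have h6 : (((α i).choose 2 * 2 : ℕ) : F) = ((α i * (α i - 1) : ℕ) : F) := by rw [h5]
    rw [Nat.cast_mul, Nat.cast_mul, Nat.cast_sub (by omega)] at h6
    simpa using h6
  rw [Nat.choose_one_right] at e
  linear_combination 2 * e + e2

theorem pow_lt_of_le_topExp (H : IsNormalizedDer p t ζ Ψ) {i : Fin m} {q : ℕ}
    (h : p ^ q ≤ topExp p t i) : q < t i := by
  have h1 : 0 < p ^ t i := pow_pos H.prime.pos _
  unfold topExp at h
  exact (Nat.pow_lt_pow_iff_right H.prime.one_lt).mp (by omega)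

/-- Non-exceptional monomials of degree at least `4` in the even variables are killed. -/
theorem even_mem (H : IsNormalizedDer p t ζ Ψ) {α : Fin m → ℕ}
    (h : Valid p t α (∅ : Finset (Fin n))) (hL : Lower F p t Ψ (∑ i, α i)) (hN : 4 ≤ ∑ i, α i)
    (hex : ¬ Exceptional p t α) : mono F α (∅ : Finset (Fin n)) ∈ killed p t Ψ := by
  have hm := H.even_m
  have hle : ∀ i, α i ≤ topExp p t i := h.le
  have hp := H.prime
  have h2 := H.two_ne
  have h3 := H.three_ne
  have hcard : (∅ : Finset (Fin n)).card = 0 := rfl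
  have hL' : Lower F p t Ψ ((∑ i, α i) + (∅ : Finset (Fin n)).card) := by simpa using hL
  have hN' : 4 ≤ (∑ i, α i) + (∅ : Finset (Fin n)).card := by simpa using hN
  by_contra hk
  -- A monomial that is not killed must have a vanishing structure constant in every bracket with
  -- x_i^(2) x_{i'}.
  have htwo : ∀ i, (α i : F) * (2 * α (conj i) - α i + 1) = 0 := fun i => by
    by_contra hc
    exact hk (H.mem_of_dp_two h hL' hN' hc)
  -- Solving the two quadratic equations for i and i' together, with 3 invertible, leaves the
  -- residue pairs (-1,-1), (0,0), (0,1) and (1,0).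
  have hpair : ∀ i, ((α i : F) = -1 ∧ (α (conj i) : F) = -1) ∨
      ((α i : F) = 0 ∧ ((α (conj i) : F) = 0 ∨ (α (conj i) : F) = 1)) ∨
      ((α i : F) = 1 ∧ (α (conj i) : F) = 0) := by
    intro i
    have a1 := htwo i
    have a2 := htwo (conj i)
    rw [conj_conj] at a2
    generalize (α i : F) = A at *
    generalize (α (conj i) : F) = B at *
    rcases mul_eq_zero.mp a1 with a1 | a1
    · right; left
      refine ⟨a1, ?_⟩
      rw [a1] at a2
      rcases mul_eq_zero.mp a2 with a2 | a2
      · exact Or.inl a2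
      · exact Or.inr (by linear_combination -a2)
    · rcases mul_eq_zero.mp a2 with a2 | a2
      · right; right
        exact ⟨by rw [a2] at a1; linear_combination -a1, a2⟩
      · left
        have hB : B = -1 := by
          have : 3 * (B + 1) = 0 := by linear_combination a2 + 2 * a1
          exact eq_neg_of_add_eq_zero_left ((mul_eq_zero.mp this).resolve_left h3)
        exact ⟨by rw [hB] at a1; linear_combination -a1, hB⟩
  -- no pair is congruent to `(-1, -1)`
  have hkill : ∀ {β : Fin m → ℕ}, Valid p t β (∅ : Finset (Fin n)) → ∑ i, β i = ∑ i, α i →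
      ∀ i, (β i : F) * (2 * β (conj i) - β i + 1) ≠ 0 →
        mono F β (∅ : Finset (Fin n)) ∈ killed p t Ψ := by
    intro β hβ hs i hc
    exact H.mem_of_dp_two hβ (by rw [hs]; exact hL') (by rw [hs]; exact hN') hc
  have hneg : ∀ i, ¬ ((α i : F) = -1 ∧ (α (conj i) : F) = -1) := by
    rintro i ⟨hi, hi'⟩
    -- Since α ≠ π, some coordinate l has room. Moving one unit from i to l gives a monomial of the
    -- same degree with residue -2 at i, which the bracket with x_i^(2) x_{i'} does reach; a root
    -- vector then brings it back to α.
    obtain ⟨l, hl⟩ : ∃ l, α l < topExp p t l := by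
      by_contra hcon
      push Not at hcon
      exact h.ne rfl (le_antisymm hle hcon)
    wlog hli : l ≠ i generalizing i
    · push Not at hli
      exact this (conj i) hi' (by rw [conj_conj]; exact hi) (hli ▸ (conj_ne hm l).symm)
    have hi0 : α i ≠ 0 := fun e => by simp [e] at hi
    have hi0' : α (conj i) ≠ 0 := fun e => by simp [e] at hi'
    have hci : conj i ≠ i := conj_ne hm i
    have hgv : Valid p t (α - Pi.single i 1 + Pi.single l 1) (∅ : Finset (Fin n)) := by
      refine ⟨fun j => ?_, by simp, fun _ e => ?_⟩
      · have hj := hle j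
        change _ ≤ topExp p t j
        by_cases hjl : j = l
        · subst hjl; simp [hli]; omega
        · simp [hjl]; omega
      · have e1 := congrFun e i
        have e2 := hle i
        simp [hli.symm] at e1
        omega
    have ci : ((α i - 1 : ℕ) : F) = -2 := by
      rw [Nat.cast_sub (by omega), hi]; norm_num
    have hne : (α i : F) ≠ 0 := by rw [hi]; simp
    by_cases hlc : l = conj i
    · subst hlc
      refine hk (H.mem_of_root_conj h hne (hkill hgv (sum_root hi0 _) i ?_))
      simp only [Pi.add_apply, Pi.sub_apply, Pi.single_eq_same, Pi.single_eq_of_ne hci,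
        Pi.single_eq_of_ne hci.symm, add_zero, Nat.sub_zero, ci, Nat.cast_add, hi', Nat.cast_one]
      intro e
      exact mul_ne_zero h2 h3 (by linear_combination -e)
    · refine hk (H.mem_of_root h hne hlc (hkill hgv (sum_root hi0 _) i ?_) fun _ => ?_)
      · simp only [Pi.add_apply, Pi.sub_apply, Pi.single_eq_same, Pi.single_eq_of_ne hci,
          Pi.single_eq_of_ne hli.symm, Pi.single_eq_of_ne (Ne.symm hlc), add_zero, Nat.sub_zero, ci,
          hi']
        intro e
        exact h2 (by linear_combination -e)
      · have hil : i ≠ conj l := fun e => hlc (by rw [e, conj_conj])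
        have hcil : conj i ≠ conj l := fun e => hli (by rw [← conj_conj i, e, conj_conj])
        rw [xe_mul_mono]
        -- If the coordinate l' is already full, the remainder would leave the admissible range, but
        -- its coefficient is α_{l'} + 1 = p^{t_{l'}} = 0 in F.
        by_cases htop : α (conj l) = topExp p t (conj l)
        · have hz : (((α - Pi.single i 1 + Pi.single l 1 - Pi.single (conj i) 1 : Fin m → ℕ) (conj l)
              + 1 : ℕ) : F) = 0 := by
            have h6 : (α - Pi.single i 1 + Pi.single l 1 - Pi.single (conj i) 1 : Fin m → ℕ) (conj l)
              = α (conj l) := by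
              simp [hil.symm, hcil.symm, conj_ne hm l]
            have h7 : 0 < p ^ t (conj l) := pow_pos hp.pos _
            rw [h6, H.cast_eq_zero, htop, topExp, Nat.sub_add_cancel h7]
            exact dvd_pow_self p (H.t_pos _).ne'
          rw [hz, zero_smul]
          exact Submodule.zero_mem _
        · have htop' : α (conj l) < topExp p t (conj l) := lt_of_le_of_ne (hle _) htop
          refine Submodule.smul_mem _ _ (hkill ⟨fun j => ?_, by simp, fun _ e => ?_⟩ ?_ i ?_)
          · have hj := hle j
            change _ ≤ topExp p t j
            have hl' := conj_ne hm l
            by_cases hjl : j = l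
            · subst hjl; simp [hl'.symm]; omega
            · by_cases hjl' : j = conj l
              · subst hjl'; simp [hl']; omega
              · simp [hjl, hjl']; omega
          · have e1 := congrFun e i
            have e2 := hle i
            simp [hli.symm, hil, hci.symm] at e1
            omega
          · rw [sum_root, sum_root hi0]
            simp [hci, Ne.symm hlc, hi0']
          · simp only [Pi.add_apply, Pi.sub_apply, Pi.single_eq_same, Pi.single_eq_of_ne hci,
              Pi.single_eq_of_ne hci.symm, Pi.single_eq_of_ne hli.symm,
              Pi.single_eq_of_ne (Ne.symm hlc), Pi.single_eq_of_ne hil, Pi.single_eq_of_ne hcil,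
              add_zero, Nat.sub_zero, ci]
            rw [Nat.cast_sub (by omega), hi']
            intro e
            exact h2 (by linear_combination e)
  have hval : ∀ i, (α i : F) = 0 ∨ ((α i : F) = 1 ∧ (α (conj i) : F) = 0) := by
    intro i
    rcases hpair i with h1 | h1 | h1
    · exact absurd h1 (hneg i)
    · exact Or.inl h1.1
    · exact Or.inr h1
  by_cases hI : ∃ i, α i ≠ 0 ∧ (α i : F) = 0
  · obtain ⟨i, hi0, hiF⟩ := hI
    have hpi : p ∣ α i := (H.cast_eq_zero _).mp hiF
    have hpa : p ≤ α i := Nat.le_of_dvd (by omega) hpi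
    have hp3 := H.three_lt
    have hsum := Finset.single_le_sum (f := α) (fun j _ => Nat.zero_le (α j)) (Finset.mem_univ i)
    by_cases hbig : α i + 2 ≤ ∑ j, α j
    -- With a + 1 = α_i the constant is α_{i'} α_i - 1 = -1, as p divides α_i. The assumption on |α|
    -- makes the factor x_i^(α_i) x_{i'} of smaller degree.
    · refine hk (H.mem_of_dp h hL' (i := i) (a := α i - 1) (by omega) (by omega)
        (by have := hle i; omega) (by rw [hcard]; omega) ?_)
      rw [show α i - 1 + 1 = α i by omega, Nat.choose_self,
        Nat.choose_symm_of_eq_add (show α i = α i - 1 + 1 by omega), Nat.choose_one_right, hiF]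
      simp
    · by_cases hq : ∃ q, 1 ≤ q ∧ α i = p ^ q
      · obtain ⟨q, hq1, hq⟩ := hq
        refine hex ⟨i, q, hq1, H.pow_lt_of_le_topExp (hq ▸ hle i), ?_⟩
        rw [← hq]
        by_cases he : ∑ j, α j ≤ α i
        · exact Or.inl (eq_single_of_sum_le he)
        · obtain ⟨j, -, hj⟩ := eq_single_add_of_sum_eq (α := α) (i := i) (by omega)
          exact Or.inr ⟨j, hj⟩
      · push Not at hq
        obtain ⟨b, hb0, hba, hpb, hb1, hb2⟩ := exists_choose_ne_zero hp (by omega) hpi hq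
        have hpb' : p ≤ b := Nat.le_of_dvd hb0 hpb
        have hpab : p ≤ α i - b := Nat.le_of_dvd (by omega) (Nat.dvd_sub hpi hpb)
        -- With a = b - 1 the term C(α_i, b - 1) vanishes mod p and the constant is -C(α_i, b) ≠ 0.
        refine hk (H.mem_of_dp h hL' (i := i) (a := b - 1) (by omega) (by omega)
          (by have := hle i; omega) (by rw [hcard]; omega) ?_)
        rw [Nat.sub_add_cancel hb0, (H.cast_eq_zero _).mpr hb2, mul_zero, zero_sub, neg_ne_zero]
        exact fun e => hb1 ((H.cast_eq_zero _).mp e)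
  · push Not at hI
    have hone : ∀ i, α i ≠ 0 → (α i : F) = 1 ∧ (α (conj i) : F) = 0 := fun i hi =>
      (hval i).resolve_left (hI i hi)
    obtain ⟨i, hi⟩ : ∃ i, α i ≠ 0 := by
      by_contra hcon
      push Not at hcon
      simp [hcon] at hN
    -- Every occurring variable has residue 1 opposite residue 0, hence nonzero weight; two of them
    -- would give two independent nonzero weights.
    have huniq : ∀ j, j ≠ i → α j = 0 := by
      intro j hj
      by_contra hj0
      refine hk (H.mem_of_two_weights h hL' hj ?_ ?_ ?_)
      · rintro rfl
        have h1 := (hone i hi).2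
        rw [(hone _ hj0).1] at h1
        exact one_ne_zero h1
      · rw [(hone i hi).1, (hone i hi).2]; simp
      · rw [(hone j hj0).1, (hone j hj0).2]; simp
    have hsum : ∑ j, α j = α i := Finset.sum_eq_single i (fun j _ hj => huniq j hj) (by simp)
    have hform : α = Pi.single i (α i) := eq_single_of_sum_le hsum.le
    obtain ⟨hi1, hi'⟩ := hone i hi
    have hpi : p ∣ α i - 1 := by
      rw [← H.cast_eq_zero (F := F), Nat.cast_sub (by omega), hi1]; simp
    by_cases hq : ∃ q, 1 ≤ q ∧ α i - 1 = p ^ q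
    · obtain ⟨q, hq1, hq⟩ := hq
      have := hle i
      refine hex ⟨i, q, hq1, H.pow_lt_of_le_topExp (by omega), Or.inr ⟨i, ?_⟩⟩
      rw [← hq, ← Pi.single_add, Nat.sub_add_cancel (by omega), ← hform]
    · push Not at hq
      obtain ⟨b, hb0, hba, hpb, hb1, hb2⟩ := exists_choose_ne_zero hp (by omega) hpi hq
      have hpb' : p ≤ b := Nat.le_of_dvd hb0 hpb
      have hp3 := H.three_lt
      have hpab : p ≤ α i - 1 - b := Nat.le_of_dvd (by omega) (Nat.dvd_sub hpi hpb)
      refine hk (H.mem_of_dp h hL' (i := i) (a := b - 1) (by omega) (by omega)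
        (by have := hle i; omega) (by rw [hcard]; omega) ?_)
      -- Pascal's rule transfers nonvanishing from α_i - 1 to α_i, because p divides C(α_i - 1, b -
      -- 1). The other term of the constant has the factor α_{i'} = 0.
      have hch : (α i).choose b = (α i - 1).choose (b - 1) + (α i - 1).choose b := by
        conv_lhs => rw [show α i = (α i - 1) + 1 by omega, show b = (b - 1) + 1 by omega]
        rw [Nat.choose_succ_succ', Nat.sub_add_cancel hb0]
      rw [hi', zero_mul, zero_sub, neg_ne_zero, Nat.sub_add_cancel hb0, hch, Nat.cast_add,
        (H.cast_eq_zero _).mpr hb2, zero_add]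
      exact fun e => hb1 ((H.cast_eq_zero _).mp e)

end IsNormalizedDer

/-! ### Exceptional monomials and rotations of the odd variables -/

theorem DH_xo_xo_mono_empty (k l : Fin n) (α : Fin m → ℕ) :
    DH F (mul F (xo F m k) (xo F m l)) (mono F α ∅) = 0 := by
  rw [DH_xo_mul_xo, partialOdd_mono_empty, partialOdd_mono_empty]; simp

theorem apply_DH_of_lie_eq_zero {f : SuperO F m n} {D : EndO F m n} (h : ⁅DH F f, D⁆ = 0)
    (g : SuperO F m n) : D (DH F f g) = DH F f (D g) := by
  have h1 := LinearMap.congr_fun h g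
  rw [lie_apply, LinearMap.zero_apply] at h1
  exact (sub_eq_zero.mp h1).symm

theorem xo_mul_mono_of_mem {k : Fin n} {u : Finset (Fin n)} (h : k ∈ u) (α : Fin m → ℕ) :
    mul F (xo F m k) (mono F α u) = 0 := by rw [xo_mul_mono, if_pos h]

theorem xo_mul_mul_mono_of_mem {k : Fin n} {u : Finset (Fin n)} (h : k ∈ u) (α : Fin m → ℕ)
    (f : SuperO F m n) : mul F (xo F m k) (mul F f (mono F α u)) = 0 := by
  induction f using SuperO.induction with
  | hadd a b ha hb => simp only [map_add, LinearMap.add_apply, ha, hb, add_zero]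
  | hsmul c a ha => simp only [map_smul, LinearMap.smul_apply, ha, smul_zero]
  | hmono β v =>
    rw [mul_mono]
    split_ifs
    · rw [map_smul, xo_mul_mono_of_mem (Finset.mem_union_right _ h), smul_zero]
    · exact map_zero _

theorem xo_mul_xo_even (k l : Fin n) : mul F (xo F m k) (xo F m l) ∈ parityPart F m n 0 := by
  have hkl := mul_mem_parityPart (xo_odd (F := F) (m := m) k) (xo_odd (F := F) (m := m) l)
  rwa [show (1 + 1 : ZMod 2) = 0 from by decide] at hkl

theorem mono_empty_mul_mono (β γ : Fin m → ℕ) (u : Finset (Fin n)) :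
    mul F (mono F β ∅) (mono F γ u) = bc F β γ • mono F (β + γ) u := by
  rw [mul_mono, if_pos (by simp)]
  simp [inversions]

theorem neg_one_pow_ne_zero (a : ℕ) : (-1 : F) ^ a ≠ 0 := pow_ne_zero _ (by simp)

namespace IsNormalizedDer

variable {p : ℕ} {t : Fin m → ℕ} {ζ : Fin n} {Ψ : SuperO F m n →ₗ[F] EndO F m n}

theorem conj_zeta (H : IsNormalizedDer p t ζ Ψ) : conj ζ = ζ := (H.conj_eq ζ).mpr rfl

theorem conj_ne_zeta (H : IsNormalizedDer p t ζ Ψ) {k : Fin n} (hk : k ≠ ζ) : conj k ≠ ζ :=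
  fun h => hk (by rw [← conj_conj k, h, H.conj_zeta])

theorem conj_ne_self (H : IsNormalizedDer p t ζ Ψ) {k : Fin n} (hk : k ≠ ζ) : conj k ≠ k :=
  fun h => hk ((H.conj_eq k).mp h)

theorem single_le (H : IsNormalizedDer p t ζ Ψ) {i : Fin m} {q : ℕ} (hq : q < t i) :
    p ^ q ≤ topExp p t i := by
  have := Nat.pow_lt_pow_right H.prime.one_lt hq
  unfold topExp; omega

theorem cast_pow (H : IsNormalizedDer p t ζ Ψ) {q : ℕ} (hq : 1 ≤ q) : ((p ^ q : ℕ) : F) = 0 :=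
  (H.cast_eq_zero _).mpr (dvd_pow_self p (by omega))

/-- Rotations annihilate functions of the even variables, so Ψ of such a function is an invariant
field under them. -/
theorem rot_commute (H : IsNormalizedDer p t ζ Ψ) {α : Fin m → ℕ}
    (h : Valid p t α (∅ : Finset (Fin n))) (k l : Fin n) :
    ⁅DH F (mul F (xo F m k) (xo F m l)), Ψ (mono F α ∅)⁆ = 0 := by
  have h0 := DH_xo_xo_mono_empty (F := F) k l α
  rw [← H.act (H.xo_mul_xo_mem k l) (H.valid_mem_idealO h) (by rw [h0]; exact Submodule.zero_mem _),
    h0, map_zero]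

/-- `x_i^(p^q)` is killed. -/
theorem single_mem (H : IsNormalizedDer p t ζ Ψ) {i : Fin m} {q : ℕ} (hq : 1 ≤ q) (hqt : q < t i)
    (hL : Lower F p t Ψ (p ^ q)) : dp F n i (p ^ q) ∈ killed p t Ψ := by
  have hm := H.even_m
  have hv : Valid p t (Pi.single i (p ^ q)) (∅ : Finset (Fin n)) := by
    refine ⟨fun j => ?_, by simp, fun _ e => ?_⟩
    · by_cases hj : j = i
      · subst hj; simpa using H.single_le hqt
      · simp [hj]
    · have h1 := congrFun e (conj i)
      have h4 := H.four_le_topExp (conj i)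
      simp [conj_ne hm i] at h1
      omega
  have hL' : Lower F p t Ψ ((∑ j, (Pi.single i (p ^ q) : Fin m → ℕ) j) +
      (∅ : Finset (Fin n)).card) := by rw [sum_single]; exact hL
  have hcast : ∀ j, ((Pi.single i (p ^ q) : Fin m → ℕ) j : F) = 0 := fun j => by
    by_cases hj : j = i
    · subst hj; rw [Pi.single_eq_same, H.cast_pow hq]
    · simp [hj]
  have hD := H.mem _ (H.valid_mem_idealO hv)
  have hinv : ∀ k g, Ψ (mono F (Pi.single i (p ^ q)) ∅) (DH F (mul F (xo F m k) (xo F m ζ)) g) =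
      DH F (mul F (xo F m k) (xo F m ζ)) (Ψ (mono F (Pi.single i (p ^ q)) ∅) g) := fun k g =>
    apply_DH_of_lie_eq_zero (H.rot_commute hv k ζ) g
  have hrot : ∀ k, k ≠ ζ → DH F (mul F (xo F m k) (xo F m ζ)) (xo F m ζ) = -xo F m k := by
    intro k hk
    rw [DH_xo_mul_xo, H.conj_zeta, partialOdd_xo, partialOdd_xo, if_neg (H.conj_ne_zeta hk),
      if_pos rfl, map_zero, mul_one', zero_sub]
  have hrot' : ∀ k, k ≠ ζ →
      DH F (mul F (xo F m (conj k)) (xo F m ζ)) (xo F m k) = xo F m ζ := by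
    intro k hk
    rw [DH_xo_mul_xo, H.conj_zeta, conj_conj, partialOdd_xo, partialOdd_xo, if_neg hk.symm,
      if_pos rfl, map_zero, mul_one', sub_zero]
  have hζ : Ψ (mono F (Pi.single i (p ^ q)) ∅) (xo F m ζ) = 0 := by
    refine eq_zero_of_coeff_zero (partialEven_of_commute hD (H.commute_partialEven hv hL')
      (Sum.inr ζ)) fun u => ?_
    by_contra hu
    -- As E_{k'} E_k x_ζ = -x_ζ and rotations commute with the field, each x^u in its value at x_ζ
    -- has eigenvalue -1 for every k ≠ ζ. Hence u is {ζ} or its complement: parity excludes the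
    -- first and `normΦ` the second.
    have hcas : ∀ k, k ≠ ζ → (if ζ ∈ u then k ∉ u else conj k ∈ u) := by
      intro k hk
      have h1 := coeff_DH_DH H.conj_zeta hk (Ψ (mono F (Pi.single i (p ^ q)) ∅) (xo F m ζ)) 0 u
      rw [← hinv, ← hinv, hrot k hk, map_neg, hrot' k hk, map_neg, map_neg] at h1
      split_ifs with h2
      · intro h3
        rw [if_pos h2, if_pos h3, neg_eq_zero] at h1
        exact hu h1
      · by_contra h3
        rw [if_neg h2, if_neg h3, neg_eq_zero] at h1
        exact hu h1
    by_cases h2 : ζ ∈ u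
    · have hu1 : u = {ζ} := by
        ext k
        rw [Finset.mem_singleton]
        refine ⟨fun hk => ?_, fun hk => hk ▸ h2⟩
        by_contra hne
        have := hcas k hne
        rw [if_pos h2] at this
        exact this hk
      refine hu (coeff_of_mem_parityPart (hD.2 (Sum.inr ζ)) 0 ?_)
      rw [hu1]; simp
    · have hu1 : u = Finset.univ.erase ζ := by
        ext k
        rw [Finset.mem_erase]
        refine ⟨fun hk => ⟨fun e => h2 (e ▸ hk), Finset.mem_univ _⟩, fun hk => ?_⟩
        have := hcas (conj k) (H.conj_ne_zeta hk.1)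
        rwa [if_neg h2, conj_conj] at this
      exact hu (hu1 ▸ H.normΦ i q hq hqt)
  refine H.mem_of_coeff hv (fun j => ?_) fun k => ?_
  · refine H.coeff_even_eq_zero hv hL' (i := j) ?_
    rw [hcast, hcast, if_neg (conj_ne hm j).symm, if_pos rfl]
    simp
  · by_cases hk : k = ζ
    · rw [hk, hζ]
    -- The rotation E_k carries x_ζ to -x_k, so vanishing at x_ζ spreads to all odd variables.
    · have h1 := hinv k (xo F m ζ)
      rw [hrot k hk, hζ, map_zero, map_neg, neg_eq_zero] at h1
      exact h1

/-- The only tight case is l = i, where p^q + 1 must not exceed p^{t_i} - 1. Equality p^{t_i} = p^q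
+ 1 is impossible because p would divide 1. -/
theorem single_add_valid (H : IsNormalizedDer p t ζ Ψ) {i : Fin m} {q : ℕ} (hq : 1 ≤ q)
    (hqt : q < t i) (l : Fin m) :
    Valid p t (Pi.single i (p ^ q) + Pi.single l 1) (∅ : Finset (Fin n)) := by
  have hm := H.even_m
  have h1 := H.single_le hqt
  have h2 : p ∣ p ^ q := dvd_pow_self p (by omega)
  have h3 : p ^ t i ≠ p ^ q + 1 := fun e => H.prime.one_lt.ne' (Nat.dvd_one.mp
    ((Nat.dvd_add_right h2).mp (e ▸ dvd_pow_self p (H.t_pos i).ne')))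
  have h5 := Nat.pow_lt_pow_right H.prime.one_lt hqt
  have h6 := H.four_le_topExp (conj i)
  refine ⟨fun j => ?_, by simp, fun _ e => ?_⟩
  · have h4 := H.four_le_topExp j
    by_cases hj : j = i
    · subst hj
      by_cases hl : j = l
      · subst hl; simp; unfold topExp; omega
      · simpa [hl] using h1
    · by_cases hl : j = l
      · subst hl; simp [hj]; omega
      · simp [hj, hl]
  · have h7 := congrFun e (conj i)
    by_cases hl : conj i = l
    · subst hl; simp [conj_ne hm i] at h7; omega
    · simp [conj_ne hm i, hl] at h7; omega

/-- `x_i^(p^q) x_{i'}` is killed. -/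
theorem single_add_conj_mem (H : IsNormalizedDer p t ζ Ψ) {i : Fin m} {q : ℕ} (hq : 1 ≤ q)
    (hqt : q < t i) (hL : Lower F p t Ψ (p ^ q + 1)) :
    mono F (Pi.single i (p ^ q) + Pi.single (conj i) 1) (∅ : Finset (Fin n)) ∈ killed p t Ψ := by
  have hm := H.even_m
  have hv := H.single_add_valid hq hqt (conj i)
  have hci := conj_ne hm i
  set α : Fin m → ℕ := Pi.single i (p ^ q) + Pi.single (conj i) 1 with hα
  have hL' : Lower F p t Ψ ((∑ j, α j) + (∅ : Finset (Fin n)).card) := by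
    simp only [hα, Pi.add_apply, Finset.sum_add_distrib, sum_single]; exact hL
  have hw : (α (conj i) : F) - α i = 1 := by
    simp only [hα, Pi.add_apply, Pi.single_eq_same, Pi.single_eq_of_ne hci,
      Pi.single_eq_of_ne hci.symm, add_zero, zero_add, H.cast_pow hq]
    simp
  have hD := H.mem _ (H.valid_mem_idealO hv)
  refine H.mem_of_coeff hv (fun j => ?_) (H.coeff_odd_eq_zero hv hL' (i := i) (by rw [hw]; simp))
  by_cases hj : j = i
  · subst hj
    have hinv : ∀ k, DH F (mul F (xo F m k) (xo F m ζ)) (Ψ (mono F α ∅) (xe F n j)) = 0 := by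
      intro k
      rw [← apply_DH_of_lie_eq_zero (H.rot_commute hv k ζ), xe, DH_xo_xo_mono_empty, map_zero]
    refine eq_zero_of_coeff_zero (partialEven_of_commute hD (H.commute_partialEven hv hL')
      (Sum.inl j)) fun u => ?_
    by_contra hu
    -- Rotations kill x_i, so the value at x_i is an invariant of the exterior algebra: eigenvalue 0
    -- for all k leaves u = ω or u = ∅. The value is odd, which rules out ∅, and `normΘ` rules out
    -- ω.
    have hcas : ∀ k, k ≠ ζ → (if ζ ∈ u then k ∈ u else conj k ∉ u) := by
      intro k hk
      have h1 := coeff_DH_DH H.conj_zeta hk (Ψ (mono F α ∅) (xe F n j)) 0 u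
      rw [hinv, map_zero, map_zero] at h1
      split_ifs with h2
      · by_contra h3
        rw [if_pos h2, if_neg h3] at h1
        exact hu (neg_eq_zero.mp h1.symm)
      · intro h3
        rw [if_neg h2, if_pos h3] at h1
        exact hu (neg_eq_zero.mp h1.symm)
    by_cases h2 : ζ ∈ u
    · have hu1 : u = Finset.univ := by
        refine Finset.eq_univ_iff_forall.mpr fun k => ?_
        by_cases hk : k = ζ
        · exact hk ▸ h2
        · have := hcas k hk
          rwa [if_pos h2] at this
      have h3 := H.normΘ j q hq hqt
      rw [dp_mul_xe_conj hm] at h3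
      exact hu (hu1 ▸ h3)
    · have hu1 : u = ∅ := by
        refine Finset.eq_empty_iff_forall_notMem.mpr fun k hk => ?_
        have hk' : k ≠ ζ := fun e => h2 (e ▸ hk)
        have := hcas (conj k) (H.conj_ne_zeta hk')
        rw [if_neg h2, conj_conj] at this
        exact this hk
      refine hu (coeff_of_mem_parityPart (hD.2 (Sum.inl j)) 0 ?_)
      rw [hu1]; simp
  · refine H.coeff_even_eq_zero hv hL' (i := i) ?_
    rw [hw, if_neg hj, sub_zero]
    split_ifs
    · rw [one_add_one_eq_two]; exact H.two_ne
    · simp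

/-- The exceptional monomials are killed. -/
theorem exceptional_mem (H : IsNormalizedDer p t ζ Ψ) {α : Fin m → ℕ}
    (hL : Lower F p t Ψ (∑ i, α i)) (hex : Exceptional p t α) :
    mono F α (∅ : Finset (Fin n)) ∈ killed p t Ψ := by
  have hm := H.even_m
  obtain ⟨i, q, hq, hqt, rfl | ⟨l, rfl⟩⟩ := hex
  · rw [sum_single] at hL
    exact H.single_mem hq hqt hL
  · simp only [Pi.add_apply, Finset.sum_add_distrib, sum_single] at hL
    have hg := H.single_add_conj_mem hq hqt hL
    have hv := H.single_add_valid hq hqt l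
    have hl : ((Pi.single i (p ^ q) + Pi.single l 1 : Fin m → ℕ) l : F) ≠ 0 := by
      by_cases hli : l = i
      · subst hli; simp [H.cast_pow hq, -Nat.cast_pow]
      · simp [hli]
    by_cases h1 : l = conj i
    · exact h1 ▸ hg
    by_cases h2 : i = l
    · subst h2
      refine H.mem_of_root_conj hv hl ?_
      rwa [add_tsub_cancel_right]
    -- Trading x_l for x_{i'} gives the monomial just treated; there is no remainder since x_{l'}
    -- does not occur.
    · refine H.mem_of_root (l := conj i) hv hl (fun e => h2 ?_) ?_ fun h0 => ?_
      · rw [← conj_conj i, e, conj_conj]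
      · rwa [add_tsub_cancel_right]
      · refine absurd ?_ h0
        have h3 : conj l ≠ i := fun e => h1 (by rw [← e, conj_conj])
        simp [h3, conj_ne hm l]

theorem mem_of_empty (H : IsNormalizedDer p t ζ Ψ) {α : Fin m → ℕ}
    (h : Valid p t α (∅ : Finset (Fin n))) (hL : Lower F p t Ψ (∑ i, α i)) :
    mono F α (∅ : Finset (Fin n)) ∈ killed p t Ψ := by
  by_cases h2 : ∑ i, α i ≤ 2
  · exact H.low_mem (by simpa using h2) (by simp)
  by_cases h3 : ∑ i, α i = 3
  · exact H.cubic_mem h3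
  by_cases hex : Exceptional p t α
  · exact H.exceptional_mem hL hex
  · exact H.even_mem h hL (by omega) hex

end IsNormalizedDer

/-! ### Monomials involving odd variables -/

theorem xo_mul_xo_eq {k l : Fin n} (h : k ≠ l) :
    mul F (xo F m k) (xo F m l) = (-1 : F) ^ inversions {k} {l} • mono F 0 {k, l} := by
  change mul F (xo F m k) (mono F 0 {l}) = _
  rw [xo_mul_mono, if_neg (by simpa using h)]

theorem DH_xo_mul_xo_xe (k l : Fin n) (i : Fin m) :
    DH F (mul F (xo F m k) (xo F m l)) (xe F n i) = 0 := DH_xo_xo_mono_empty k l _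

theorem xo_mul_xo_comm (k l : Fin n) :
    mul F (xo F m k) (xo F m l) = -mul F (xo F m l) (xo F m k) := by
  rw [mul_comm_of_mem (xo_odd k) (xo_odd l)]; simp [zsgn]

theorem xo_mul_xo_self (k : Fin n) : mul F (xo F m k) (xo F m k) = 0 :=
  xo_mul_mono_of_mem (by simp) 0

theorem xe_mul_xo_mul_xo_eq (i : Fin m) {k l : Fin n} (h : k ≠ l) :
    mul F (xe F n i) (mul F (xo F m k) (xo F m l)) =
      (-1 : F) ^ inversions {k} {l} • mono F (Pi.single i 1) {k, l} := by
  rw [xo_mul_xo_eq h, map_smul, xe_mul_mono]; simp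

namespace IsNormalizedDer

variable {p : ℕ} {t : Fin m → ℕ} {ζ : Fin n} {Ψ : SuperO F m n →ₗ[F] EndO F m n}

theorem xe_mul_xo_mul_xo_mem_idealO (H : IsNormalizedDer p t ζ Ψ) (i : Fin m) (k l : Fin n) :
    mul F (xe F n i) (mul F (xo F m k) (xo F m l)) ∈ idealO F n p t := by
  by_cases h : k = l
  · rw [h, xo_mul_xo_self, map_zero]; exact Submodule.zero_mem _
  · rw [xe_mul_xo_mul_xo_eq i h]
    refine Submodule.smul_mem _ _ (H.valid_mem_idealO (H.valid_of_sum_le ?_ ?_))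
    · rw [sum_single]; norm_num
    · rw [Finset.card_pair h]; exact even_two

/-- The base case for mixed monomials. With g = x_k x_ζ, weights reduce Ψ(x_i g) to c ∂_{i'} and
Ψ(x_{i'} g) to -c ∂_i. The relation {x_i g, x_{i'} g} = 0 then forces c x_k = c x_ζ = 0, and the
remaining rotations leave only multiples of g, which have the wrong parity. -/
theorem xe_mul_rot_mem (H : IsNormalizedDer p t ζ Ψ) (i : Fin m) {k : Fin n} (hk : k ≠ ζ) :
    mul F (xe F n i) (mul F (xo F m k) (xo F m ζ)) ∈ killed p t Ψ := by
  have hm := H.even_m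
  have hcz := H.conj_zeta
  set g := mul F (xo F m k) (xo F m ζ) with hg
  have hge : g ∈ parityPart F m n 0 := xo_mul_xo_even k ζ
  have hmem : ∀ j, mul F (xe F n j) g ∈ idealO F n p t := fun j =>
    H.xe_mul_xo_mul_xo_mem_idealO j k ζ
  have hv : ∀ j : Fin m, Valid p t (Pi.single j 1) {k, ζ} := fun j =>
    H.valid_of_sum_le (by rw [sum_single]; norm_num) (by rw [Finset.card_pair hk]; exact even_two)
  have hL : ∀ j : Fin m, Lower F p t Ψ ((∑ l, (Pi.single j 1 : Fin m → ℕ) l) +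
      ({k, ζ} : Finset (Fin n)).card) := fun j => by
    rw [sum_single, Finset.card_pair hk]; exact H.lower_three
  have hform : ∀ j, mul F (xe F n j) g =
      (-1 : F) ^ inversions {k} {ζ} • mono F (Pi.single j 1) {k, ζ} := fun j =>
    xe_mul_xo_mul_xo_eq j hk
  have hw : ∀ j : Fin m, (((Pi.single j 1 : Fin m → ℕ) (conj j) : ℕ) : F) -
      (((Pi.single j 1 : Fin m → ℕ) j : ℕ) : F) = -1 := fun j => by simp [conj_ne hm j]
  have hDmem : ∀ j, Ψ (mul F (xe F n j) g) ∈ oddFields F m n := fun j => H.mem _ (hmem j)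
  have hodd : ∀ j l, Ψ (mul F (xe F n j) g) (xo F m l) = 0 := fun j l => by
    rw [hform, map_smul, LinearMap.smul_apply,
      H.coeff_odd_eq_zero (hv j) (hL j) (i := j) (by rw [hw]; simp), smul_zero]
  have heven : ∀ j l, l ≠ conj j → Ψ (mul F (xe F n j) g) (xe F n l) = 0 := fun j l hl => by
    rw [hform, map_smul, LinearMap.smul_apply,
      H.coeff_even_eq_zero (hv j) (hL j) (i := j), smul_zero]
    rw [hw, if_neg hl]
    split_ifs
    · intro e; exact H.two_ne (by linear_combination -e)
    · simp
  have happly : ∀ j h, Ψ (mul F (xe F n j) g) h =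
      mul F (Ψ (mul F (xe F n j) g) (xe F n (conj j))) (partialEven F (conj j) h) := by
    intro j h
    rw [(hDmem j).1 h, Fintype.sum_sum_type, Finset.sum_eq_single (conj j)]
    · rw [Finset.sum_eq_zero, add_zero]; · rfl
      intro l _
      rw [show xv F (Sum.inr l : Fin m ⊕ Fin n) = xo F m l from rfl, hodd]; simp
    · intro l _ hl
      rw [show xv F (Sum.inl l : Fin m ⊕ Fin n) = xe F n l from rfl, heven j l hl]; simp
    · simp
  -- the coefficients at `i` and `i'` are opposite
  set c := Ψ (mul F (xe F n i) g) (xe F n (conj i)) with hc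
  have hpar : c ∈ parityPart F m n 1 := by
    have := (hDmem i).2 (Sum.inl (conj i))
    rwa [ipar_inl, zero_add] at this
  have hg0 : ∀ j, partialEven F j g = 0 := fun j => by
    rw [hg, xo_mul_xo_eq hk, map_smul, partialEven_mono_zero_left, smul_zero]
  have hc' : Ψ (mul F (xe F n (conj i)) g) (xe F n i) = -c := by
    -- The long root vector x_{i'}² carries x_i g to a multiple of x_{i'} g, which ties the two
    -- coefficients together.
    have h1 : DH F (mul F (xe F n (conj i)) (xe F n (conj i))) (mul F (xe F n i) g) =
        (2 * tau F (conj i)) • mul F (xe F n (conj i)) g := by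
      rw [DH_xe_mul_xe, conj_conj, partialEven_mul, hg0, partialEven_xe, if_pos rfl, one_mul',
        map_zero, add_zero, ← add_smul, two_mul]
    have h2 := H.act (H.xe_mul_xe_mem (conj i) (conj i)) (hmem i)
      (by rw [h1]; exact Submodule.smul_mem _ _ (hmem _))
    rw [h1, map_smul] at h2
    have h3 := LinearMap.congr_fun h2 (xe F n i)
    rw [lie_apply, heven i i (conj_ne hm i).symm, map_zero, DH_xe_mul_xe, conj_conj, partialEven_xe,
      if_pos rfl, mul_one', ← add_smul, map_smul, LinearMap.smul_apply, ← two_mul, zero_sub,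
      ← smul_neg] at h3
    exact smul_right_injective _ (mul_ne_zero H.two_ne (tau_ne_zero _)) h3
  -- `{g, g} = 0` and `g² = 0`
  have hgg : DH F g g = 0 := by
    rw [hg, DH_xo_mul_xo, hcz, partialOdd_mul, partialOdd_mul, parityInv_of_mem (xo_odd k)]
    simp [partialOdd_xo, H.conj_ne_self hk, H.conj_ne_zeta hk, hk.symm, zsgn, mul_one',
      xo_mul_xo_self]
  have hg2 : mul F g g = 0 := by
    rw [hg, mul_assoc', ← mul_assoc' (xo F m ζ), xo_mul_xo_comm ζ k, map_neg, LinearMap.neg_apply,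
      mul_assoc', xo_mul_xo_self]
    simp
  have hDg : ∀ j h, DH F (mul F (xe F n j) g) h =
      mul F (xe F n j) (DH F g h) + tau F j • mul F g (partialEven F (conj j) h) := fun j h => by
    rw [DH_mul_eq (xe_even j) hge, DH_xe, map_smul]
  have hzero : DH F (mul F (xe F n i) g) (mul F (xe F n (conj i)) g) = 0 := by
    have h1 : DH F g (xe F n (conj i)) = 0 := DH_xo_mul_xo_xe k ζ _
    rw [hDg, DH_mul hge, hgg, h1, partialEven_mul, hg0, partialEven_xe, if_pos rfl, one_mul']
    simp [hg2]
  -- Evaluated at x_l, the derivation rule for the vanishing bracket becomes 2 c {g, x_l} = 0; the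
  -- values {g, x_l} include -x_k and x_ζ.
  have hkey : ∀ e, partialEven F i e = 0 → partialEven F (conj i) e = 0 →
      ∀ l, DH F g (xo F m l) = e → mul F c e = 0 := by
    intro e he he' l hl
    have h1 := H.der _ (hmem i) _ (hmem (conj i)) (by rw [hzero]; exact Submodule.zero_mem _)
    rw [hzero, map_zero] at h1
    have h2 := LinearMap.congr_fun h1 (xo F m l)
    have h3 : ∀ j, partialEven F j (xo F m l) = 0 := fun j => partialEven_mono_zero_left j _
    rw [LinearMap.zero_apply, LinearMap.add_apply, lie_apply, lie_apply, hodd, hodd, map_zero,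
      map_zero, hDg, hDg, h3, h3, map_zero, smul_zero, smul_zero, add_zero, add_zero, hl,
      happly i, happly (conj i), conj_conj, hc', partialEven_mul, partialEven_mul, he, he',
      partialEven_xe, partialEven_xe, if_pos rfl, if_pos rfl, one_mul', map_zero, add_zero,
      map_neg, LinearMap.neg_apply] at h2
    have h4 : (2 : F) • mul F c e = 0 := by
      rw [two_smul]
      rw [← hc] at h2
      simpa using h2.symm
    exact (smul_eq_zero.mp h4).resolve_left H.two_ne
  have hxk : mul F (xo F m k) c = 0 := by
    have h1 := hkey (-xo F m k) (by rw [map_neg, xo, partialEven_mono_zero_left, neg_zero])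
      (by rw [map_neg, xo, partialEven_mono_zero_left, neg_zero]) ζ (by
        rw [hg, DH_xo_mul_xo, hcz, partialOdd_xo, partialOdd_xo, if_neg (H.conj_ne_zeta hk),
          if_pos rfl, map_zero, mul_one', zero_sub])
    rw [map_neg, neg_eq_zero] at h1
    rw [mul_comm_of_mem (xo_odd k) hpar, h1, smul_zero]
  have hxz : mul F (xo F m ζ) c = 0 := by
    have h1 := hkey (xo F m ζ) (partialEven_mono_zero_left _ _)
      (partialEven_mono_zero_left _ _) (conj k) (by
        rw [hg, DH_xo_mul_xo, hcz, partialOdd_xo, partialOdd_xo, if_pos rfl,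
          if_neg (H.conj_ne_zeta hk).symm, map_zero, mul_one', sub_zero])
    rw [mul_comm_of_mem (xo_odd ζ) hpar, h1, smul_zero]
  -- invariance
  have hinv : ∀ l, l ≠ ζ → l ≠ k → DH F (mul F (xo F m (conj l)) (xo F m ζ))
      (DH F (mul F (xo F m l) (xo F m ζ)) c) = -c := by
    intro l hl hlk
    have e1 : DH F (mul F (xo F m l) (xo F m ζ)) g = mul F (xo F m l) (xo F m k) := by
      rw [hg, DH_xo_mul_xo, hcz, partialOdd_mul, partialOdd_mul, parityInv_of_mem (xo_odd k)]
      by_cases h1 : conj l = k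
      · simp [partialOdd_xo, h1, hk, hk.symm, zsgn, mul_one', one_mul', xo_mul_xo_self]
      · simp [partialOdd_xo, h1, H.conj_ne_zeta hl, hk.symm, zsgn, mul_one']
    have e2 : DH F (mul F (xo F m (conj l)) (xo F m ζ)) (mul F (xo F m l) (xo F m k)) = -g := by
      rw [hg, DH_xo_mul_xo, hcz, conj_conj, partialOdd_mul, partialOdd_mul,
        parityInv_of_mem (xo_odd l)]
      simp [partialOdd_xo, hlk, hl.symm, hk.symm, one_mul', xo_mul_xo_comm ζ k]
    have a1 : DH F (mul F (xo F m l) (xo F m ζ)) (mul F (xe F n i) g) =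
        mul F (xe F n i) (mul F (xo F m l) (xo F m k)) := by
      rw [DH_mul (xo_mul_xo_even l ζ), DH_xo_mul_xo_xe, e1]; simp
    have a2 : DH F (mul F (xo F m (conj l)) (xo F m ζ))
        (mul F (xe F n i) (mul F (xo F m l) (xo F m k))) = -mul F (xe F n i) g := by
      rw [DH_mul (xo_mul_xo_even _ ζ), DH_xo_mul_xo_xe, e2]; simp
    have b1 := H.act (H.xo_mul_xo_mem l ζ) (hmem i)
      (by rw [a1]; exact H.xe_mul_xo_mul_xo_mem_idealO i l k)
    have b2 := H.act (H.xo_mul_xo_mem (conj l) ζ) (H.xe_mul_xo_mul_xo_mem_idealO i l k)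
      (by rw [a2]; exact Submodule.neg_mem _ (hmem i))
    rw [a2, ← a1, b1, map_neg] at b2
    have b3 := LinearMap.congr_fun b2 (xe F n (conj i))
    rw [lie_apply, lie_apply, lie_apply, DH_xo_mul_xo_xe, DH_xo_mul_xo_xe, map_zero, map_zero,
      map_zero, sub_zero] at b3
    simpa using b3.symm
  -- Every u in the support contains k and ζ because x_k c = x_ζ c = 0. The eigenvalue -1 excludes
  -- any further index, so u = {k, ζ}, which is even although c is odd.
  have hc0 : c = 0 := by
    refine eq_zero_of_coeff_zero (partialEven_of_commute (hDmem i) (fun j => ?_)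
      (Sum.inl (conj i))) fun u => ?_
    · rw [hform, map_smul]
      have := H.commute_partialEven (hv i) (hL i) j
      rw [Ring.lie_def] at this ⊢
      rw [mul_smul_comm, smul_mul_assoc, ← smul_sub, this, smul_zero]
    · by_contra hu
      have hku : k ∈ u := by
        by_contra h; exact hu (coeff_of_xo_mul_eq_zero hxk 0 h)
      have hzu : ζ ∈ u := by
        by_contra h; exact hu (coeff_of_xo_mul_eq_zero hxz 0 h)
      have hu1 : u = {k, ζ} := by
        ext l
        rw [Finset.mem_insert, Finset.mem_singleton]
        refine ⟨fun hl => ?_, fun hl => hl.elim (fun h => h ▸ hku) (fun h => h ▸ hzu)⟩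
        by_contra hcon
        push Not at hcon
        have h1 := coeff_DH_DH hcz hcon.2 c 0 u
        rw [hinv l hcon.2 hcon.1, if_pos hzu, if_pos hl, map_neg, neg_eq_zero] at h1
        exact hu h1
      refine hu (coeff_of_mem_parityPart hpar 0 ?_)
      rw [hu1, Finset.card_pair hk]; decide
  refine ⟨hmem i, oddFields_ext (hDmem i) (fun j => ?_) (hodd i)⟩
  by_cases hj : j = conj i
  · rw [hj]; exact hc0
  · exact heven i j hj

/-- Bracket of `x^(β) x_k x_ζ` with `x^(γ) x_ζ x^v`. -/
theorem mem_of_split (H : IsNormalizedDer p t ζ Ψ) {β γ : Fin m → ℕ} {k : Fin n}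
    {v : Finset (Fin n)} (hk : k ≠ ζ) (hkv : k ∉ v) (hzv : ζ ∉ v)
    (h : Valid p t (β + γ) (insert k v)) (hc : bc F β γ ≠ 0)
    (hf : mono F β {k, ζ} ∈ killed p t Ψ) (hg : mono F γ (insert ζ v) ∈ killed p t Ψ) :
    mono F (β + γ) (insert k v) ∈ killed p t Ψ := by
  have e1 : mul F (mono F β ∅) (mul F (xo F m k) (xo F m ζ)) =
      (-1 : F) ^ inversions {k} {ζ} • mono F β {k, ζ} := by
    rw [xo_mul_xo_eq hk, map_smul, mono_empty_mul_mono, add_zero]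
    simp [bc]
  -- Since x_ζ² = 0, only the part -x_k ∂_ζ of the rotation contributes; the even derivatives vanish
  -- for the same reason.
  have e2 : mul F (xo F m ζ) (partialOdd F (conj k) (mono F γ (insert ζ v))) = 0 := by
    rw [partialOdd_mono]
    split_ifs
    · rw [map_smul, xo_mul_mono_of_mem, smul_zero]
      exact Finset.mem_erase.mpr ⟨(H.conj_ne_zeta hk).symm, Finset.mem_insert_self _ _⟩
    · exact map_zero _
  refine H.mem_of_bracket' (f := mul F (mono F β ∅) (mul F (xo F m k) (xo F m ζ))) (g := _)
    (c := -((-1 : F) ^ inversions {ζ} v * (-1) ^ inversions {k} v * bc F β γ))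
    (by rw [e1]; exact Submodule.smul_mem _ _ hf) hg (H.valid_mem_idealO h)
    (neg_ne_zero.mpr (mul_ne_zero (mul_ne_zero (neg_one_pow_ne_zero _) (neg_one_pow_ne_zero _)) hc))
    ?_
  rw [DH_mul_eq (mono_even _ (by simp)) (xo_mul_xo_even k ζ), DH_mono_empty, map_sum,
    Finset.sum_eq_zero, add_zero, DH_xo_mul_xo, H.conj_zeta, e2, partialOdd_mono_insert hzv,
    map_smul, xo_mul_mono, if_neg hkv, zero_sub, map_neg, map_smul, map_smul, mono_empty_mul_mono,
    smul_smul, smul_smul, neg_smul]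
  intro i _
  rw [map_smul, mul_assoc', partialEven_mono (conj i)]
  split_ifs
  · simp
  · rw [xo_mul_mul_mono_of_mem (Finset.mem_insert_self _ _)]; simp

/-- Monomials divisible by `x_ζ` are reached from those that are not. -/
theorem mem_of_mem_zeta (H : IsNormalizedDer p t ζ Ψ) {α : Fin m → ℕ} {u : Finset (Fin n)}
    (h : Valid p t α u) (hz : ζ ∈ u)
    (hw : ∀ w : Finset (Fin n), ζ ∉ w → w.card = u.card → mono F α w ∈ killed p t Ψ) :
    mono F α u ∈ killed p t Ψ := by
  -- The size of u is even and n is odd, so some index l is missing. The rotation x_ζ ∂_l - x_{l'}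
  -- ∂_ζ then replaces x_l by x_ζ.
  obtain ⟨l, hl⟩ : ∃ l, l ∉ u := by
    by_contra hcon
    push Not at hcon
    have h1 := h.even
    rw [Finset.eq_univ_iff_forall.mpr hcon, Finset.card_univ, Fintype.card_fin] at h1
    exact Nat.not_even_iff_odd.mpr H.odd_n h1
  have hlz : l ≠ ζ := fun e => hl (e ▸ hz)
  have hle : l ∉ u.erase ζ := fun h' => hl (Finset.mem_of_mem_erase h')
  have hzw : ζ ∉ insert l (u.erase ζ) := by simp [hlz.symm]
  refine H.mem_of_bracket' (H.xo_mul_xo_mem (conj l) ζ) (hw (insert l (u.erase ζ)) hzw ?_)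
    (H.valid_mem_idealO h) (c := (-1 : F) ^ inversions {l} (u.erase ζ) *
      (-1) ^ inversions {ζ} (u.erase ζ))
    (mul_ne_zero (neg_one_pow_ne_zero _) (neg_one_pow_ne_zero _)) ?_
  · rw [Finset.card_insert_of_notMem hle, Finset.card_erase_add_one hz]
  · rw [DH_xo_mul_xo, conj_conj, H.conj_zeta, partialOdd_mono_insert hle,
      partialOdd_mono_of_notMem hzw, map_zero, sub_zero, map_smul, xo_mul_mono,
      if_neg (Finset.notMem_erase _ _), Finset.insert_erase hz, smul_smul]

/-- A bracket cancels an auxiliary x_ζ between two shorter monomials. With at least three odd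
variables, α can stay entirely in one factor. With two, α is split if it involves several variables;
a pure power x_i^(a), a > 1, is reached by `mem_of_dp`, and a single x_i by the base case
`xe_mul_rot_mem`. -/
theorem mem_of_ne_zero_of_notMem (H : IsNormalizedDer p t ζ Ψ) {α : Fin m → ℕ}
    {u : Finset (Fin n)} (h : Valid p t α u) (hL : Lower F p t Ψ ((∑ i, α i) + u.card))
    (hα : α ≠ 0) (hu : u.Nonempty) (hz : ζ ∉ u) : mono F α u ∈ killed p t Ψ := by
  have hle : ∀ i, α i ≤ topExp p t i := h.le
  obtain ⟨k, hk⟩ := hu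
  obtain ⟨v, hkv, rfl⟩ : ∃ v, k ∉ v ∧ insert k v = u :=
    ⟨u.erase k, Finset.notMem_erase k u, Finset.insert_erase hk⟩
  have hkz : k ≠ ζ := fun e => hz (e ▸ hk)
  have hzv : ζ ∉ v := fun h' => hz (Finset.mem_insert_of_mem h')
  have hcz : (insert ζ v).card = v.card + 1 := Finset.card_insert_of_notMem hzv
  have hck : (insert k v).card = v.card + 1 := Finset.card_insert_of_notMem hkv
  have hkz2 : ({k, ζ} : Finset (Fin n)).card = 2 := Finset.card_pair hkz
  have hev := h.even
  rw [hck] at hev hL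
  obtain ⟨i, hi⟩ := Function.ne_iff.mp hα
  change α i ≠ 0 at hi
  have hsum := Finset.single_le_sum (f := α) (fun j _ => Nat.zero_le (α j)) (Finset.mem_univ i)
  have hvpos : 1 ≤ v.card := by
    by_contra hcon
    rw [show v.card = 0 by omega] at hev
    exact absurd hev (by decide)
  have hvalf : ∀ β : Fin m → ℕ, β ≤ topExp p t → Valid p t β {k, ζ} := fun β hβ =>
    ⟨hβ, by rw [hkz2]; exact even_two, fun e => by simp at e⟩
  have hvalg : ∀ β : Fin m → ℕ, β ≤ topExp p t → Valid p t β (insert ζ v) := fun β hβ =>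
    ⟨hβ, by rw [hcz]; exact hev, fun e => by simp at e⟩
  by_cases h4 : 2 ≤ v.card
  · have := H.mem_of_split (β := α) (γ := 0) hkz hkv hzv (by rwa [add_zero]) (by simp [bc])
      (hL _ _ (hvalf α h.le) (by omega)) (hL _ _ (hvalg 0 fun _ => Nat.zero_le _) (by simp; omega))
    rwa [add_zero] at this
  have hv1 : v.card = 1 := by omega
  by_cases hmulti : α i < ∑ j, α j
  · have e : Pi.single i (α i) + (α - Pi.single i (α i)) = α := by
      ext j
      by_cases hj : j = i
      · subst hj; simp
      · simp [hj]
    have hγ := sum_sub_single (α := α) (i := i) le_rfl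
    have hb : bc F (Pi.single i (α i)) (α - Pi.single i (α i)) = 1 := by
      refine Finset.prod_eq_one fun j _ => ?_
      by_cases hj : j = i
      · subst hj; simp
      · simp [hj]
    have hβle : (Pi.single i (α i) : Fin m → ℕ) ≤ topExp p t := fun j => by
      by_cases hj : j = i
      · subst hj; simpa using hle j
      · simp [hj]
    have hγle : (α - Pi.single i (α i) : Fin m → ℕ) ≤ topExp p t := fun j =>
      (Nat.sub_le _ _).trans (hle j)
    have := H.mem_of_split (β := Pi.single i (α i)) (γ := α - Pi.single i (α i)) hkz hkv hzv
      (by rwa [e]) (by rw [hb]; simp) (hL _ _ (hvalf _ hβle) (by rw [sum_single]; omega))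
      (hL _ _ (hvalg _ hγle) (by omega))
    rwa [e] at this
  have hform : α = Pi.single i (α i) := eq_single_of_sum_le (by omega)
  by_cases h1 : α i = 1
  · rw [h1] at hform
    obtain ⟨l, rfl⟩ := Finset.card_eq_one.mp hv1
    have hlz : l ≠ ζ := fun e => hzv (by simp [e])
    have hg := H.xe_mul_rot_mem i hlz
    rw [xe_mul_xo_mul_xo_eq i hlz, Submodule.smul_mem_iff _ (neg_one_pow_ne_zero _)] at hg
    have := H.mem_of_split (β := 0) (γ := α) hkz hkv hzv (by rwa [zero_add]) (by simp [bc])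
      (H.low_mem (by rw [hkz2]; simp) (by rw [hkz2]; exact even_two))
      (by rw [hform, Finset.pair_comm]; exact hg)
    rwa [zero_add] at this
  · have hci := conj_ne H.even_m i
    have h0 : α (conj i) = 0 := by rw [hform]; simp [hci]
    refine H.mem_of_dp h (by rw [hck]; exact hL) (i := i) (a := α i - 1) (by omega) (by omega)
      (by have := hle i; omega) (by rw [hck]; omega) ?_
    rw [h0, show α i - 1 + 1 = α i by omega, Nat.choose_self]
    simp

theorem mem_of_ne_zero (H : IsNormalizedDer p t ζ Ψ) {α : Fin m → ℕ}
    {u : Finset (Fin n)} (h : Valid p t α u) (hL : Lower F p t Ψ ((∑ i, α i) + u.card))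
    (hα : α ≠ 0) (hu : u.Nonempty) : mono F α u ∈ killed p t Ψ := by
  by_cases hz : ζ ∈ u
  · refine H.mem_of_mem_zeta h hz fun w hw hcard => ?_
    have hwn : w.Nonempty := by
      rw [← Finset.card_pos, hcard]; exact Finset.card_pos.mpr hu
    exact H.mem_of_ne_zero_of_notMem ⟨h.le, by rw [hcard]; exact h.even, fun e =>
      absurd e hwn.ne_empty⟩ (by rw [hcard]; exact hL) hα hwn hw
  · exact H.mem_of_ne_zero_of_notMem h hL hα hu hz

theorem xo_mul_partialOdd_mem {S : Submodule F (SuperO F m n)} {i : Fin m} {β : Fin m → ℕ}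
    {v : Finset (Fin n)} (hS : ∀ w : Finset (Fin n), w.card = v.card →
      mono F (β + Pi.single i 1) w ∈ S) (k l : Fin n) :
    mul F (xe F n i) (mul F (xo F m k) (partialOdd F l (mono F β v))) ∈ S := by
  rw [partialOdd_mono]
  split_ifs with h
  · rw [map_smul, xo_mul_mono]
    split_ifs with h2
    · simp
    · rw [map_smul, map_smul, xe_mul_mono]
      refine Submodule.smul_mem _ _ (Submodule.smul_mem _ _ (Submodule.smul_mem _ _ (hS _ ?_)))
      rw [Finset.card_insert_of_notMem h2, Finset.card_erase_add_one h]
  · simp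

/-- Monomials of degree at least `4` in the odd variables are killed. -/
theorem mem_of_zero (H : IsNormalizedDer p t ζ Ψ) {u : Finset (Fin n)} (hev : Even u.card)
    (hL : Lower F p t Ψ u.card) (hu : 4 ≤ u.card) : mono F 0 u ∈ killed p t Ψ := by
  have hm := H.even_m
  obtain ⟨k, hk⟩ : u.Nonempty := Finset.card_pos.mp (by omega)
  obtain ⟨u', hku', rfl⟩ : ∃ v, k ∉ v ∧ insert k v = u :=
    ⟨u.erase k, Finset.notMem_erase k u, Finset.insert_erase hk⟩
  have hc1 : (insert k u').card = u'.card + 1 := Finset.card_insert_of_notMem hku'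
  obtain ⟨l, hl⟩ : u'.Nonempty := Finset.card_pos.mp (by omega)
  obtain ⟨v, hlv, rfl⟩ : ∃ v, l ∉ v ∧ insert l v = u' :=
    ⟨u'.erase l, Finset.notMem_erase l u', Finset.insert_erase hl⟩
  have hc2 : (insert l v).card = v.card + 1 := Finset.card_insert_of_notMem hlv
  have hkl : k ≠ l := fun e => hku' (by simp [e])
  rw [hc1, hc2] at hev hL hu
  have hev' : Even v.card := by
    rwa [add_assoc, Nat.even_add, iff_true_right (by decide)] at hev
  let i : Fin m := ⟨0, H.m_pos⟩
  have hf : mul F (xe F n i) (mul F (xo F m k) (xo F m l)) ∈ killed p t Ψ := by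
    rw [xe_mul_xo_mul_xo_eq i hkl]
    refine Submodule.smul_mem _ _ (hL _ _ (H.valid_of_sum_le ?_ ?_) ?_)
    · rw [sum_single]; norm_num
    · rw [Finset.card_pair hkl]; exact even_two
    · rw [Finset.card_pair hkl, sum_single]; omega
  have hg : mono F (Pi.single (conj i) 1) v ∈ killed p t Ψ :=
    hL _ _ (H.valid_of_sum_le (by rw [sum_single]; norm_num) hev') (by rw [sum_single]; omega)
  have hS : ∀ w : Finset (Fin n), w.card = v.card →
      mono F (Pi.single (conj i) 1 + Pi.single i 1) w ∈ killed p t Ψ := fun w hw => by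
    have hs : ∑ j, (Pi.single (conj i) 1 + Pi.single i 1 : Fin m → ℕ) j = 2 := by
      simp only [Pi.add_apply, Finset.sum_add_distrib, sum_single]
    refine H.mem_of_ne_zero (H.valid_of_sum_le (by omega) (by rwa [hw])) ?_ ?_ ?_
    · rw [hs, hw, show 2 + v.card = v.card + 1 + 1 by ring]; exact hL
    · intro e; rw [e] at hs; simp at hs
    · rw [← Finset.card_pos]; omega
  have hv0 : Valid p t (0 : Fin m → ℕ) (insert k (insert l v)) :=
    H.valid_of_sum_le (by simp) (by rw [hc1, hc2]; exact hev)
  -- {x_i x_k x_l, x_{i'} x^v} is ±x_k x_l x^v plus x_i {x_k x_l, x_{i'} x^v}. The second term has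
  -- the same total degree but contains even variables, so `mem_of_ne_zero` already covers it.
  refine H.mem_of_bracket hf hg (H.valid_mem_idealO hv0) (c := tau F i *
    ((-1) ^ inversions {l} v * (-1) ^ inversions {k} (insert l v)))
    (r := mul F (xe F n i) (DH F (mul F (xo F m k) (xo F m l)) (mono F (Pi.single (conj i) 1) v)))
    ?_ (mul_ne_zero (tau_ne_zero _) (mul_ne_zero (neg_one_pow_ne_zero _) (neg_one_pow_ne_zero _)))
    ?_
  · rw [DH_xo_mul_xo, map_sub]
    exact Submodule.sub_mem _ (xo_mul_partialOdd_mem hS _ _) (xo_mul_partialOdd_mem hS _ _)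
  · have e : partialEven F (conj i) (mono F (Pi.single (conj i) 1) v) = mono F 0 v := by
      have := partialEven_mono_succ (F := F) (conj i) 0 v
      rwa [zero_add] at this
    rw [DH_mul_eq (xe_even i) (xo_mul_xo_even k l), DH_xe, e, map_smul, mul_assoc', xo_mul_mono l,
      if_neg hlv, map_smul, xo_mul_mono k, if_neg hku', add_comm, smul_smul, smul_smul, mul_assoc]

/-- A normalized derivation kills all monomials. -/
theorem lower (H : IsNormalizedDer p t ζ Ψ) (N : ℕ) : Lower F p t Ψ N := by
  induction N with
  | zero => exact fun α u _ h => absurd h (Nat.not_lt_zero _)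
  | succ N ih =>
    intro α u h hlt
    by_cases hlt' : (∑ i, α i) + u.card < N
    · exact ih α u h hlt'
    have hN : (∑ i, α i) + u.card = N := by omega
    rw [← hN] at ih
    by_cases h2 : (∑ i, α i) + u.card ≤ 2
    · exact H.low_mem h2 h.even
    rcases Finset.eq_empty_or_nonempty u with rfl | hu
    · exact H.mem_of_empty h (by simpa using ih)
    · by_cases hα : α = 0
      · subst hα
        have hs : ∑ i, (0 : Fin m → ℕ) i = 0 := by simp
        rw [hs, zero_add] at ih h2
        obtain ⟨c, hc⟩ := h.even
        exact H.mem_of_zero h.even ih (by omega)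
      · exact H.mem_of_ne_zero h ih hα hu

/-- A normalized derivation vanishes. -/
theorem eq_zero (H : IsNormalizedDer p t ζ Ψ) {f : SuperO F m n} (hf : f ∈ idealO F n p t) :
    Ψ f = 0 := by
  have : idealO F n p t ≤ LinearMap.ker Ψ := by
    refine Submodule.span_le.mpr ?_
    rintro _ ⟨α, u, h1, h2, -, h3, rfl⟩
    exact (H.lower _ α u ⟨h1, h2, fun e e' => h3 (by rw [e, e'])⟩ (Nat.lt_succ_self _)).2
  exact this hf

end IsNormalizedDer

/-! ### Iterated derivatives in characteristic `p` -/

theorem partialEven_pow_mono (i : Fin m) (k : ℕ) (α : Fin m → ℕ) (u : Finset (Fin n)) :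
    (partialEven F i ^ k) (mono F α u) = if k ≤ α i then mono F (α - Pi.single i k) u else 0 := by
  induction k with
  | zero => simp
  | succ k ih =>
    rw [pow_succ', Module.End.mul_apply, ih]
    by_cases h : k + 1 ≤ α i
    · rw [if_pos (by omega), if_pos h, partialEven_mono, if_neg (by simp; omega)]
      congr 1
      ext j
      by_cases hj : j = i
      · subst hj; simp; omega
      · simp [hj]
    · rw [if_neg h]
      split_ifs with h2
      · rw [partialEven_mono, if_pos (by simp; omega)]
      · exact map_zero _

theorem partialEven_pow_even (i : Fin m) (k : ℕ) {f : SuperO F m n}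
    (hf : f ∈ parityPart F m n 0) : (partialEven F i ^ k) f ∈ parityPart F m n 0 := by
  induction k with
  | zero => simpa using hf
  | succ k ih =>
    rw [pow_succ', Module.End.mul_apply]
    simpa using pd_mem_parityPart (Sum.inl i) ih

theorem lie_partialEven_DH (hm : Even m) (i : Fin m) {f : SuperO F m n}
    (hf : f ∈ parityPart F m n 0) :
    ⁅(partialEven F i : EndO F m n), DH F f⁆ = DH F (partialEven F i f) := by
  rw [DH_xe_conj hm, lie_DH hm (Submodule.smul_mem _ _ (xe_even _)) hf]

/-- Because ∂_i is itself Hamiltonian, ad ∂_i acts inside D_H as ∂_i. This identifies Θ(D_H f) with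
x^ω D_H(∂_i^{p^q} f). -/
theorem adOp_pow_DH (hm : Even m) (i : Fin m) (k : ℕ) {f : SuperO F m n}
    (hf : f ∈ parityPart F m n 0) :
    (adOp F (partialEven F i : EndO F m n) ^ k) (DH F f) = DH F ((partialEven F i ^ k) f) := by
  induction k with
  | zero => rfl
  | succ k ih =>
    rw [pow_succ', Module.End.mul_apply, ih, adOp_apply,
      lie_partialEven_DH hm i (partialEven_pow_even i k hf), pow_succ', Module.End.mul_apply]

instance : Nontrivial (SuperO F m n) :=
  ⟨⟨mono F 0 ∅, 0, (stdBasis F m n).ne_zero (0, ∅)⟩⟩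

/-- Left and right multiplication commute, so Frobenius applies to their difference in
characteristic p. -/
theorem adOp_pow_char (p : ℕ) [Fact p.Prime] [CharP F p] (q : ℕ) (D : EndO F m n) :
    adOp F D ^ p ^ q = adOp F (D ^ p ^ q) := by
  have : CharP (Module.End F (EndO F m n)) p :=
    charP_of_injective_algebraMap (algebraMap F (Module.End F (EndO F m n))).injective p
  have hc : Commute (LinearMap.mulLeft F D) (LinearMap.mulRight F D) :=
    LinearMap.commute_mulLeft_right _ _
  rw [adOp, adOp, sub_pow_char_pow_of_commute p q hc, LinearMap.pow_mulLeft,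
    LinearMap.pow_mulRight]

/-- `∂_i^{p^q}` is a derivation of the Hamiltonian bracket. -/
theorem partialEven_pow_DH (hm : Even m) (p : ℕ) [Fact p.Prime] [CharP F p] (i : Fin m) (q : ℕ)
    {f : SuperO F m n} (hf : f ∈ parityPart F m n 0) (g : SuperO F m n) :
    (partialEven F i ^ p ^ q) (DH F f g) =
      DH F ((partialEven F i ^ p ^ q) f) g + DH F f ((partialEven F i ^ p ^ q) g) := by
  have h := adOp_pow_DH hm i (p ^ q) hf
  rw [adOp_pow_char] at h
  have h1 := LinearMap.congr_fun h g
  rw [adOp_apply, lie_apply] at h1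
  rw [← h1]; abel

/-! ### The exceptional derivations -/

theorem partialEven_xOmega (i : Fin m) : partialEven F i (xOmega F n) = 0 :=
  partialEven_mono_zero_left i _

theorem xo_mul_partialOdd_xOmega (k l : Fin n) :
    mul F (xo F m k) (partialOdd F l (xOmega F n)) = if k = l then xOmega F n else 0 := by
  by_cases h : k = l
  · subst h
    rw [xOmega, xo_mul_partialOdd_mono]; simp
  · rw [xOmega, partialOdd_mono, if_pos (Finset.mem_univ _), map_smul,
      xo_mul_mono_of_mem (by simp [h]), smul_zero, if_neg h]

/-- `{f, x^ω} = 0` for even `f`. -/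
theorem DH_xOmega {f : SuperO F m n} (hf : f ∈ parityPart F m n 0) : DH F f (xOmega F n) = 0 := by
  -- Odd variables are removed two at a time by the product rule. For x_k x_l the two contributions
  -- to {x_k x_l, x^ω} are both x^ω when l = k' and both 0 otherwise, so they cancel.
  have key : ∀ (N : ℕ) (α : Fin m → ℕ) (u : Finset (Fin n)), u.card = 2 * N →
      DH F (mono F α u) (xOmega F n) = 0 := by
    intro N
    induction N with
    | zero =>
      intro α u hu
      obtain rfl : u = ∅ := Finset.card_eq_zero.mp (by simpa using hu)
      rw [DH_mono_empty]
      exact Finset.sum_eq_zero fun i _ => by rw [partialEven_xOmega]; simp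
    | succ N ih =>
      intro α u hu
      obtain ⟨k, hk⟩ : u.Nonempty := Finset.card_pos.mp (by omega)
      obtain ⟨u', hku', rfl⟩ : ∃ v, k ∉ v ∧ insert k v = u :=
        ⟨u.erase k, Finset.notMem_erase k u, Finset.insert_erase hk⟩
      rw [Finset.card_insert_of_notMem hku'] at hu
      obtain ⟨l, hl⟩ : u'.Nonempty := Finset.card_pos.mp (by omega)
      obtain ⟨v, hlv, rfl⟩ : ∃ v, l ∉ v ∧ insert l v = u' :=
        ⟨u'.erase l, Finset.notMem_erase l u', Finset.insert_erase hl⟩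
      rw [Finset.card_insert_of_notMem hlv] at hu
      have hv : v.card = 2 * N := by omega
      have e : mul F (mul F (xo F m k) (xo F m l)) (mono F α v) =
          ((-1 : F) ^ inversions {l} v * (-1) ^ inversions {k} (insert l v)) •
            mono F α (insert k (insert l v)) := by
        rw [mul_assoc', xo_mul_mono, if_neg hlv, map_smul, xo_mul_mono, if_neg hku', smul_smul]
      have h1 : DH F (mul F (mul F (xo F m k) (xo F m l)) (mono F α v)) (xOmega F n) = 0 := by
        rw [DH_mul_eq (xo_mul_xo_even k l) (mono_even _ (by rw [hv]; exact even_two_mul N)),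
          ih α v hv, DH_xo_mul_xo, xo_mul_partialOdd_xOmega, xo_mul_partialOdd_xOmega]
        have h2 : l = conj k ↔ k = conj l :=
          ⟨fun h => by rw [h, conj_conj], fun h => by rw [h, conj_conj]⟩
        simp [h2]
      rw [e, map_smul, LinearMap.smul_apply] at h1
      exact (smul_eq_zero.mp h1).resolve_left
        (mul_ne_zero (neg_one_pow_ne_zero _) (neg_one_pow_ne_zero _))
  let T : SuperO F m n →ₗ[F] SuperO F m n :=
    { toFun := fun g => DH F g (xOmega F n)
      map_add' := fun g h => by rw [map_add, LinearMap.add_apply]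
      map_smul' := fun c g => by rw [map_smul, LinearMap.smul_apply, RingHom.id_apply] }
  have hT : ∀ α u, (Finset.card u : ZMod 2) = 0 →
      T (mono F α u) = (0 : SuperO F m n →ₗ[F] SuperO F m n) (mono F α u) := by
    intro α u hu
    obtain ⟨N, hN⟩ := natCast_zmod_two_eq_zero.mp hu
    have h := key N α u (by omega)
    rw [LinearMap.zero_apply]
    exact h
  have h := eq_on_parityPart hT hf
  rw [LinearMap.zero_apply] at h
  exact h

theorem xOmega_odd (hn : Odd n) : xOmega F n ∈ parityPart F m n 1 :=
  mono_mem_parityPart _ _ (by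
    rw [Finset.card_univ, Fintype.card_fin]; exact natCast_zmod_two_eq_one.mpr hn)

theorem DH_xOmega_eq (hn : Odd n) :
    DH F (xOmega F n : SuperO F m n) =
      -∑ k, leftMul F (partialOdd F k (xOmega F n)) (partialOdd F (conj k)) := by
  change (∑ i : Fin m, tau F i • leftMul F (partialEven F i _) (partialEven F (conj i))) +
    ∑ k : Fin n, leftMul F (partialOdd F k (parityInv F _)) (partialOdd F (conj k)) = _
  rw [parityInv_of_mem (xOmega_odd hn), Finset.sum_eq_zero, zero_add, ← Finset.sum_neg_distrib]
  · refine Finset.sum_congr rfl fun k _ => ?_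
    ext h; simp [leftMul, zsgn]
  · intro i _
    rw [partialEven_xOmega]; simp [leftMul]

theorem lie_leftMul {f : SuperO F m n} (hf : f ∈ parityPart F m n 0) (h : SuperO F m n)
    (D : EndO F m n) :
    ⁅DH F f, leftMul F h D⁆ = leftMul F (DH F f h) D + leftMul F h ⁅DH F f, D⁆ := by
  ext1 g
  simp only [lie_apply, leftMul, LinearMap.add_apply, LinearMap.comp_apply, DH_mul hf, map_sub]
  abel

/-- `D_H(x^ω)` commutes with `D_H(f)` for even `f`. -/
theorem lie_DH_xOmega (hn : Odd n) {f : SuperO F m n} (hf : f ∈ parityPart F m n 0) :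
    ⁅DH F f, DH F (xOmega F n : SuperO F m n)⁆ = 0 := by
  have hpar : ∀ k, partialOdd F k (xOmega F n) ∈ parityPart F m n 0 := fun k => by
    have := pd_mem_parityPart (Sum.inr k) (xOmega_odd (F := F) (m := m) hn)
    rwa [ipar_inr, show (1 + 1 : ZMod 2) = 0 from by decide] at this
  have hΩ : ∀ h : SuperO F m n, DH F (xOmega F n) h =
      -∑ k, mul F (partialOdd F k (xOmega F n)) (partialOdd F (conj k) h) := fun h => by
    rw [DH_xOmega_eq hn]; simp [leftMul]
  have hsum : ∀ h : SuperO F m n, ∑ k, mul F (partialOdd F k (xOmega F n)) (partialOdd F (conj k) h)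
      = ∑ k, mul F (partialOdd F k h) (partialOdd F (conj k) (xOmega F n)) := fun h => by
    let e : Equiv.Perm (Fin n) := ⟨conj, conj, conj_conj, conj_conj⟩
    rw [← Equiv.sum_comp e]
    refine Finset.sum_congr rfl fun k _ => ?_
    change mul F (partialOdd F (conj k) (xOmega F n)) (partialOdd F (conj (conj k)) h) = _
    rw [conj_conj, mul_comm_even (hpar _)]
  -- This follows from {f, x^ω} = 0 by reindexing k ↦ k'. Differentiating these two identities gives
  -- the action of D_H(x^ω) on all derivatives of f, which are the coefficients of D_H(f).
  have hΩf : DH F (xOmega F n) f = 0 := by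
    have h1 := DH_xOmega hf
    rw [DH_apply hf, Fintype.sum_sum_type, Finset.sum_eq_zero, zero_add] at h1
    · rw [hΩ, hsum, neg_eq_zero]
      simpa using h1
    · intro i _
      simp [partialEven_xOmega]
  have hΩe : ∀ i, DH F (xOmega F n) (partialEven F i f) = 0 := fun i => by
    have h1 := congrArg (partialEven F i) hΩf
    rw [hΩ, map_neg, map_sum, map_zero] at h1
    rw [hΩ, ← h1]
    congr 1
    refine Finset.sum_congr rfl fun k _ => ?_
    rw [partialEven_mul, partialEven_partialOdd, partialEven_xOmega, partialEven_partialOdd]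
    simp
  have hΩo : ∀ l, DH F (xOmega F n) (partialOdd F l f) = -DH F f (partialOdd F l (xOmega F n)) := by
    intro l
    have h1 := pd_DH hf (Sum.inr l) (xOmega F n)
    rw [DH_xOmega hf, map_zero, Fintype.sum_sum_type, Finset.sum_eq_zero, zero_add] at h1
    · rw [hΩ, hsum, eq_neg_iff_add_eq_zero, add_comm, h1]
      congr 1
      rw [← Finset.sum_neg_distrib]
      refine Finset.sum_congr rfl fun k _ => ?_
      simp [partialOdd_partialOdd l k]
    · intro i _
      simp [partialEven_xOmega]
  ext1 h
  rw [lie_apply, LinearMap.zero_apply, hΩ, hΩ, map_neg, map_sum, sub_neg_eq_add,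
    neg_add_eq_sub, ← Finset.sum_sub_distrib]
  -- Termwise commutator: the first part differentiates the coefficients of D_H(f), the second those
  -- of D_H(x^ω). After summation they cancel by the relations just obtained.
  have key : ∀ k, mul F (partialOdd F k (xOmega F n)) (partialOdd F (conj k) (DH F f h)) -
      DH F f (mul F (partialOdd F k (xOmega F n)) (partialOdd F (conj k) h)) =
      (∑ s, tauI F s • mul F (mul F (partialOdd F k (xOmega F n))
        (partialOdd F (conj k) (pd F s f))) (pd F (conjI s) h)) -
      mul F (DH F f (partialOdd F k (xOmega F n))) (partialOdd F (conj k) h) := by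
    intro k
    have h1 := pd_DH hf (Sum.inr (conj k)) h
    simp only [pd_inr] at h1
    rw [DH_mul hf, h1, map_add, map_sum]
    simp only [map_smul, ← mul_assoc']
    abel
  rw [Finset.sum_congr rfl fun k _ => key k, Finset.sum_sub_distrib, Finset.sum_comm]
  have key2 : ∀ s, ∑ k, tauI F s • mul F (mul F (partialOdd F k (xOmega F n))
        (partialOdd F (conj k) (pd F s f))) (pd F (conjI s) h) =
      -(tauI F s • mul F (DH F (xOmega F n) (pd F s f)) (pd F (conjI s) h)) := by
    intro s
    rw [hΩ, ← Finset.smul_sum, map_neg, LinearMap.neg_apply, smul_neg, neg_neg, map_sum,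
      LinearMap.sum_apply]
  rw [Finset.sum_congr rfl fun s _ => key2 s, Fintype.sum_sum_type]
  simp [hΩe, hΩo]

theorem leftMul_leftMul (f g : SuperO F m n) (D : EndO F m n) :
    leftMul F f (leftMul F g D) = leftMul F (mul F f g) D := by
  ext1 h; simp [leftMul, mul_assoc']

theorem leftMul_neg_sum {ι : Type*} (s : Finset ι) (f : SuperO F m n) (D : ι → EndO F m n) :
    leftMul F f (-∑ k ∈ s, D k) = -∑ k ∈ s, leftMul F f (D k) := by
  ext1 h; simp [leftMul]

/-- The map `f ↦ x^ω D_H(∂_i^{p^q}(f))`. -/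
def preΘ (F : Type*) [Field F] {m : ℕ} (n p : ℕ) (i : Fin m) (q : ℕ) :
    SuperO F m n →ₗ[F] EndO F m n where
  toFun f := leftMul F (xOmega F n) (DH F ((partialEven F i ^ p ^ q) f))
  map_add' f g := by simp [leftMul, LinearMap.comp_add]
  map_smul' c f := by simp [leftMul, LinearMap.comp_smul]

theorem preΘ_apply (p : ℕ) (i : Fin m) (q : ℕ) (f : SuperO F m n) :
    preΘ F n p i q f = leftMul F (xOmega F n) (DH F ((partialEven F i ^ p ^ q) f)) := rfl

/-- Derivations of `𝒥` into the odd vector fields, as maps on Hamiltonian functions, that vanish in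
degrees `-1` and `0`. -/
def outerDers (F : Type*) [Field F] {m : ℕ} (n p : ℕ) (t : Fin m → ℕ) :
    Submodule F (SuperO F m n →ₗ[F] EndO F m n) where
  carrier := {T | (∀ f ∈ idealO F n p t, T f ∈ oddFields F m n) ∧
    (∀ f ∈ idealO F n p t, ∀ g ∈ idealO F n p t, DH F f g ∈ idealO F n p t →
      T (DH F f g) = ⁅T f, DH F g⁆ + ⁅DH F f, T g⁆) ∧
    ∀ α u, Valid p t α u → (∑ i, α i) + u.card ≤ 2 → T (mono F α u) = 0}
  add_mem' := by
    rintro S T ⟨a1, a2, a3⟩ ⟨b1, b2, b3⟩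
    refine ⟨fun f hf => Submodule.add_mem _ (a1 f hf) (b1 f hf), fun f hf g hg h => ?_,
      fun α u h h' => ?_⟩
    · simp only [LinearMap.add_apply, a2 f hf g hg h, b2 f hf g hg h, Ring.lie_def, add_mul, mul_add]
      abel
    · rw [LinearMap.add_apply, a3 α u h h', b3 α u h h', add_zero]
  zero_mem' := ⟨fun f _ => Submodule.zero_mem _, fun f _ g _ _ => by simp [Ring.lie_def],
    fun _ _ _ _ => rfl⟩
  smul_mem' := by
    rintro c T ⟨a1, a2, a3⟩
    refine ⟨fun f hf => Submodule.smul_mem _ _ (a1 f hf), fun f hf g hg h => ?_,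
      fun α u h h' => ?_⟩
    · simp only [LinearMap.smul_apply, a2 f hf g hg h, Ring.lie_def, smul_add, smul_sub,
        smul_mul_assoc, mul_smul_comm]
    · rw [LinearMap.smul_apply, a3 α u h h', smul_zero]

/-- For q ≥ 1 the order p^q exceeds 2, hence every exponent in total degree at most two. This is why
the exceptional maps vanish in degrees -1 and 0. -/
theorem partialEven_pow_low {p : ℕ} (hp : 3 < p) {q : ℕ} (hq : 1 ≤ q) (i : Fin m)
    {α : Fin m → ℕ} {u : Finset (Fin n)} (h : (∑ i, α i) + u.card ≤ 2) :
    (partialEven F i ^ p ^ q) (mono F α u) = 0 := by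
  rw [partialEven_pow_mono, if_neg]
  have h1 := Finset.single_le_sum (f := α) (fun j _ => Nat.zero_le (α j)) (Finset.mem_univ i)
  have h2 : p ^ 1 ≤ p ^ q := Nat.pow_le_pow_right (by omega) hq
  rw [pow_one] at h2
  omega

theorem neg_lie_eq (A B : EndO F m n) : ⁅A, B⁆ = -⁅B, A⁆ := by
  rw [Ring.lie_def, Ring.lie_def, neg_sub]

/-- As D_H(x^ω) commutes with D_H(f), the bracket [D_H f, h D_H(x^ω)] is {f, h} D_H(x^ω). The
derivation rule is therefore that of ∂_i^{p^q} on the bracket. -/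
theorem preΦ_mem_outerDers (hm : Even m) (hn : Odd n) (p : ℕ) [Fact p.Prime] [CharP F p]
    (hp : 3 < p) (t : Fin m → ℕ) (i : Fin m) {q : ℕ} (hq : 1 ≤ q) :
    preΦ F n p i q ∈ outerDers F n p t := by
  refine ⟨fun f hf => ?_, fun f hf g hg _ => ?_, fun α u _ h => ?_⟩
  · have hf' := partialEven_pow_even i (p ^ q) (idealO_le_parityPart p t hf)
    rw [preΦ_apply, DH_xOmega_eq hn, leftMul_neg_sum]
    refine Submodule.neg_mem _ (Submodule.sum_mem _ fun k _ => ?_)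
    rw [leftMul_leftMul]
    refine leftMul_pd_mem_oddFields (Sum.inr (conj k)) ?_
    have h1 := mul_mem_parityPart hf' (pd_mem_parityPart (Sum.inr k) (xOmega_odd (F := F) (m := m) hn))
    rwa [zero_add] at h1
  · have hf' := idealO_le_parityPart p t hf
    have hg' := idealO_le_parityPart p t hg
    rw [preΦ_apply, preΦ_apply, preΦ_apply, neg_lie_eq, lie_leftMul hg', lie_leftMul hf',
      lie_DH_xOmega hn hf', lie_DH_xOmega hn hg', partialEven_pow_DH hm p i q hf',
      DH_antisymm hm (partialEven_pow_even i _ hf') hg']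
    ext1 h
    simp [leftMul]
  · rw [preΦ_apply, partialEven_pow_low hp hq i h]
    ext1; simp [leftMul]

/-- As {f, x^ω} = 0, the factor x^ω passes through [D_H f, ·], and again only the derivation rule of
∂_i^{p^q} remains. -/
theorem preΘ_mem_outerDers (hm : Even m) (hn : Odd n) (p : ℕ) [Fact p.Prime] [CharP F p]
    (hp : 3 < p) (t : Fin m → ℕ) (i : Fin m) {q : ℕ} (hq : 1 ≤ q) :
    preΘ F n p i q ∈ outerDers F n p t := by
  refine ⟨fun f hf => ?_, fun f hf g hg _ => ?_, fun α u _ h => ?_⟩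
  · have hf' := partialEven_pow_even i (p ^ q) (idealO_le_parityPart p t hf)
    have e : preΘ F n p i q f = ∑ r, tauI F r • leftMul F (mul F (xOmega F n)
        (pd F r ((partialEven F i ^ p ^ q) f))) (pd F (conjI r)) := by
      rw [preΘ_apply, DH_eq_sum hf']
      ext1 h
      simp [leftMul, mul_assoc', -Fintype.sum_sum_type]
    rw [e]
    refine Submodule.sum_mem _ fun r _ => Submodule.smul_mem _ _ (leftMul_pd_mem_oddFields _ ?_)
    have h1 := mul_mem_parityPart (xOmega_odd (F := F) (m := m) hn) (pd_mem_parityPart r hf')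
    rwa [add_zero, add_comm, ← ipar_conjI] at h1
  · have hf' := idealO_le_parityPart p t hf
    have hg' := idealO_le_parityPart p t hg
    have h0 : ∀ D : EndO F m n, leftMul F (0 : SuperO F m n) D = 0 := fun D => by
      ext1; simp [leftMul]
    rw [preΘ_apply, preΘ_apply, preΘ_apply, neg_lie_eq, lie_leftMul hg', lie_leftMul hf',
      DH_xOmega hf', DH_xOmega hg', h0, h0, zero_add, zero_add, partialEven_pow_DH hm p i q hf',
      map_add, ← lie_DH hm (partialEven_pow_even i _ hf') hg',
      ← lie_DH hm hf' (partialEven_pow_even i _ hg'), neg_lie_eq (DH F ((partialEven F i ^ _) f))]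
    ext1 h
    simp [leftMul]
  · rw [preΘ_apply, partialEven_pow_low hp hq i h]
    ext1; simp [leftMul]

theorem DH_mono_mem_WDeg (p : ℕ) (t : Fin m → ℕ) {α : Fin m → ℕ} {u : Finset (Fin n)}
    (hα : α ≤ topExp p t) (hu : Even u.card) {d : ℤ}
    (hd : (((∑ i, α i) + u.card : ℕ) : ℤ) = d + 2) : DH F (mono F α u) ∈ WDeg F n p t d := by
  rw [DH_eq_sum (mono_even α hu)]
  refine Submodule.sum_mem _ fun r _ => Submodule.smul_mem _ _ ?_
  have h0 : ∀ D : EndO F m n, leftMul F (0 : SuperO F m n) D = 0 := fun D => by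
    ext1; simp [leftMul]
  rcases r with i | k
  · rw [pd_inl, partialEven_mono]
    split_ifs with h
    · rw [h0]; exact Submodule.zero_mem _
    · refine Submodule.subset_span ⟨_, _, conjI (Sum.inl i), fun j => (Nat.sub_le _ _).trans (hα j),
        ?_, rfl⟩
      have h1 := IsNormalizedDer.sum_sub_single (α := α) (i := i) (a := 1) (by omega)
      change (((∑ j, (α - Pi.single i 1 : Fin m → ℕ) j) + u.card : ℕ) : ℤ) = d + 1
      rw [← h1] at hd
      omega
  · rw [pd_inr, partialOdd_mono]
    split_ifs with h
    · have e : ∀ (c : F) (f : SuperO F m n) (D : EndO F m n),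
          leftMul F (c • f) D = c • leftMul F f D := fun c f D => by ext1; simp [leftMul]
      rw [e]
      refine Submodule.smul_mem _ _ (Submodule.subset_span ⟨_, _, conjI (Sum.inr k), hα, ?_, rfl⟩)
      have h1 := Finset.card_erase_add_one h
      rw [← h1] at hd
      omega
    · rw [h0]; exact Submodule.zero_mem _

/-! ### Coefficients that separate the exceptional derivations -/

theorem conj_eq_self_iff (hn : Odd n) (k : Fin n) :
    conj k = k ↔ k = ⟨n - 1, Nat.sub_lt hn.pos one_pos⟩ := by
  obtain ⟨s, rfl⟩ := hn
  have hk := k.2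
  have h2 : (2 * s + 1) / 2 = s := by omega
  rw [Fin.ext_iff, Fin.ext_iff]
  unfold conj
  split_ifs <;> simp <;> omega

theorem DH_xOmega_xo (hn : Odd n) {ζ : Fin n} (hζ : conj ζ = ζ) :
    DH F (xOmega F n : SuperO F m n) (xo F m ζ) =
      -(-1 : F) ^ inversions {ζ} Finset.univ • mono F 0 (Finset.univ.erase ζ) := by
  have h1 : DH F (xOmega F n : SuperO F m n) (xo F m ζ) =
      -∑ k, mul F (partialOdd F k (xOmega F n)) (partialOdd F (conj k) (xo F m ζ)) := by
    rw [DH_xOmega_eq hn]; simp [leftMul]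
  rw [h1, Finset.sum_eq_single ζ, partialOdd_xo, if_pos hζ, mul_one', xOmega, partialOdd_mono,
    if_pos (Finset.mem_univ _), neg_smul]
  · intro k _ hk
    rw [partialOdd_xo, if_neg (fun h => hk (by rw [← conj_conj k, h, hζ])), map_zero]
  · intro h; exact absurd (Finset.mem_univ _) h

theorem DH_xOmega_xe (hn : Odd n) (i : Fin m) :
    DH F (xOmega F n : SuperO F m n) (xe F n i) = 0 := by
  rw [DH_xOmega_eq hn]
  simp [leftMul, xe, partialOdd_mono_empty]

theorem sub_single_eq_zero_iff {i : Fin m} {a b : ℕ} (h : b ≤ a) :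
    (0 : Fin m → ℕ) = Pi.single i a - Pi.single i b ↔ b = a := by
  constructor
  · intro e
    have := congrFun e i
    simp at this
    omega
  · rintro rfl; simp

/-- The functionals of `normΦ` are dual, up to a nonzero scalar, to the Φ_r^{(s)}: the value has a
constant term only when the derivative exactly exhausts x_i^(p^q). The Θ_r^{(s)} are invisible to
them, by `preΘ_mono_xo`. -/
theorem coeff_preΦ_xo (hn : Odd n) {p : ℕ} (hp : 1 < p) {ζ : Fin n} (hζ : conj ζ = ζ)
    (i r : Fin m) (q s : ℕ) :
    coeff 0 (Finset.univ.erase ζ) (preΦ F n p r s (dp F n i (p ^ q)) (xo F m ζ)) =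
      if r = i ∧ s = q then -(-1 : F) ^ inversions {ζ} Finset.univ else 0 := by
  rw [preΦ_apply, leftMul, LinearMap.comp_apply, DH_xOmega_xo hn hζ, map_smul, map_smul, dp,
    partialEven_pow_mono, smul_eq_mul]
  by_cases hr : r = i
  · subst hr
    rw [Pi.single_eq_same]
    split_ifs with h1 h2 h2
    · obtain ⟨-, rfl⟩ := h2
      rw [tsub_self, one_mul', coeff_mono, if_pos ⟨rfl, rfl⟩, mul_one]
    · rw [mono_empty_mul_mono, map_smul, coeff_mono, if_neg, smul_zero, mul_zero]
      rintro ⟨e, -⟩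
      rw [add_zero, sub_single_eq_zero_iff h1] at e
      exact h2 ⟨rfl, Nat.pow_right_injective hp e⟩
    · exact absurd (by rw [h2.2]) h1
    · simp
  · rw [Pi.single_eq_of_ne hr, if_neg (not_le.mpr (Nat.pow_pos (n := s) (zero_lt_one.trans hp))),
      if_neg (fun h => hr h.1)]
    simp

theorem preΘ_mono_xo (p : ℕ) (r : Fin m) (s : ℕ) (α : Fin m → ℕ) (k : Fin n) :
    preΘ F n p r s (mono F α ∅) (xo F m k) = 0 := by
  rw [preΘ_apply, leftMul, LinearMap.comp_apply, partialEven_pow_mono]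
  split_ifs
  · rw [DH_mono_empty, Finset.sum_eq_zero, map_zero]
    intro j _
    rw [xo, partialEven_mono_zero_left]
    simp
  · simp

theorem preΦ_xe (hn : Odd n) (p : ℕ) (r : Fin m) (s : ℕ) (f : SuperO F m n) (i : Fin m) :
    preΦ F n p r s f (xe F n i) = 0 := by
  rw [preΦ_apply, leftMul, LinearMap.comp_apply, DH_xOmega_xe hn, map_zero]

theorem DH_mono_empty_xe (α : Fin m → ℕ) (i : Fin m) :
    DH F (mono F α ∅) (xe F n i) = tau F (conj i) • partialEven F (conj i) (mono F α ∅) := by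
  rw [DH_mono_empty, Finset.sum_eq_single (conj i), conj_conj, partialEven_xe, if_pos rfl,
    mul_one']
  · intro j _ hj
    rw [partialEven_xe, if_neg (fun h => hj (by rw [← h, conj_conj])), map_zero, smul_zero]
  · intro h; exact absurd (Finset.mem_univ _) h

/-- The functionals of `normΘ` are dual to the Θ_r^{(s)} up to the nonzero factor τ(i'), and the
Φ_r^{(s)} vanish under them since D_H(x^ω) kills the even variables. The condition s ≥ 1 prevents
∂_{i'} from removing the extra x_{i'}. -/
theorem coeff_preΘ_xe (hm : Even m) {p : ℕ} (hp : 1 < p) (i r : Fin m) (q : ℕ) {s : ℕ}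
    (hs : 1 ≤ s) :
    coeff 0 Finset.univ
        (preΘ F n p r s (mul F (dp F n i (p ^ q)) (xe F n (conj i))) (xe F n i)) =
      if r = i ∧ s = q then tau F (conj i) else 0 := by
  have hps : 1 < p ^ s := Nat.one_lt_pow (by omega) hp
  have hne := conj_ne hm i
  rw [IsNormalizedDer.dp_mul_xe_conj hm, preΘ_apply, leftMul, LinearMap.comp_apply,
    partialEven_pow_mono]
  by_cases hr : r = i
  · subst hr
    rw [Pi.add_apply, Pi.single_eq_same, Pi.single_eq_of_ne hne.symm, add_zero]
    by_cases h1 : p ^ s ≤ p ^ q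
    · rw [if_pos h1, DH_mono_empty_xe, map_smul, map_smul, smul_eq_mul,
        show (Pi.single r (p ^ q) + Pi.single (conj r) 1 - Pi.single r (p ^ s) : Fin m → ℕ) =
          (Pi.single r (p ^ q) - Pi.single r (p ^ s)) + Pi.single (conj r) 1 from
          tsub_add_eq_add_tsub (by
            intro j
            by_cases hj : j = r
            · subst hj; simpa using h1
            · simp [hj]) |>.symm,
        partialEven_mono_succ, ← mul_comm_even (mono_even _ (by simp)), xOmega,
        mono_empty_mul_mono, map_smul, coeff_mono, add_zero]
      simp only [sub_single_eq_zero_iff h1]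
      by_cases h2 : s = q
      · subst h2
        simp [bc]
      · rw [if_neg (fun h => h2 (Nat.pow_right_injective hp h.1)), if_neg (fun h => h2 h.2)]
        simp
    · rw [if_neg h1, if_neg (fun h => h1 (by rw [h.2]))]
      simp
  · have h1 : ¬ p ^ s ≤ (Pi.single i (p ^ q) + Pi.single (conj i) 1 : Fin m → ℕ) r := by
      rw [Pi.add_apply, Pi.single_eq_of_ne hr, zero_add]
      by_cases hr' : r = conj i
      · subst hr'; simpa using hps
      · rw [Pi.single_eq_of_ne hr']; omega
    rw [if_neg h1, if_neg (fun h => hr h.1)]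
    simp

theorem sum_sum_mul_ite {t : Fin m → ℕ} (a : Fin m → ℕ → F) (c : F) (i : Fin m) {q : ℕ}
    (hq1 : 1 ≤ q) (hq : q < t i) :
    ∑ r, ∑ s ∈ Finset.Icc 1 (t r - 1), a r s * (if r = i ∧ s = q then c else 0) = a i q * c := by
  rw [Finset.sum_eq_single i, Finset.sum_eq_single q, if_pos ⟨rfl, rfl⟩]
  · intro s _ hs; rw [if_neg (fun h => hs h.2), mul_zero]
  · intro h; exact absurd (Finset.mem_Icc.mpr ⟨hq1, by omega⟩) h
  · intro r _ hr
    exact Finset.sum_eq_zero fun s _ => by rw [if_neg (fun h => hr h.1), mul_zero]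
  · intro h; exact absurd (Finset.mem_univ _) h

/-- Modulo the exceptional derivations, a derivation that vanishes in degrees `-1` and `0` is
normalized. -/
theorem exists_isNormalizedDer_sub (p : ℕ) [Fact p.Prime] [CharP F p] (hp : 3 < p) (hm : 0 < m)
    (hm2 : Even m) (hn : Odd n) {t : Fin m → ℕ} (ht : ∀ i, 0 < t i)
    {T : SuperO F m n →ₗ[F] EndO F m n} (hT : T ∈ outerDers F n p t) :
    ∃ (ζ : Fin n) (a b : Fin m → ℕ → F), IsNormalizedDer p t ζ
      (T - ∑ r, ∑ s ∈ Finset.Icc 1 (t r - 1), (a r s • preΦ F n p r s + b r s • preΘ F n p r s)) := by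
  have hp1 : 1 < p := by omega
  let ζ : Fin n := ⟨n - 1, Nat.sub_lt hn.pos one_pos⟩
  have hζ : conj ζ = ζ := (conj_eq_self_iff hn ζ).mpr rfl
  let c : F := -(-1 : F) ^ inversions {ζ} Finset.univ
  have hc : c ≠ 0 := neg_ne_zero.mpr (neg_one_pow_ne_zero _)
  -- The detecting functionals form a diagonal system, so each scalar is the detected coefficient of
  -- T divided by the diagonal entry.
  let a : Fin m → ℕ → F := fun i q =>
    coeff 0 (Finset.univ.erase ζ) (T (dp F n i (p ^ q)) (xo F m ζ)) / c
  let b : Fin m → ℕ → F := fun i q =>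
    coeff 0 Finset.univ (T (mul F (dp F n i (p ^ q)) (xe F n (conj i))) (xe F n i)) /
      tau F (conj i)
  have hmem : T - ∑ r, ∑ s ∈ Finset.Icc 1 (t r - 1),
      (a r s • preΦ F n p r s + b r s • preΘ F n p r s) ∈ outerDers F n p t := by
    refine Submodule.sub_mem _ hT (Submodule.sum_mem _ fun r _ => Submodule.sum_mem _ fun s hs => ?_)
    have hs1 := (Finset.mem_Icc.mp hs).1
    exact Submodule.add_mem _
      (Submodule.smul_mem _ _ (preΦ_mem_outerDers hm2 hn p hp t r hs1))
      (Submodule.smul_mem _ _ (preΘ_mem_outerDers hm2 hn p hp t r hs1))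
  refine ⟨ζ, a, b, ?_⟩
  refine ⟨Fact.out, inferInstance, hp, hm, hm2, hn, conj_eq_self_iff hn, ht, hmem.1, hmem.2.1,
    hmem.2.2, fun i q hq1 hq => ?_, fun i q hq1 hq => ?_⟩
  · have h1 : ∀ r, ∀ s ∈ Finset.Icc 1 (t r - 1), coeff 0 (Finset.univ.erase ζ)
        ((a r s • preΦ F n p r s + b r s • preΘ F n p r s) (dp F n i (p ^ q)) (xo F m ζ)) =
        a r s * (if r = i ∧ s = q then c else 0) := fun r s _ => by
      simp only [LinearMap.add_apply, LinearMap.smul_apply, map_add, map_smul, smul_eq_mul]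
      rw [coeff_preΦ_xo hn hp1 hζ, dp, preΘ_mono_xo, map_zero, mul_zero, add_zero]
    simp only [LinearMap.sub_apply, LinearMap.sum_apply, map_sub, map_sum]
    rw [Finset.sum_congr rfl fun r _ => Finset.sum_congr rfl (h1 r), sum_sum_mul_ite a c i hq1 hq,
      div_mul_cancel₀ _ hc, sub_self]
  · have h1 : ∀ r, ∀ s ∈ Finset.Icc 1 (t r - 1), coeff 0 Finset.univ
        ((a r s • preΦ F n p r s + b r s • preΘ F n p r s)
          (mul F (dp F n i (p ^ q)) (xe F n (conj i))) (xe F n i)) =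
        b r s * (if r = i ∧ s = q then tau F (conj i) else 0) := fun r s hs => by
      simp only [LinearMap.add_apply, LinearMap.smul_apply, map_add, map_smul, smul_eq_mul]
      rw [coeff_preΘ_xe hm2 hp1 i r q (Finset.mem_Icc.mp hs).1, preΦ_xe hn, map_zero, mul_zero,
        zero_add]
    simp only [LinearMap.sub_apply, LinearMap.sum_apply, map_sub, map_sum]
    rw [Finset.sum_congr rfl fun r _ => Finset.sum_congr rfl (h1 r),
      sum_sum_mul_ite b _ i hq1 hq, div_mul_cancel₀ _ (tau_ne_zero _), sub_self]

/-! ### Derivations of `𝒥` as maps on functions -/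

theorem evenO_of_idealO (p : ℕ) (t : Fin m → ℕ) : idealO F n p t ≤ evenO F n p t := by
  refine Submodule.span_mono ?_
  rintro f ⟨α, u, h1, h2, h3, -, h4⟩
  exact ⟨α, u, h1, h2, h3, h4⟩

/-- Composition with D_H gives a map on `idealO`. It is extended arbitrarily to all functions,
because only its values on `idealO` enter the conditions. -/
theorem exists_mem_outerDers (hm : Even m) (hn : Odd n) {p : ℕ} {t : Fin m → ℕ}
    (φ : J F n p t →ₗ[F] WOdd F n p t) (hder : IsDer φ) (htop : VanishesOnTop φ) :
    ∃ T ∈ outerDers F n p t, ∀ (f : SuperO F m n) (hf : f ∈ idealO F n p t),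
      T f = φ ⟨DH F f, Submodule.mem_map_of_mem hf⟩ := by
  obtain ⟨T, hT⟩ := LinearMap.exists_extend
    ((WOdd F n p t).subtype ∘ₗ φ ∘ₗ (DH F).submoduleMap (idealO F n p t))
  have hTf : ∀ (f : SuperO F m n) (hf : f ∈ idealO F n p t),
      T f = φ ⟨DH F f, Submodule.mem_map_of_mem hf⟩ := fun f hf =>
    LinearMap.congr_fun hT ⟨f, hf⟩
  refine ⟨T, ⟨fun f hf => ?_, fun f hf g hg h => ?_, fun α u h h2 => ?_⟩, hTf⟩
  · rw [hTf f hf]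
    exact WOdd_le_oddFields p t (φ _).2
  · rw [hTf f hf, hTf g hg, hTf _ h]
    exact hder ⟨DH F f, Submodule.mem_map_of_mem hf⟩ ⟨DH F g, Submodule.mem_map_of_mem hg⟩
      ⟨DH F (DH F f g), Submodule.mem_map_of_mem h⟩ (lie_DH hm (idealO_le_parityPart p t hf) (idealO_le_parityPart p t hg)).symm
  · have hf : mono F α u ∈ idealO F n p t := by
      refine Submodule.subset_span ⟨α, u, h.le, h.even, fun e => ?_, fun e => ?_, rfl⟩
      · have h1 := h.even
        rw [(Prod.mk.inj e).2, Finset.card_univ, Fintype.card_fin] at h1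
        exact (Nat.not_even_iff_odd.mpr hn) h1
      · exact h.ne (Prod.mk.inj e).2 (Prod.mk.inj e).1
    rw [hTf _ hf]
    -- A function of degree d + 2 gives a field of degree d: degree 0 is the constants, where D_H =
    -- 0, and degrees 1 and 2 give 𝒥_{-1} and 𝒥_0.
    obtain h0 | h0 | h0 : (∑ i, α i) + u.card = 0 ∨ (∑ i, α i) + u.card = 1 ∨
      (∑ i, α i) + u.card = 2 := by omega
    · have hu : u = ∅ := Finset.card_eq_zero.mp (by omega)
      have hα : α = 0 := by
        ext i
        exact Finset.sum_eq_zero_iff.mp (by omega : ∑ i, α i = 0) i (Finset.mem_univ i)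
      have hz : (⟨DH F (mono F α u), Submodule.mem_map_of_mem hf⟩ : J F n p t) = 0 := by
        apply Subtype.ext
        subst hu hα
        ext1 g
        change DH F (mono F 0 ∅) g = 0
        rw [DH_mono_empty]
        exact Finset.sum_eq_zero fun i _ => by rw [partialEven_mono_zero_left]; simp
      rw [hz, map_zero]; rfl
    · rw [htop _ (Or.inl (DH_mono_mem_WDeg p t h.le h.even (by rw [h0]; norm_num)))]; rfl
    · rw [htop _ (Or.inr (DH_mono_mem_WDeg p t h.le h.even (by rw [h0]; norm_num)))]; rfl

end HamSuper
end

/-! ### The description of the derivations -/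

theorem proposition4p7 {F : Type*} [Field F] [IsAlgClosed F] (p : ℕ) [Fact p.Prime] [CharP F p]
    (hp : 3 < p) (m n : ℕ) (hm : 0 < m) (hm2 : Even m) (hn : Odd n)
    (t : Fin m → ℕ) (ht : ∀ i, 0 < t i)
    (φ : HamSuper.J F n p t →ₗ[F] HamSuper.WOdd F n p t)
    (hder : HamSuper.IsDer φ) (hhom : HamSuper.IsHomog φ) (htop : HamSuper.VanishesOnTop φ) :
    ∃ (c : F) (a b : Fin m → ℕ → F), ∀ x : HamSuper.J F n p t,
      (φ x : HamSuper.EndO F m n) =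
        c • ⁅HamSuper.frakD F m hn.pos, (x : HamSuper.EndO F m n)⁆ +
        ∑ r : Fin m, ∑ s ∈ Finset.Icc 1 (t r - 1),
          (a r s • HamSuper.Φ F n p t r s ⟨x, HamSuper.J_le_HEven F n p t x.2⟩ +
           b r s • HamSuper.Θ F n p t r s ⟨x, HamSuper.J_le_HEven F n p t x.2⟩) := by
  open HamSuper in
  obtain ⟨T, hT, hTφ⟩ := exists_mem_outerDers hm2 hn φ hder htop
  obtain ⟨ζ, a, b, H⟩ := exists_isNormalizedDer_sub p hp hm hm2 hn ht hT
  -- The normalized difference vanishes outright, so no multiple of ad 𝔇 is needed.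
  refine ⟨0, a, b, ?_⟩
  rintro ⟨_, f, hf, rfl⟩
  rw [zero_smul, zero_add, ← hTφ f hf]
  have h := H.eq_zero hf
  rw [LinearMap.sub_apply, sub_eq_zero] at h
  rw [h]
  simp only [LinearMap.sum_apply, LinearMap.add_apply, LinearMap.smul_apply]
  refine Finset.sum_congr rfl fun r _ => Finset.sum_congr rfl fun s _ => ?_
  have h1 := Φ_apply F n p t r s (evenO_of_idealO p t hf)
  have h2 : Θ F n p t r s ⟨DH F f, Submodule.mem_map_of_mem (evenO_of_idealO p t hf)⟩ =
      preΘ F n p r s f :=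
    congrArg (leftMul F (xOmega F n)) (adOp_pow_DH hm2 r (p ^ s) (idealO_le_parityPart p t hf))
  rw [h1, h2, preΦ_apply]
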